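/- **Setting.** Let $U\subset\mathbb C\times\mathbb R$ be open and connected (non-empty), let $f(\zeta,u)$ be one of the functions below, and consider the vacuum pp-wave metric $$ds^2=2\,d\zeta\,d\bar\zeta-2\,du\,dv-(f+\bar f)\,du^2$$ on $M=\{(\zeta,u,v):(\zeta,u)\in U,\ v\in\mathbb R\}$. Let $(\delta,\delta^*,D,\Delta)=(m,\bar m,\ell,n)$ be a smooth null tetrad on $M$ (so $g(m,\bar m)=1$, $g(\ell,n)=-1$, all other products zero, $\ell,n$ real) with $\ell$ parallel to $\partial_v$, with $m$ having no $\partial_{\bar\zeta}$-component, and normalized by $\Psi_4=1$, $\gamma=0$; assume $\alpha\neq0$ everywhere. Here, with $\nabla$ the Levi-Civita connection and $R(x,y)=[\nabla_x,\nabla_y]-\nabla_{[x,y]}$, $$\alpha=-\tfrac12\big(g(m,\nabla_{\bar m}\bar m)+g(n,\nabla_{\bar m}\ell)\big),\quad \gamma=-\tfrac12\big(g(m,\nabla_n\bar m)+g(n,\nabla_n\ell)\big),$$ $$\mu=g(\bar m,\nabla_m n),\quad \nu=g(\bar m,\nabla_n n),\quad \Psi_4=g(\bar m,R(\bar m,n)n).$$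 A star is complex conjugation. Put $$A=\frac{\delta^*\alpha}{\alpha^2},\quad B=\mu A-\mu^*=B_1+iB_2,\quad Y=(3-A)\nu-\frac1\alpha+\frac{\Delta\mu+\mu^2}{\alpha^*},$$ and, where $AA^*\ne1$, $$X=\frac{B}{AA^*-1}=X_1+iX_2,\quad \hat\nu=\nu+\frac{X(\mu+2X^*)}{\alpha^*},\quad \hat\Upsilon=\Delta\!\Big(\frac{\hat\nu}{X^*}\Big)-2\hat\nu+\frac1\alpha-\frac{4iXX_2}{\alpha^*}.$$ Assume that the metric is of type $(0,2)$: $d\alpha\wedge d\alpha^*\neq0$ at every point of $M$. Call the metric a *$G_2$ solution* if the real vector space of smooth Killing vector fields on $M$ has dimension exactly $2$. Let $J\subset\mathbb R$ be the set of values of $u$ on $U$ (an open interval). Below, $F$ is holomorphic on an open set $W\subset\mathbb C$, and $g,g_1,g_2:J\to\mathbb C$ are smooth. "$=$" between functions means equality everywhere on their domain. **Statement.** In each of the following four precursor classes the listed invariant relations hold at every point of $M$, and the five listed conditions are equivalent. * **Class $\mathrm B_{23}$.** $f=F(u^{-ik}\zeta)u^{-2}+g(u)\,u^{-2-ik}\zeta$,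 where $k\in\mathbb R$, and $u>0$, $u^{-ik}\zeta\in W$ on $U$. Then $AA^*\neq1$, $B_1\ne0$, $B_2/B_1=k$, $\Delta X_1=2X_1^2$, and the following are equivalent: (0) the metric is a $G_2$ solution; (i) $d\alpha\wedge d\alpha^*\wedge d\nu=0$; (ii) $\hat\Upsilon=0$; (iii) $g'=0$ on $J$; (iv) $f(\zeta,u)=G(u^{-ik}\zeta)u^{-2}$ on $U$ for some holomorphic $G$ on $W$ (class $\mathrm B_{22}$). * **Class $\mathrm C_{23}$.** $f=F(e^{iu}\zeta)+g(u)\,e^{iu}\zeta$, where $e^{iu}\zeta\in W$ on $U$. Then $AA^*\neq1$, $\mu\ne0$, $B_1=0$, $\Delta X_2=0$, and the following are equivalent: (0) the metric is a $G_2$ solution; (i) $d\alpha\wedge d\alpha^*\wedge d\nu=0$; (ii) $\hat\Upsilon=0$; (iii) $g'=0$ on $J$; (iv) $f(\zeta,u)=G(e^{iu}\zeta)$ on $U$ for some holomorphic $G$ on $W$ (class $\mathrm C_{22}$). * **Class $\mathrm L_{23}$.** $f=g_1(u)\log\zeta+g_2(u)\zeta$, where $\zeta\in W$ on $U$ and $\log$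 is a continuous branch of the logarithm on the open set $W$. Then $A=1$, and the following are equivalent: (0) the metric is a $G_2$ solution; (i) $d\alpha\wedge d\alpha^*\wedge d\nu=0$; (ii) $Y=0$; (iii) $g_2=0$ on $J$; (iv) $f(\zeta,u)=g(u)\log\zeta$ on $U$ for some smooth $g:J\to\mathbb C$ (class $\mathrm L_{22}$). * **Class $\mathrm A_{23}$.** $f=F(\zeta)+g(u)\zeta$, where $\zeta\in W$ on $U$. Then $\mu=0$, and the following are equivalent: (0) the metric is a $G_2$ solution; (i) $d\alpha\wedge d\alpha^*\wedge d\nu=0$; (ii) $\Delta\nu=0$; (iii) $g'=0$ on $J$; (iv) $f(\zeta,u)=G(\zeta)$ on $U$ for some holomorphic $G$ on $W$ (class $\mathrm A_{22}$). -/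

import Mathlib

open scoped ContDiff ComplexConjugate

noncomputable section

namespace PPWave

/-! ## Points, coordinates and coordinate derivatives

A point is `(ζ, u, v)` with `ζ` complex and `u`, `v` real.  Complexified tangent vectors are given by
their four components in the basis `∂_ζ, ∂_ζ̄, ∂_u, ∂_v` (indices `0, 1, 2, 3`), where
`∂_ζ, ∂_ζ̄` are the Wirtinger derivatives. -/

/-- The coordinate space of `(ζ, u, v)`. -/
abbrev Pt : Type := ℂ × ℝ × ℝ

/-- Complex valued scalar functions. -/
abbrev Scalar : Type := Pt → ℂ

/-- Complexified vector fields, by components in `∂_ζ, ∂_ζ̄, ∂_u, ∂_v`. -/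
abbrev VField : Type := Pt → Fin 4 → ℂ

/-- Real directional derivative of a scalar. -/
def dir (w : Pt) (φ : Scalar) (p : Pt) : ℂ := fderiv ℝ φ p w

/-- The coordinate derivatives `∂_ζ, ∂_ζ̄, ∂_u, ∂_v`. -/
def pd : Fin 4 → Scalar → Scalar :=
  ![fun φ p => (dir (1, 0, 0) φ p - Complex.I * dir (Complex.I, 0, 0) φ p) / 2,
    fun φ p => (dir (1, 0, 0) φ p + Complex.I * dir (Complex.I, 0, 0) φ p) / 2,
    dir (0, 1, 0),
    dir (0, 0, 1)]

/-- Complex conjugate of a scalar. -/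
def cj (φ : Scalar) : Scalar := fun p => conj (φ p)

/-- Complex conjugate of a complexified vector field. -/
def cjV (X : VField) : VField :=
  fun p => ![conj (X p 1), conj (X p 0), conj (X p 2), conj (X p 3)]

/-- The derivation of scalars defined by a complexified vector field. -/
def act (X : VField) (φ : Scalar) : Scalar := fun p => ∑ i, X p i * pd i φ p

/-- The component of `dφ₁ ∧ ⋯ ∧ dφᵣ` at `p` along the coordinate indices `J 0, …, J (r - 1)`.  The
`r`-form vanishes at `p` exactly if this function of `J` is zero. -/
def wedgeD {r : ℕ} (φ : Fin r → Scalar) (p : Pt) : (Fin r → Fin 4) → ℂ :=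
  fun J => (Matrix.of fun i j => pd (J j) (φ i) p).det

/-- The spacetime domain: all `(ζ, u, v)` with `(ζ, u) ∈ U`. -/
def dom (U : Set (ℂ × ℝ)) : Set Pt := {p | (p.1, p.2.1) ∈ U}

/-- The range of the coordinate `u` on the domain. -/
def uRange (U : Set (ℂ × ℝ)) : Set ℝ := Prod.snd '' U

/-! ## The metric, its Levi-Civita connection and its curvature -/

section Geometry

variable (f : ℂ → ℝ → ℂ)

/-- The metric `2 dζ dζ̄ - 2 du dv - (f + f̄) du²`. -/
def metric (p : Pt) : Matrix (Fin 4) (Fin 4) ℂ :=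
  !![0, 1, 0, 0;
     1, 0, 0, 0;
     0, 0, -(f p.1 p.2.1 + conj (f p.1 p.2.1)), -1;
     0, 0, -1, 0]

/-- The metric as a complex bilinear form at `p`. -/
def ip (p : Pt) (x y : Fin 4 → ℂ) : ℂ := ∑ i, ∑ j, metric f p i j * x i * y j

/-- The Christoffel symbol `Γ^k_{ij}`. -/
def christoffel (k i j : Fin 4) : Scalar := fun p =>
  (1 / 2) * ∑ l, (metric f p)⁻¹ k l *
    (pd i (fun q => metric f q l j) p + pd j (fun q => metric f q l i) p
      - pd l (fun q => metric f q i j) p)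

/-- The covariant derivative `∇_X Y` of the Levi-Civita connection. -/
def cov (X Y : VField) : VField := fun p k =>
  ∑ i, X p i * (pd i (fun q => Y q k) p + ∑ j, christoffel f k i j p * Y p j)

/-- The components `R^k_{lij}` of the curvature `R(∂ᵢ, ∂ⱼ) ∂ₗ = ∇ᵢ∇ⱼ∂ₗ - ∇ⱼ∇ᵢ∂ₗ`. -/
def riemann (k l i j : Fin 4) : Scalar := fun p =>
  pd i (christoffel f k j l) p - pd j (christoffel f k i l) p
    + ∑ s, (christoffel f k i s p * christoffel f s j l p
      - christoffel f k j s p * christoffel f s i l p)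

/-- The vector `R(x, y) z` at `p`. -/
def curv (p : Pt) (x y z : Fin 4 → ℂ) : Fin 4 → ℂ := fun k =>
  ∑ l, ∑ i, ∑ j, riemann f k l i j p * z l * x i * y j

/-- Reality of a vector field at a point. -/
def IsRealAt (X : VField) (p : Pt) : Prop := cjV X p = X p

/-- A smooth real vector field on `Ω` is Killing if the Lie derivative of the metric vanishes. -/
structure IsKilling (Ω : Set Pt) (ξ : VField) : Prop where
  smooth : ContDiffOn ℝ ∞ ξ Ω
  real : ∀ p ∈ Ω, IsRealAt ξ p
  lie : ∀ p ∈ Ω, ∀ i j : Fin 4,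
    ∑ k, (ξ p k * pd k (fun q => metric f q i j) p
      + metric f p k j * pd i (fun q => ξ q k) p
      + metric f p i k * pd j (fun q => ξ q k) p) = 0

end Geometry

/-! ## Null tetrads and Newman-Penrose quantities -/

/-- A tetrad `(m, m̄, ℓ, n) = (δ, δ*, D, Δ)`; only `m`, `ℓ`, `n` are recorded. -/
structure Tetrad where
  m : VField
  l : VField
  n : VField

namespace Tetrad

variable (f : ℂ → ℝ → ℂ) (e : Tetrad)

/-- The complex conjugate leg `m̄`. -/
def mb : VField := cjV e.m

/-- `(m, m̄, ℓ, n)` is a smooth null tetrad on `Ω`: the metric is `2θ¹θ² - 2θ³θ⁴` in the coframe dual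
to `(m, m̄, n, ℓ)`. -/
structure IsNull (Ω : Set Pt) : Prop where
  smooth_m : ContDiffOn ℝ ∞ e.m Ω
  smooth_l : ContDiffOn ℝ ∞ e.l Ω
  smooth_n : ContDiffOn ℝ ∞ e.n Ω
  real_l : ∀ p ∈ Ω, IsRealAt e.l p
  real_n : ∀ p ∈ Ω, IsRealAt e.n p
  m_mb : ∀ p ∈ Ω, ip f p (e.m p) (e.mb p) = 1
  l_n : ∀ p ∈ Ω, ip f p (e.l p) (e.n p) = -1
  m_m : ∀ p ∈ Ω, ip f p (e.m p) (e.m p) = 0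
  m_l : ∀ p ∈ Ω, ip f p (e.m p) (e.l p) = 0
  m_n : ∀ p ∈ Ω, ip f p (e.m p) (e.n p) = 0
  l_l : ∀ p ∈ Ω, ip f p (e.l p) (e.l p) = 0
  n_n : ∀ p ∈ Ω, ip f p (e.n p) (e.n p) = 0

/-- The spin coefficient `α`. -/
def al : Scalar := fun p =>
  -(ip f p (e.m p) (cov f e.mb e.mb p) + ip f p (e.n p) (cov f e.mb e.l p)) / 2

/-- The spin coefficient `γ`. -/
def ga : Scalar := fun p =>
  -(ip f p (e.m p) (cov f e.n e.mb p) + ip f p (e.n p) (cov f e.n e.l p)) / 2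

/-- The spin coefficient `μ`. -/
def mu : Scalar := fun p => ip f p (e.mb p) (cov f e.m e.n p)

/-- The spin coefficient `ν`. -/
def nu : Scalar := fun p => ip f p (e.mb p) (cov f e.n e.n p)

/-- The curvature component `Ψ₄ = g(m̄, R(m̄, n) n)`. -/
def psi4 : Scalar := fun p => ip f p (e.mb p) (curv f p (e.mb p) (e.n p) (e.n p))

/-- The invariant tetrad of the branch `α ≠ 0`: a null tetrad with `ℓ` along the covariantly constant
null vector `∂_v` and `m` without `∂_ζ̄` component (this fixes the orientation), normalized by
`Ψ₄ = 1`, `γ = 0`. -/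
structure IsInvariant (Ω : Set Pt) : Prop where
  null : e.IsNull f Ω
  aligned : ∀ p ∈ Ω, e.l p 0 = 0 ∧ e.l p 1 = 0 ∧ e.l p 2 = 0
  oriented : ∀ p ∈ Ω, e.m p 1 = 0
  psi4_eq : ∀ p ∈ Ω, e.psi4 f p = 1
  ga_eq : ∀ p ∈ Ω, e.ga f p = 0
  al_ne : ∀ p ∈ Ω, e.al f p ≠ 0

/-! ### The Cartan invariants -/

/-- `A = δ*α / α²`. -/
def A : Scalar := fun p => act e.mb (e.al f) p / e.al f p ^ 2

/-- `B = μ A - μ*`. -/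
def B : Scalar := fun p => e.mu f p * e.A f p - conj (e.mu f p)

/-- `X = B / (A A* - 1)`, meaningful where `A A* ≠ 1`. -/
def X : Scalar := fun p => e.B f p / (e.A f p * conj (e.A f p) - 1)

/-- `X₁ = Re X`, as a complex valued scalar. -/
def X1 : Scalar := fun p => ((e.X f p).re : ℂ)

/-- `X₂ = Im X`, as a complex valued scalar. -/
def X2 : Scalar := fun p => ((e.X f p).im : ℂ)

/-- `Y = (3 - A) ν - 1/α + (Δμ + μ²)/α*`. -/
def Y : Scalar := fun p =>
  (3 - e.A f p) * e.nu f p - 1 / e.al f p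
    + (act e.n (e.mu f) p + e.mu f p ^ 2) / conj (e.al f p)

/-- `ν̂ = ν + X (μ + 2X*)/α*`. -/
def nuHat : Scalar := fun p =>
  e.nu f p + e.X f p * (e.mu f p + 2 * conj (e.X f p)) / conj (e.al f p)

/-- `Υ̂ = Δ(ν̂/X*) - 2ν̂ + 1/α - 4i X X₂/α*`. -/
def upsHat : Scalar := fun p =>
  act e.n (fun q => e.nuHat f q / conj (e.X f q)) p - 2 * e.nuHat f p + 1 / e.al f p
    - 4 * Complex.I * e.X f p * e.X2 f p / conj (e.al f p)

/-- Type `(0, 2)`: `dα ∧ dα* ≠ 0` at every point. -/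
def IsType02 (Ω : Set Pt) : Prop :=
  ∀ p ∈ Ω, wedgeD ![e.al f, cj (e.al f)] p ≠ 0

/-- `dα ∧ dα* ∧ dν = 0` at every point. -/
def NuDependent (Ω : Set Pt) : Prop :=
  ∀ p ∈ Ω, wedgeD ![e.al f, cj (e.al f), e.nu f] p = 0

end Tetrad

/-! ## Killing algebra -/

theorem pd_add {φ ψ : Scalar} {p : Pt} (hφ : DifferentiableAt ℝ φ p)
    (hψ : DifferentiableAt ℝ ψ p) (i : Fin 4) :
    pd i (fun q => φ q + ψ q) p = pd i φ p + pd i ψ p := by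
  have h : ∀ w, dir w (fun q => φ q + ψ q) p = dir w φ p + dir w ψ p := by
    intro w
    simp only [dir]
    rw [fderiv_fun_add hφ hψ]
    rfl
  fin_cases i <;> simp [pd, h] <;> ring

theorem pd_smul {φ : Scalar} {p : Pt} (hφ : DifferentiableAt ℝ φ p) (c : ℝ) (i : Fin 4) :
    pd i (fun q => c • φ q) p = c • pd i φ p := by
  have h : ∀ w, dir w (fun q => c • φ q) p = c • dir w φ p := by
    intro w
    simp only [dir]
    rw [fderiv_fun_const_smul hφ c]
    rfl
  simp only [Complex.real_smul] at h ⊢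
  fin_cases i <;> simp [pd, h] <;> ring

/-- The real vector space of Killing vector fields on the open set `Ω` (extended by `0` outside
`Ω`). -/
def killingAlgebra (f : ℂ → ℝ → ℂ) (Ω : Set Pt) (hΩ : IsOpen Ω) : Submodule ℝ VField where
  carrier := {ξ | IsKilling f Ω ξ ∧ ∀ p ∉ Ω, ξ p = 0}
  zero_mem' := by
    refine ⟨⟨contDiffOn_const, ?_, ?_⟩, fun _ _ => rfl⟩
    · intro p _
      funext i
      fin_cases i <;> simp [cjV]
    · intro p _ i j
      have h : ∀ k, pd k (fun _ => (0 : ℂ)) p = 0 := by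
        intro k
        fin_cases k <;> simp [pd, dir]
      simp [h]
  add_mem' := by
    rintro ξ η ⟨hξ, hξ0⟩ ⟨hη, hη0⟩
    refine ⟨⟨hξ.smooth.add hη.smooth, ?_, ?_⟩, ?_⟩
    · intro p hp
      have h1 := hξ.real p hp
      have h2 := hη.real p hp
      funext i
      have h1i := congrFun h1 i
      have h2i := congrFun h2 i
      fin_cases i <;> simp_all [cjV]
    · intro p hp i j
      have d1 : ∀ k, DifferentiableAt ℝ (fun q => ξ q k) p := fun k =>
        differentiableAt_pi.1
          ((hξ.smooth.contDiffAt (hΩ.mem_nhds hp)).differentiableAt (by simp)) k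
      have d2 : ∀ k, DifferentiableAt ℝ (fun q => η q k) p := fun k =>
        differentiableAt_pi.1
          ((hη.smooth.contDiffAt (hΩ.mem_nhds hp)).differentiableAt (by simp)) k
      have h1 := hξ.lie p hp i j
      have h2 := hη.lie p hp i j
      have h := congrArg₂ (· + ·) h1 h2
      simp only [← Finset.sum_add_distrib, add_zero] at h
      rw [← h]
      refine Finset.sum_congr rfl fun k _ => ?_
      simp only [Pi.add_apply]
      rw [pd_add (d1 k) (d2 k), pd_add (d1 k) (d2 k)]
      ring
    · intro p hp
      simp [hξ0 p hp, hη0 p hp]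
  smul_mem' := by
    rintro c ξ ⟨hξ, hξ0⟩
    refine ⟨⟨hξ.smooth.const_smul c, ?_, ?_⟩, ?_⟩
    · intro p hp
      have h1 := hξ.real p hp
      funext i
      have h1i := congrFun h1 i
      fin_cases i <;> simp_all [cjV]
    · intro p hp i j
      have d1 : ∀ k, DifferentiableAt ℝ (fun q => ξ q k) p := fun k =>
        differentiableAt_pi.1
          ((hξ.smooth.contDiffAt (hΩ.mem_nhds hp)).differentiableAt (by simp)) k
      have h := congrArg (fun z => (c : ℂ) * z) (hξ.lie p hp i j)
      simp only [mul_zero, Finset.mul_sum] at h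
      rw [← h]
      refine Finset.sum_congr rfl fun k _ => ?_
      simp only [Pi.smul_apply]
      rw [pd_smul (d1 k), pd_smul (d1 k)]
      simp only [Complex.real_smul]
      ring
    · intro p hp
      simp [hξ0 p hp]

theorem isOpen_dom {U : Set (ℂ × ℝ)} (hU : IsOpen U) : IsOpen (dom U) :=
  hU.preimage (by fun_prop : Continuous fun p : Pt => (p.1, p.2.1))

/-- A `G₂` solution: the Killing vector fields form a vector space of dimension exactly two. -/
def IsG2 (f : ℂ → ℝ → ℂ) (U : Set (ℂ × ℝ)) (hU : IsOpen U) : Prop :=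
  Module.finrank ℝ (killingAlgebra f (dom U) (isOpen_dom hU)) = 2

/-! ## The four precursor classes -/

/-- `f = F(u^{-ik} ζ) u⁻² + g(u) u^{-2-ik} ζ`, for `u > 0`. -/
def potB (k : ℝ) (F : ℂ → ℂ) (g : ℝ → ℂ) : ℂ → ℝ → ℂ := fun ζ u =>
  F ((u : ℂ) ^ (-(Complex.I * k)) * ζ) * (u : ℂ) ^ (-2 : ℂ)
    + g u * (u : ℂ) ^ (-2 - Complex.I * k) * ζ

/-- `f = F(e^{iu} ζ) + g(u) e^{iu} ζ`. -/
def potC (F : ℂ → ℂ) (g : ℝ → ℂ) : ℂ → ℝ → ℂ := fun ζ u =>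
  F (Complex.exp (Complex.I * u) * ζ) + g u * Complex.exp (Complex.I * u) * ζ

/-- `f = g₁(u) log ζ + g₂(u) ζ`, for a branch `lg` of the logarithm. -/
def potL (lg : ℂ → ℂ) (g₁ g₂ : ℝ → ℂ) : ℂ → ℝ → ℂ := fun ζ u => g₁ u * lg ζ + g₂ u * ζ

/-- `f = F(ζ) + g(u) ζ`. -/
def potA (F : ℂ → ℂ) (g : ℝ → ℂ) : ℂ → ℝ → ℂ := fun ζ u => F ζ + g u * ζ

end PPWave

end

/-! Write f', f'', f''' for the ζ-derivatives of the potential (`f1`, `f2`, `f3`), a for the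
u-component of n, w for the ζ-component of m, z = -f''_u/f''' (`zz`) and L = f''/f''' (`il`). The
conditions Ψ₄ = 1 and γ = 0 say that (a w̄)² conj(f'') = 2 and that n has ζ-component a z.
Consequently α = w̄/(4 L̄), A = -1 - 4 conj(L_ζ) and μ = a z_ζ depend on f'' only, whereas ν = w̄ a²
(z_u + z z_ζ + conj(f')/2) also sees f'.

Let V = (e₀u + d₀)∂_u + iω₀(ζ∂_ζ - ζ̄∂_ζ̄). Every precursor potential satisfies V f + 2e₀ f = t(u) +
r(u)ζ (`AffineSym`), with (e₀, d₀, ω₀) equal to (1, 0, k), (0, 1, -1), (0, 0, 1), (0, 1, 0) in the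
classes B, C, L, A. The coefficient r is a nowhere vanishing multiple of g', or of g₂ in class L.
All five conditions turn out to mean r = 0.

Two ζ-derivatives remove the affine term, so f'' is an eigenfunction of V, and so is everything
built from it (`Weight`). In particular Vα = Vα* = 0, while Vν = w̄ a² r̄/2. As V is nonzero and dα
∧ dα* ≠ 0, the triple wedge vanishes exactly if Vν = 0 (`AffineSym.nuDependent_iff`). Direct
computation shows that Υ̂, Y and Δν, each in its class, are nonvanishing multiples of r̄
(`AffineSym.upsHat_iff`, `AffineSym.Y_iff`, `AffineSym.act_nu_iff`).

For the Killing algebra, the Killing equations are integrated (`IsKilling.exists_form`). Type (0,2)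
then forces the ζ- and u-components of a Killing field to be those of cV with c a real constant
(`AffineSym.rigid`, `AffineSym.rotation_rigid`), and the remaining equation gives c r = 0. Since ∂_v
is always Killing, the dimension is 2 if r = 0 and 1 otherwise (`AffineSym.isG2_iff`). Finally, r is
determined by f and V (`AffineSym.unique`), so a second representation of f without the extra term
forces r = 0. -/

noncomputable section

namespace PPWave


/-! ## Calculus of the coordinate derivatives -/

/-- The components of a real linear form on `Pt` in the basis `∂_ζ, ∂_ζ̄, ∂_u, ∂_v`. -/
def comp4 (L : Pt →L[ℝ] ℂ) : Fin 4 → ℂ :=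
  ![(L (1, 0, 0) - Complex.I * L (Complex.I, 0, 0)) / 2,
    (L (1, 0, 0) + Complex.I * L (Complex.I, 0, 0)) / 2, L (0, 1, 0), L (0, 0, 1)]

theorem pd_eq_comp4 (φ : Scalar) (p : Pt) (i : Fin 4) : pd i φ p = comp4 (fderiv ℝ φ p) i := by
  fin_cases i <;> rfl

/-- `φ` is real differentiable at `p` with coordinate derivatives `d`. -/
structure HasPD (φ : Scalar) (d : Fin 4 → ℂ) (p : Pt) : Prop where
  diff : DifferentiableAt ℝ φ p
  eq : ∀ i, pd i φ p = d i

theorem HasPD.of_fderiv {φ : Scalar} {L : Pt →L[ℝ] ℂ} {p : Pt} (h : HasFDerivAt φ L p) :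
    HasPD φ (comp4 L) p :=
  ⟨h.differentiableAt, fun i => by rw [pd_eq_comp4, h.fderiv]⟩

theorem HasPD.of_diff {φ : Scalar} {p : Pt} (h : DifferentiableAt ℝ φ p) :
    HasPD φ (fun i => pd i φ p) p := ⟨h, fun _ => rfl⟩

theorem HasPD.change {φ : Scalar} {d d' : Fin 4 → ℂ} {p : Pt} (h : HasPD φ d p)
    (hd : ∀ i, d i = d' i) : HasPD φ d' p := ⟨h.diff, fun i => (h.eq i).trans (hd i)⟩

theorem pd_congr {φ ψ : Scalar} {Ω : Set Pt} (hΩ : IsOpen Ω) (h : ∀ q ∈ Ω, φ q = ψ q) {p : Pt}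
    (hp : p ∈ Ω) (i : Fin 4) : pd i φ p = pd i ψ p := by
  have : φ =ᶠ[nhds p] ψ := by
    filter_upwards [hΩ.mem_nhds hp] with q hq using h q hq
  rw [pd_eq_comp4, pd_eq_comp4, this.fderiv_eq]

theorem HasPD.congr {φ ψ : Scalar} {Ω : Set Pt} (hΩ : IsOpen Ω) {d : Fin 4 → ℂ} {p : Pt}
    (h : HasPD φ d p) (he : ∀ q ∈ Ω, ψ q = φ q) (hp : p ∈ Ω) : HasPD ψ d p := by
  have : ψ =ᶠ[nhds p] φ := by
    filter_upwards [hΩ.mem_nhds hp] with q hq using he q hq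
  exact ⟨h.diff.congr_of_eventuallyEq this, fun i => by rw [pd_congr hΩ he hp, h.eq]⟩

theorem HasPD.const (c : ℂ) (p : Pt) : HasPD (fun _ => c) (fun _ => 0) p :=
  (HasPD.of_fderiv (hasFDerivAt_const c p)).change fun i => by
    fin_cases i <;> simp [comp4]

theorem HasPD.add {φ ψ : Scalar} {d d' : Fin 4 → ℂ} {p : Pt} (h : HasPD φ d p)
    (h' : HasPD ψ d' p) : HasPD (fun q => φ q + ψ q) (fun i => d i + d' i) p :=
  ⟨h.diff.add h'.diff, fun i => by rw [pd_add h.diff h'.diff, h.eq, h'.eq]⟩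

theorem HasPD.mul {φ ψ : Scalar} {d d' : Fin 4 → ℂ} {p : Pt} (h : HasPD φ d p)
    (h' : HasPD ψ d' p) :
    HasPD (fun q => φ q * ψ q) (fun i => d i * ψ p + φ p * d' i) p := by
  refine (HasPD.of_fderiv (h.diff.hasFDerivAt.mul h'.diff.hasFDerivAt)).change fun i => ?_
  rw [← h.eq, ← h'.eq, pd_eq_comp4, pd_eq_comp4]
  fin_cases i <;> simp [comp4] <;> ring

theorem HasPD.const_mul (c : ℂ) {φ : Scalar} {d : Fin 4 → ℂ} {p : Pt} (h : HasPD φ d p) :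
    HasPD (fun q => c * φ q) (fun i => c * d i) p :=
  ((HasPD.const c p).mul h).change fun i => by simp

theorem HasPD.neg {φ : Scalar} {d : Fin 4 → ℂ} {p : Pt} (h : HasPD φ d p) :
    HasPD (fun q => -φ q) (fun i => -d i) p := by
  simpa using h.const_mul (-1)

theorem HasPD.sub {φ ψ : Scalar} {d d' : Fin 4 → ℂ} {p : Pt} (h : HasPD φ d p)
    (h' : HasPD ψ d' p) : HasPD (fun q => φ q - ψ q) (fun i => d i - d' i) p := by
  simpa [sub_eq_add_neg] using h.add h'.neg

/-- Chain rule for a holomorphic function of a scalar. -/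
theorem HasPD.comp {φ : Scalar} {d : Fin 4 → ℂ} {p : Pt} (h : HasPD φ d p) {F : ℂ → ℂ} {F' : ℂ}
    (hF : HasDerivAt F F' (φ p)) : HasPD (fun q => F (φ q)) (fun i => F' * d i) p := by
  have h1 := hF.hasFDerivAt.restrictScalars ℝ
  refine (HasPD.of_fderiv (h1.comp p h.diff.hasFDerivAt)).change fun i => ?_
  rw [← h.eq, pd_eq_comp4]
  fin_cases i <;> simp [comp4] <;> ring

theorem HasPD.inv {φ : Scalar} {d : Fin 4 → ℂ} {p : Pt} (h : HasPD φ d p) (h0 : φ p ≠ 0) :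
    HasPD (fun q => (φ q)⁻¹) (fun i => -d i / φ p ^ 2) p :=
  (h.comp (hasDerivAt_inv h0)).change fun i => by ring

theorem HasPD.div {φ ψ : Scalar} {d d' : Fin 4 → ℂ} {p : Pt} (h : HasPD φ d p)
    (h' : HasPD ψ d' p) (h0 : ψ p ≠ 0) :
    HasPD (fun q => φ q / ψ q) (fun i => (d i * ψ p - φ p * d' i) / ψ p ^ 2) p := by
  simp only [div_eq_mul_inv]
  refine (h.mul (h'.inv h0)).change fun i => ?_
  field_simp
  ring

/-- The components of the conjugate of a complexified covector. -/
def cjD (d : Fin 4 → ℂ) : Fin 4 → ℂ := ![conj (d 1), conj (d 0), conj (d 2), conj (d 3)]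

theorem HasPD.cj {φ : Scalar} {d : Fin 4 → ℂ} {p : Pt} (h : HasPD φ d p) :
    HasPD (fun q => conj (φ q)) (cjD d) p := by
  have h1 : HasFDerivAt (fun z : ℂ => conj z) (Complex.conjCLE : ℂ →L[ℝ] ℂ) (φ p) :=
    Complex.conjCLE.hasFDerivAt
  refine (HasPD.of_fderiv (h1.comp p h.diff.hasFDerivAt)).change fun i => ?_
  have e : d = fun i => comp4 (fderiv ℝ φ p) i := by
    funext i
    rw [← h.eq, pd_eq_comp4]
  rw [e]
  have h2 : conj (2 : ℂ) = 2 := Complex.conj_ofNat 2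
  fin_cases i <;> simp [comp4, cjD, h2]
  all_goals ring

theorem HasPD.zeta (p : Pt) : HasPD (fun q => q.1) ![1, 0, 0, 0] p := by
  refine (HasPD.of_fderiv (hasFDerivAt_fst (p := p))).change fun i => ?_
  fin_cases i <;> simp [comp4]

/-- A function of the coordinate `u`. -/
theorem HasPD.ofU {g : ℝ → ℂ} {g' : ℂ} {p : Pt} (h : HasDerivAt g g' p.2.1) :
    HasPD (fun q => g q.2.1) ![0, 0, g', 0] p := by
  have h1 : HasFDerivAt (fun q : Pt => q.2.1)
      ((ContinuousLinearMap.fst ℝ ℝ ℝ).comp (ContinuousLinearMap.snd ℝ ℂ (ℝ × ℝ))) p :=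
    ((ContinuousLinearMap.fst ℝ ℝ ℝ).comp (ContinuousLinearMap.snd ℝ ℂ (ℝ × ℝ))).hasFDerivAt
  refine (HasPD.of_fderiv (h.hasFDerivAt.comp p h1)).change fun i => ?_
  fin_cases i <;> simp [comp4]

theorem HasPD.u (p : Pt) : HasPD (fun q => (q.2.1 : ℂ)) ![0, 0, 1, 0] p :=
  HasPD.ofU (g := fun x => (x : ℂ)) (Complex.ofRealCLM.hasDerivAt (x := p.2.1))

theorem HasPD.v (p : Pt) : HasPD (fun q => (q.2.2 : ℂ)) ![0, 0, 0, 1] p := by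
  let L : Pt →L[ℝ] ℂ := Complex.ofRealCLM.comp
    ((ContinuousLinearMap.snd ℝ ℝ ℝ).comp (ContinuousLinearMap.snd ℝ ℂ (ℝ × ℝ)))
  refine (HasPD.of_fderiv (L.hasFDerivAt (x := p))).change fun i => ?_
  fin_cases i <;> simp [comp4, L]

/-- Smooth scalars on `Ω`. -/
abbrev Smooth (Ω : Set Pt) (φ : Scalar) : Prop := ContDiffOn ℝ ∞ φ Ω

/-! ### Smooth scalars: symmetry of second derivatives and constancy. -/

section Smoothness

variable {Ω : Set Pt} (hΩ : IsOpen Ω) {φ : Scalar}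

include hΩ

theorem Smooth.diffAt (h : Smooth Ω φ) {p : Pt} (hp : p ∈ Ω) : DifferentiableAt ℝ φ p :=
  (h.contDiffAt (hΩ.mem_nhds hp)).differentiableAt (by simp)

theorem Smooth.hasPD (h : Smooth Ω φ) {p : Pt} (hp : p ∈ Ω) : HasPD φ (fun i => pd i φ p) p :=
  HasPD.of_diff (h.diffAt hΩ hp)

theorem Smooth.dir (h : Smooth Ω φ) (w : Pt) : Smooth Ω (dir w φ) := by
  have := h.fderiv_of_isOpen (m := ∞) hΩ (by simp)
  exact this.clm_apply contDiffOn_const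

theorem Smooth.pd (h : Smooth Ω φ) (i : Fin 4) : Smooth Ω (pd i φ) := by
  have hd := fun w => Smooth.dir hΩ h w
  fin_cases i
  · exact ((hd _).sub (contDiffOn_const.mul (hd _))).div_const 2
  · exact ((hd _).add (contDiffOn_const.mul (hd _))).div_const 2
  · exact hd _
  · exact hd _

theorem dir_comm (h : Smooth Ω φ) (w w' : Pt) {p : Pt} (hp : p ∈ Ω) :
    PPWave.dir w (PPWave.dir w' φ) p = PPWave.dir w' (PPWave.dir w φ) p := by
  have hc := h.contDiffAt (hΩ.mem_nhds hp)
  have hs : IsSymmSndFDerivAt ℝ φ p := hc.isSymmSndFDerivAt (by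
    rw [minSmoothness_of_isRCLikeNormedField]; exact WithTop.coe_le_coe.2 le_top)
  have hd : DifferentiableAt ℝ (fderiv ℝ φ) p :=
    ((h.fderiv_of_isOpen (m := ∞) hΩ (by simp)).contDiffAt (hΩ.mem_nhds hp)).differentiableAt
      (by simp)
  have e : ∀ w w' : Pt, PPWave.dir w (PPWave.dir w' φ) p = fderiv ℝ (fderiv ℝ φ) p w w' := by
    intro w w'
    change fderiv ℝ (fun y => fderiv ℝ φ y w') p w = _
    rw [fderiv_clm_apply hd (differentiableAt_const _)]
    simp
  rw [e, e]
  exact hs w w'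

theorem pd_comm (h : Smooth Ω φ) (i j : Fin 4) {p : Pt} (hp : p ∈ Ω) :
    PPWave.pd i (PPWave.pd j φ) p = PPWave.pd j (PPWave.pd i φ) p := by
  have hd : ∀ w, DifferentiableAt ℝ (PPWave.dir w φ) p := fun w =>
    (Smooth.dir hΩ h w).diffAt hΩ hp
  have hc := fun w w' => dir_comm hΩ h w w' hp
  have key : ∀ (w : Pt) (c : ℂ) (w1 w2 : Pt),
      PPWave.dir w (fun p => (PPWave.dir w1 φ p + c * PPWave.dir w2 φ p) / 2) p
        = (PPWave.dir w (PPWave.dir w1 φ) p + c * PPWave.dir w (PPWave.dir w2 φ) p) / 2 := by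
    intro w c w1 w2
    have e : (fun p => (PPWave.dir w1 φ p + c * PPWave.dir w2 φ p) / 2)
        = fun p => (2 : ℂ)⁻¹ * (PPWave.dir w1 φ p + c * PPWave.dir w2 φ p) := by
      funext; ring
    rw [e]
    have h2 : HasFDerivAt (fun p => (2 : ℂ)⁻¹ * (PPWave.dir w1 φ p + c * PPWave.dir w2 φ p))
        ((2 : ℂ)⁻¹ • (fderiv ℝ (PPWave.dir w1 φ) p + c • fderiv ℝ (PPWave.dir w2 φ) p)) p :=
      (((hd w1).hasFDerivAt).add (((hd w2).hasFDerivAt).const_mul c)).const_mul _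
    unfold PPWave.dir at h2 ⊢
    rw [h2.fderiv]
    simp
    ring
  have k0 : PPWave.pd 0 φ = fun p => (PPWave.dir (1, 0, 0) φ p
      + (-Complex.I) * PPWave.dir (Complex.I, 0, 0) φ p) / 2 := by
    funext q; simp [PPWave.pd]; ring
  have k1 : PPWave.pd 1 φ = fun p => (PPWave.dir (1, 0, 0) φ p
      + Complex.I * PPWave.dir (Complex.I, 0, 0) φ p) / 2 := by
    funext q; simp [PPWave.pd]
  have k2 : PPWave.pd 2 φ = PPWave.dir (0, 1, 0) φ := rfl
  have k3 : PPWave.pd 3 φ = PPWave.dir (0, 0, 1) φ := rfl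
  have l0 : ∀ ψ : Scalar, PPWave.pd 0 ψ p = (PPWave.dir (1, 0, 0) ψ p
      - Complex.I * PPWave.dir (Complex.I, 0, 0) ψ p) / 2 := fun _ => rfl
  have l1 : ∀ ψ : Scalar, PPWave.pd 1 ψ p = (PPWave.dir (1, 0, 0) ψ p
      + Complex.I * PPWave.dir (Complex.I, 0, 0) ψ p) / 2 := fun _ => rfl
  have l2 : ∀ ψ : Scalar, PPWave.pd 2 ψ p = PPWave.dir (0, 1, 0) ψ p := fun _ => rfl
  have l3 : ∀ ψ : Scalar, PPWave.pd 3 ψ p = PPWave.dir (0, 0, 1) ψ p := fun _ => rfl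
  have c1 := hc (1, 0, 0) (Complex.I, 0, 0)
  have c2 := hc (1, 0, 0) (0, 1, 0)
  have c3 := hc (1, 0, 0) (0, 0, 1)
  have c4 := hc (Complex.I, 0, 0) (0, 1, 0)
  have c5 := hc (Complex.I, 0, 0) (0, 0, 1)
  have c6 := hc (0, 1, 0) (0, 0, 1)
  fin_cases i <;> fin_cases j <;>
    simp only [Fin.zero_eta, Fin.mk_one, Fin.reduceFinMk, k0, k1, k2, k3] <;>
    simp only [l0, l1, l2, l3, key, c1, c2, c3, c4, c5, c6] <;> ring

theorem const_of_pd_eq_zero (hc : IsPreconnected Ω) (h : ∀ p ∈ Ω, DifferentiableAt ℝ φ p)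
    (h0 : ∀ p ∈ Ω, ∀ i, PPWave.pd i φ p = 0) {p q : Pt} (hp : p ∈ Ω) (hq : q ∈ Ω) :
    φ p = φ q := by
  refine hΩ.is_const_of_fderiv_eq_zero (𝕜 := ℝ) hc
    (fun x hx => (h x hx).differentiableWithinAt) (fun x hx => ?_) hp hq
  have e0 : (fderiv ℝ φ x (1, 0, 0) - Complex.I * fderiv ℝ φ x (Complex.I, 0, 0)) / 2 = 0 :=
    h0 x hx 0
  have e1 : (fderiv ℝ φ x (1, 0, 0) + Complex.I * fderiv ℝ φ x (Complex.I, 0, 0)) / 2 = 0 :=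
    h0 x hx 1
  have e2 : fderiv ℝ φ x (0, 1, 0) = 0 := h0 x hx 2
  have e3 : fderiv ℝ φ x (0, 0, 1) = 0 := h0 x hx 3
  have e4 : fderiv ℝ φ x (1, 0, 0) = 0 := by linear_combination e0 + e1
  have e5 : fderiv ℝ φ x (Complex.I, 0, 0) = 0 := by
    have : Complex.I * fderiv ℝ φ x (Complex.I, 0, 0) = 0 := by linear_combination e1 - e0
    simpa using this
  refine ContinuousLinearMap.ext fun w => ?_
  have : w = w.1.re • ((1, 0, 0) : Pt) + w.1.im • ((Complex.I, 0, 0) : Pt)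
      + w.2.1 • ((0, 1, 0) : Pt) + w.2.2 • ((0, 0, 1) : Pt) := by
    ext <;> simp
  rw [this]
  simp only [map_add, map_smul, e2, e3, e4, e5]
  simp

end Smoothness

/-- Smooth scalars on `Ω` that are holomorphic in `ζ` and independent of `v`. -/
structure Hol (Ω : Set Pt) (φ : Scalar) : Prop where
  smooth : Smooth Ω φ
  bar : ∀ p ∈ Ω, pd 1 φ p = 0
  vert : ∀ p ∈ Ω, pd 3 φ p = 0

/-! ### Closure properties of scalars holomorphic in ζ and independent of v. -/

section HolCalculus

variable {Ω : Set Pt} (hΩ : IsOpen Ω) {φ ψ : Scalar}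

include hΩ

theorem Hol.hasPD (h : Hol Ω φ) {p : Pt} (hp : p ∈ Ω) :
    HasPD φ ![pd 0 φ p, 0, pd 2 φ p, 0] p :=
  (h.smooth.hasPD hΩ hp).change fun i => by
    fin_cases i <;> simp [h.bar p hp, h.vert p hp]

omit hΩ in
theorem Hol.of_hasPD (h : Smooth Ω φ) {d : Pt → Fin 4 → ℂ} (hd : ∀ p ∈ Ω, HasPD φ (d p) p)
    (h1 : ∀ p ∈ Ω, d p 1 = 0) (h3 : ∀ p ∈ Ω, d p 3 = 0) : Hol Ω φ :=
  ⟨h, fun p hp => by rw [(hd p hp).eq, h1 p hp], fun p hp => by rw [(hd p hp).eq, h3 p hp]⟩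

omit hΩ in
theorem pd_zero_fun (i : Fin 4) (p : Pt) : PPWave.pd i (fun _ => (0 : ℂ)) p = 0 :=
  (HasPD.const 0 p).eq i

theorem pd_of_eq_zero (h : ∀ q ∈ Ω, φ q = 0) {p : Pt} (hp : p ∈ Ω) (i : Fin 4) :
    PPWave.pd i φ p = 0 := by
  rw [pd_congr hΩ (ψ := fun _ => 0) h hp, pd_zero_fun]

theorem Hol.pd (h : Hol Ω φ) (i : Fin 4) : Hol Ω (pd i φ) :=
  ⟨h.smooth.pd hΩ i,
    fun p hp => by rw [pd_comm hΩ h.smooth 1 i hp, pd_of_eq_zero hΩ h.bar hp],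
    fun p hp => by rw [pd_comm hΩ h.smooth 3 i hp, pd_of_eq_zero hΩ h.vert hp]⟩

theorem Hol.div (h : Hol Ω φ) (h' : Hol Ω ψ) (h0 : ∀ p ∈ Ω, ψ p ≠ 0) :
    Hol Ω (fun q => φ q / ψ q) :=
  Hol.of_hasPD (by
    simp only [div_eq_mul_inv]
    exact h.smooth.mul (h'.smooth.inv h0))
    (fun p hp => (h.hasPD hΩ hp).div (h'.hasPD hΩ hp) (h0 p hp)) (fun p hp => by simp)
    (fun p hp => by simp)

theorem Hol.neg (h : Hol Ω φ) : Hol Ω (fun q => -φ q) :=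
  Hol.of_hasPD h.smooth.neg
    (fun p hp => (h.hasPD hΩ hp).neg) (fun p hp => by simp) (fun p hp => by simp)

end HolCalculus


/-! ## Connection and curvature of the pp-wave -/

/-- The potential as a scalar. -/
def pot (f : ℂ → ℝ → ℂ) : Scalar := fun p => f p.1 p.2.1

/-- The first `ζ`-derivative of the potential. -/
def f1 (f : ℂ → ℝ → ℂ) : Scalar := pd 0 (pot f)

/-- The second `ζ`-derivative of the potential. -/
def f2 (f : ℂ → ℝ → ℂ) : Scalar := pd 0 (f1 f)

/-- The third `ζ`-derivative of the potential. -/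
def f3 (f : ℂ → ℝ → ℂ) : Scalar := pd 0 (f2 f)

theorem ip_eq (f : ℂ → ℝ → ℂ) (p : Pt) (x y : Fin 4 → ℂ) :
    ip f p x y = x 0 * y 1 + x 1 * y 0 - (pot f p + conj (pot f p)) * (x 2 * y 2)
      - x 2 * y 3 - x 3 * y 2 := by
  simp [ip, metric, Fin.sum_univ_four, pot]
  ring

theorem metric_inv (f : ℂ → ℝ → ℂ) (p : Pt) :
    (metric f p)⁻¹ = !![0, 1, 0, 0; 1, 0, 0, 0; 0, 0, 0, -1;
      0, 0, -1, pot f p + conj (pot f p)] := by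
  apply Matrix.inv_eq_right_inv
  ext i j
  fin_cases i <;> fin_cases j <;> simp [metric, Matrix.mul_apply, Fin.sum_univ_four, pot]

section PotentialHol

variable {f : ℂ → ℝ → ℂ} {Ω : Set Pt} (hΩ : IsOpen Ω) (hf : Hol Ω (pot f))

include hΩ hf

theorem hol_f1 : Hol Ω (f1 f) := hf.pd hΩ 0

theorem hol_f2 : Hol Ω (f2 f) := (hol_f1 hΩ hf).pd hΩ 0

theorem hol_f3 : Hol Ω (f3 f) := (hol_f2 hΩ hf).pd hΩ 0

/-- The coordinate derivatives of the metric. -/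
theorem pd_metric {p : Pt} (hp : p ∈ Ω) (i l j : Fin 4) :
    pd i (fun q => metric f q l j) p = if l = 2 ∧ j = 2 then
      (![-f1 f p, -conj (f1 f p), -(pd 2 (pot f) p + conj (pd 2 (pot f) p)), 0] : Fin 4 → ℂ) i
      else 0 := by
  have hc : ∀ c : ℂ, pd i (fun _ => c) p = 0 := fun c => (HasPD.const c p).eq i
  have hH : pd i (fun q => -(f q.1 q.2.1 + conj (f q.1 q.2.1))) p
      = (![-f1 f p, -conj (f1 f p), -(pd 2 (pot f) p + conj (pd 2 (pot f) p)), 0] : _ → ℂ) i := by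
    have h := hf.hasPD hΩ hp
    refine ((h.add h.cj).neg.eq i).trans ?_
    fin_cases i <;> simp [cjD, f1]
  fin_cases l <;> fin_cases j <;> simp [metric] <;> first | exact hc _ | simpa using hH

theorem christoffel_eq {p : Pt} (hp : p ∈ Ω) (k i j : Fin 4) :
    christoffel f k i j p =
      if k = 0 ∧ i = 2 ∧ j = 2 then conj (f1 f p) / 2
      else if k = 1 ∧ i = 2 ∧ j = 2 then f1 f p / 2
      else if k = 3 ∧ i = 2 ∧ j = 2 then (pd 2 (pot f) p + conj (pd 2 (pot f) p)) / 2
      else if k = 3 ∧ ((i = 0 ∧ j = 2) ∨ (i = 2 ∧ j = 0)) then f1 f p / 2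
      else if k = 3 ∧ ((i = 1 ∧ j = 2) ∨ (i = 2 ∧ j = 1)) then conj (f1 f p) / 2
      else 0 := by
  simp only [christoffel, pd_metric hΩ hf hp, metric_inv, Fin.sum_univ_four]
  fin_cases k <;> fin_cases i <;> fin_cases j <;> simp <;> ring

theorem cov_eq {p : Pt} (hp : p ∈ Ω) (X Y : VField) (k : Fin 4) :
    cov f X Y p k = act X (fun q => Y q k) p +
      (![conj (f1 f p) / 2 * (X p 2 * Y p 2), f1 f p / 2 * (X p 2 * Y p 2), 0,
        (pd 2 (pot f) p + conj (pd 2 (pot f) p)) / 2 * (X p 2 * Y p 2)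
          + f1 f p / 2 * (X p 0 * Y p 2 + X p 2 * Y p 0)
          + conj (f1 f p) / 2 * (X p 1 * Y p 2 + X p 2 * Y p 1)] : Fin 4 → ℂ) k := by
  simp only [cov, act, christoffel_eq hΩ hf hp, Fin.sum_univ_four]
  fin_cases k <;> simp <;> ring

theorem riemann_two {p : Pt} (hp : p ∈ Ω) (l i j : Fin 4) : riemann f 2 l i j p = 0 := by
  have h : ∀ i j, ∀ q ∈ Ω, christoffel f 2 i j q = 0 := fun i j q hq => by
    simp [christoffel_eq hΩ hf hq]
  simp [riemann, h _ _ p hp, pd_of_eq_zero hΩ (h _ _) hp]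

theorem riemann_zero {p : Pt} (hp : p ∈ Ω) (l i j : Fin 4) :
    riemann f 0 l i j p = if l = 2 ∧ i = 1 ∧ j = 2 then conj (f2 f p) / 2
      else if l = 2 ∧ i = 2 ∧ j = 1 then -(conj (f2 f p) / 2) else 0 := by
  have h2 : ∀ i j, christoffel f 2 i j p = 0 := fun i j => by
    simp [christoffel_eq hΩ hf hp]
  have hs : ∀ s i, s ≠ 2 → christoffel f 0 i s p = 0 := fun s i hs => by
    simp [christoffel_eq hΩ hf hp, hs]
  have hd : ∀ i j l, pd i (christoffel f 0 j l) p = if j = 2 ∧ l = 2 then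
      (![0, conj (f2 f p) / 2, pd i (fun q => conj (f1 f q) / 2) p, 0] : Fin 4 → ℂ) i else 0 := by
    intro i j l
    by_cases hjl : j = 2 ∧ l = 2
    · rw [if_pos hjl, pd_congr hΩ (ψ := fun q => conj (f1 f q) / 2)
        (fun q hq => by simp [christoffel_eq hΩ hf hq, hjl]) hp i]
      have h := ((hol_f1 hΩ hf).hasPD hΩ hp).cj.div (HasPD.const 2 p) (by simp)
      fin_cases i
      · rw [h.eq]; simp [cjD]
      · rw [h.eq]; simp [cjD, f2]; ring
      · rfl
      · rw [h.eq]; simp [cjD]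
    · rw [if_neg hjl]
      refine pd_of_eq_zero hΩ (fun q hq => ?_) hp i
      rw [christoffel_eq hΩ hf hq]
      simp [hjl]
  simp only [riemann, hd, Fin.sum_univ_four, h2, hs 0 _ (by decide), hs 1 _ (by decide),
    hs 3 _ (by decide)]
  fin_cases l <;> fin_cases i <;> fin_cases j <;> simp

/-- A vector y with only ζ̄- and v-components pairs with the ζ- and u-components of R(x, z)z alone.
Hence `riemann_zero` and `riemann_two` are all the curvature that Ψ₄ requires. -/
theorem ip_curv_eq {p : Pt} (hp : p ∈ Ω) (x y : Fin 4 → ℂ) (hx : x 2 = 0) (hy : y 0 = 0)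
    (hy' : y 2 = 0) (z : Fin 4 → ℂ) :
    ip f p y (curv f p x z z) = y 1 * (conj (f2 f p) / 2 * x 1 * z 2 ^ 2) := by
  have h2 : curv f p x z z 2 = 0 := by simp [curv, riemann_two hΩ hf hp]
  have h0 : curv f p x z z 0 = conj (f2 f p) / 2 * x 1 * z 2 ^ 2 := by
    simp only [curv, riemann_zero hΩ hf hp, Fin.sum_univ_four]
    simp [hx]
    ring
  rw [ip_eq, hy, hy', h0, h2]
  ring

end PotentialHol


/-! ## The invariant tetrad -/

/-- The `ζ`-component of `n`, divided by its `u`-component, for the invariant tetrad: `-f''_u/f'''`. -/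
def zz (f : ℂ → ℝ → ℂ) : Scalar := fun p => -pd 2 (f2 f) p / f3 f p

/-- The quotient `f''/f'''`. -/
def il (f : ℂ → ℝ → ℂ) : Scalar := fun p => f2 f p / f3 f p

theorem act_of_vert {X : VField} {φ : Scalar} {p : Pt} (h : pd 3 φ p = 0) :
    act X φ p = X p 0 * pd 0 φ p + X p 1 * pd 1 φ p + X p 2 * pd 2 φ p := by
  simp [act, Fin.sum_univ_four, h]

section InvariantTetrad

variable {f : ℂ → ℝ → ℂ} {Ω : Set Pt} (hΩ : IsOpen Ω) (hf : Hol Ω (pot f)) {e : Tetrad}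

/-- The components of an aligned and oriented null tetrad at a point. -/
structure Comps (e : Tetrad) (p : Pt) : Prop where
  m0 : e.m p 0 * conj (e.m p 0) = 1
  m1 : e.m p 1 = 0
  m2 : e.m p 2 = 0
  m3 : e.m p 3 = e.m p 0 * (e.n p 1 / e.n p 2)
  l0 : e.l p 0 = 0
  l1 : e.l p 1 = 0
  l2 : e.l p 2 = 0
  l3 : e.l p 3 = 1 / e.n p 2
  n1 : e.n p 1 = conj (e.n p 0)
  n2 : conj (e.n p 2) = e.n p 2
  n2_ne : e.n p 2 ≠ 0

theorem Tetrad.IsInvariant.comps (he : e.IsInvariant f Ω) {p : Pt} (hp : p ∈ Ω) : Comps e p := by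
  obtain ⟨l0, l1, l2⟩ := he.aligned p hp
  have m1 := he.oriented p hp
  have hln := he.null.l_n p hp
  have hml := he.null.m_l p hp
  have hmm := he.null.m_mb p hp
  have hmn := he.null.m_n p hp
  have hn := he.null.real_n p hp
  rw [ip_eq] at hln hml hmm hmn
  have hn0 := congrFun hn 0
  have hn1 := congrFun hn 1
  have hn2 := congrFun hn 2
  simp only [cjV, Matrix.cons_val] at hn0 hn1 hn2
  simp only [Tetrad.mb, cjV, Matrix.cons_val, m1, l0, l1, l2] at *
  have hl : e.l p 3 * e.n p 2 = 1 := by linear_combination -hln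
  have hn2' : e.n p 2 ≠ 0 := right_ne_zero_of_mul_eq_one hl
  have hl3 : e.l p 3 ≠ 0 := left_ne_zero_of_mul_eq_one hl
  have m2 : e.m p 2 = 0 := by
    have : e.m p 2 * e.l p 3 = 0 := by linear_combination -hml
    exact (mul_eq_zero.1 this).resolve_right hl3
  rw [m2] at hmm hmn
  have hw : e.m p 0 * conj (e.m p 0) = 1 := by
    simp only [map_zero] at hmm
    linear_combination hmm
  refine ⟨hw, he.oriented p hp, m2, ?_, (he.aligned p hp).1, (he.aligned p hp).2.1,
    (he.aligned p hp).2.2, ?_, hn1.symm, hn2, hn2'⟩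
  · field_simp
    linear_combination -hmn
  · field_simp
    linear_combination hl

section

include hΩ

theorem Tetrad.IsInvariant.hasPD_n2 (he : e.IsInvariant f Ω) {p : Pt} (hp : p ∈ Ω) (k : Fin 4) :
    HasPD (fun q => e.n q k) (fun i => pd i (fun q => e.n q k) p) p :=
  Smooth.hasPD hΩ (contDiffOn_pi.1 he.null.smooth_n k) hp

theorem Tetrad.IsInvariant.hasPD_m0 (he : e.IsInvariant f Ω) {p : Pt} (hp : p ∈ Ω) (k : Fin 4) :
    HasPD (fun q => e.m q k) (fun i => pd i (fun q => e.m q k) p) p :=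
  Smooth.hasPD hΩ (contDiffOn_pi.1 he.null.smooth_m k) hp

end

include hΩ hf

/-- This is Ψ₄ = 1 in coordinates. It determines a and w from f'' up to a sign, and it forces f'' ≠
0. -/
theorem Tetrad.IsInvariant.normalization (he : e.IsInvariant f Ω) {p : Pt} (hp : p ∈ Ω) :
    (e.n p 2 * conj (e.m p 0)) ^ 2 * conj (f2 f p) = 2 := by
  have h := he.psi4_eq p hp
  have c := he.comps hp
  rw [Tetrad.psi4, ip_curv_eq hΩ hf hp _ _ (by simp [Tetrad.mb, cjV, c.m2])
    (by simp [Tetrad.mb, cjV, c.m1]) (by simp [Tetrad.mb, cjV, c.m2])] at h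
  simp only [Tetrad.mb, cjV, Matrix.cons_val] at h
  linear_combination 2 * h

theorem Tetrad.IsInvariant.f2_ne (he : e.IsInvariant f Ω) {p : Pt} (hp : p ∈ Ω) : f2 f p ≠ 0 := by
  intro h
  have := he.normalization hΩ hf hp
  rw [h] at this
  simp at this

/-- The logarithmic derivatives of the boost factor and of the phase of the tetrad. -/
theorem Tetrad.IsInvariant.pd_boost (he : e.IsInvariant f Ω) {p : Pt} (hp : p ∈ Ω) (i : Fin 4) :
    let x := pd i (f2 f) p / f2 f p
    let y := pd i (fun q => conj (f2 f q)) p / conj (f2 f p)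
    pd i (fun q => e.n q 2) p = -(e.n p 2 / 4) * (x + y) ∧
      pd i (fun q => e.m q 0) p = -(e.m p 0 / 4) * (x - y) := by
  intro x y
  have hn := he.hasPD_n2 hΩ hp 2
  have hm := he.hasPD_m0 hΩ hp 0
  have hh := (hol_f2 hΩ hf).smooth.hasPD hΩ hp
  have hh' := HasPD.of_diff hh.cj.diff
  have c := he.comps hp
  have h0 := he.f2_ne hΩ hf hp
  have h0' : conj (f2 f p) ≠ 0 := by simpa using h0
  have e0 := he.normalization hΩ hf hp
  have e0' := congrArg conj e0
  simp only [map_mul, map_pow, Complex.conj_conj, c.n2, Complex.conj_ofNat] at e0'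
  have hm' := HasPD.of_diff hm.cj.diff
  -- Differentiating (a w̄)² conj(f'') = 2, its conjugate and w w̄ = 1 gives a linear system for the
  -- derivatives of a, w and w̄. No branch of the square root of f'' has to be chosen.
  have E1 := (((hn.mul hm').mul (hn.mul hm')).mul hh').congr hΩ (ψ := fun _ => 2)
    (fun q hq => by rw [← he.normalization hΩ hf hq]; ring) hp
  have E2 := (((hn.mul hm).mul (hn.mul hm)).mul hh).congr hΩ (ψ := fun _ => 2)
    (fun q hq => by
      have := congrArg conj (he.normalization hΩ hf hq)
      simp only [map_mul, map_pow, Complex.conj_conj, (he.comps hq).n2, Complex.conj_ofNat] at this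
      rw [← this]; ring) hp
  have E3 := (hm.mul hm').congr hΩ (ψ := fun _ => 1) (fun q hq => (he.comps hq).m0.symm) hp
  have E1 := E1.eq i
  have E2 := E2.eq i
  have E3 := E3.eq i
  rw [(HasPD.const _ p).eq] at E1 E2 E3
  have hx : pd i (f2 f) p = x * f2 f p := by simp [x, h0]
  have hy : pd i (fun q => conj (f2 f q)) p = y * conj (f2 f p) := by simp [y, h0]
  rw [hy] at E1
  rw [hx] at E2
  clear_value x y
  generalize pd i (fun q => e.n q 2) p = da at *
  generalize pd i (fun q => e.m q 0) p = dw at *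
  generalize pd i (fun q => conj (e.m q 0)) p = dw' at *
  have hw := c.m0
  have ha := c.n2_ne
  generalize e.n p 2 = a at *
  generalize e.m p 0 = w at *
  generalize conj w = w' at *
  generalize conj (f2 f p) = H' at *
  generalize f2 f p = H at *
  have hw0 : w ≠ 0 := left_ne_zero_of_mul_eq_one hw
  have hw0' : w' ≠ 0 := right_ne_zero_of_mul_eq_one hw
  -- logarithmic forms of the three relations
  have L1 : da * w' + a * dw' = -(y / 2) * (a * w') := by
    have : (2 * a * w' * H') * (da * w' + a * dw' + (y / 2) * (a * w')) = 0 := by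
      linear_combination -E1
    have h2 : 2 * a * w' * H' ≠ 0 := by
      simp [ha, hw0', h0']
    linear_combination (mul_eq_zero.1 this).resolve_left h2
  have L2 : da * w + a * dw = -(x / 2) * (a * w) := by
    have : (2 * a * w * H) * (da * w + a * dw + (x / 2) * (a * w)) = 0 := by
      linear_combination -E2
    have h2 : 2 * a * w * H ≠ 0 := by
      simp [ha, hw0, h0]
    linear_combination (mul_eq_zero.1 this).resolve_left h2
  have hda : da = -(a / 4) * (x + y) := by
    linear_combination (w / 2) * L1 + (w' / 2) * L2 + a / 2 * E3
      - (da + a * (x + y) / 4) * hw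
  refine ⟨hda, ?_⟩
  have : a * (dw - -(w / 4) * (x - y)) = 0 := by
    rw [hda] at L2
    linear_combination L2
  linear_combination (mul_eq_zero.1 this).resolve_left ha

/-- Coordinate derivatives of the boost factor. -/
theorem Tetrad.IsInvariant.hasPD_a (he : e.IsInvariant f Ω) {p : Pt} (hp : p ∈ Ω) :
    HasPD (fun q => e.n q 2) ![-(e.n p 2 / 4) * (f3 f p / f2 f p),
      -(e.n p 2 / 4) * conj (f3 f p / f2 f p),
      -(e.n p 2 / 4) * (pd 2 (f2 f) p / f2 f p + conj (pd 2 (f2 f) p / f2 f p)), 0] p := by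
  refine (he.hasPD_n2 hΩ hp 2).change fun i => ?_
  have hh := (hol_f2 hΩ hf).hasPD hΩ hp
  rw [(he.pd_boost hΩ hf hp i).1, hh.eq, hh.cj.eq]
  fin_cases i <;> simp [cjD, f3]

/-- Coordinate derivatives of the phase. -/
theorem Tetrad.IsInvariant.hasPD_w (he : e.IsInvariant f Ω) {p : Pt} (hp : p ∈ Ω) :
    HasPD (fun q => e.m q 0) ![-(e.m p 0 / 4) * (f3 f p / f2 f p),
      e.m p 0 / 4 * conj (f3 f p / f2 f p),
      -(e.m p 0 / 4) * (pd 2 (f2 f) p / f2 f p - conj (pd 2 (f2 f) p / f2 f p)), 0] p := by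
  refine (he.hasPD_m0 hΩ hp 0).change fun i => ?_
  have hh := (hol_f2 hΩ hf).hasPD hΩ hp
  rw [(he.pd_boost hΩ hf hp i).2, hh.eq, hh.cj.eq]
  fin_cases i <;> simp [cjD, f3]

omit hf in
theorem Tetrad.IsInvariant.pd_mb_zero (he : e.IsInvariant f Ω) {p : Pt} (hp : p ∈ Ω) (i : Fin 4) :
    pd i (fun q => e.mb q 2) p = 0 :=
  pd_of_eq_zero hΩ (fun q hq => by simp [Tetrad.mb, cjV, (he.comps hq).m2]) hp i

/-- `-2α` and `-2γ` as logarithmic derivatives of `a w̄`. -/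
theorem Tetrad.IsInvariant.spin_eq (he : e.IsInvariant f Ω) {p : Pt} (hp : p ∈ Ω) (X : VField) :
    ip f p (e.m p) (cov f X e.mb p) + ip f p (e.n p) (cov f X e.l p)
      = e.m p 0 * act X (fun q => conj (e.m q 0)) p
        + act X (fun q => e.n q 2) p / e.n p 2 := by
  have c := he.comps hp
  have hb2 : act X (fun q => e.mb q 2) p = 0 := by
    simp [act, he.pd_mb_zero hΩ hp]
  have hl : ∀ k, k ≠ 3 → act X (fun q => e.l q k) p = 0 := by
    intro k hk
    have : ∀ i, pd i (fun q => e.l q k) p = 0 := fun i =>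
      pd_of_eq_zero hΩ (fun q hq => by
        have c := he.comps hq
        fin_cases k
        · exact c.l0
        · exact c.l1
        · exact c.l2
        · exact absurd rfl hk) hp i
    simp [act, this]
  have hl3 : act X (fun q => e.l q 3) p = -act X (fun q => e.n q 2) p / e.n p 2 ^ 2 := by
    have : ∀ i, pd i (fun q => e.l q 3) p = -pd i (fun q => e.n q 2) p / e.n p 2 ^ 2 := fun i =>
      ((he.hasPD_n2 hΩ hp 2).inv c.n2_ne).congr hΩ (ψ := fun q => e.l q 3)
        (fun q hq => by rw [(he.comps hq).l3, one_div]) hp |>.eq i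
    simp only [act, this, Fin.sum_univ_four]
    ring
  rw [ip_eq, ip_eq]
  simp only [cov_eq hΩ hf hp, Matrix.cons_val, hl 0 (by decide), hl 1 (by decide),
    hl 2 (by decide), hl3, hb2, c.l0, c.l1, c.l2, c.m1, c.m2]
  have hb : e.mb p 2 = 0 := by simp [Tetrad.mb, cjV, c.m2]
  have hb1 : act X (fun q => e.mb q 1) p = act X (fun q => conj (e.m q 0)) p := rfl
  rw [hb, hb1]
  have := c.n2_ne
  field_simp
  ring

theorem Tetrad.IsInvariant.al_eq' (he : e.IsInvariant f Ω) {p : Pt} (hp : p ∈ Ω) :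
    e.al f p = conj (e.m p 0) / 4 * conj (f3 f p / f2 f p) := by
  have c := he.comps hp
  have ha := he.hasPD_a hΩ hf hp
  have hw := (he.hasPD_w hΩ hf hp).cj
  rw [Tetrad.al, he.spin_eq hΩ hf hp]
  simp only [act, ha.eq, hw.eq, Fin.sum_univ_four, Tetrad.mb, cjV, cjD, Matrix.cons_val, c.m1,
    c.m2, map_zero]
  simp only [map_mul, map_neg, map_div₀, Complex.conj_conj, Complex.conj_ofNat]
  have := c.n2_ne
  have := he.f2_ne hΩ hf hp
  have h' : conj (f2 f p) ≠ 0 := by simpa using this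
  field_simp
  linear_combination (conj (e.m p 0) * conj (f3 f p) * f2 f p * e.n p 2) * c.m0

theorem Tetrad.IsInvariant.f3_ne (he : e.IsInvariant f Ω) {p : Pt} (hp : p ∈ Ω) : f3 f p ≠ 0 := by
  intro h
  have := he.al_ne p hp
  rw [he.al_eq' hΩ hf hp, h] at this
  simp at this

/-- By `spin_eq`, γ = 0 says that a w̄ is constant along n. By `normalization` the same then holds
for f'', and this fixes the ζ-component of n. -/
theorem Tetrad.IsInvariant.n0 (he : e.IsInvariant f Ω) {p : Pt} (hp : p ∈ Ω) :
    e.n p 0 = e.n p 2 * zz f p := by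
  have c := he.comps hp
  have ha := he.hasPD_a hΩ hf hp
  have hw := (he.hasPD_w hΩ hf hp).cj
  have hg := he.ga_eq p hp
  rw [Tetrad.ga, he.spin_eq hΩ hf hp] at hg
  simp only [act, ha.eq, hw.eq, Fin.sum_univ_four, cjD, Matrix.cons_val, c.n1,
    map_zero] at hg
  simp only [map_mul, map_neg, map_div₀, map_sub, Complex.conj_conj,
    Complex.conj_ofNat] at hg
  have h2 := c.n2_ne
  have h3 := he.f2_ne hΩ hf hp
  have h' : conj (f2 f p) ≠ 0 := by simpa using h3
  have h4 := he.f3_ne hΩ hf hp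
  have key : conj (e.n p 0) * conj (f3 f p) + e.n p 2 * conj (pd 2 (f2 f) p) = 0 := by
    field_simp at hg
    have hw0 : conj (e.m p 0) = 1 / e.m p 0 := by
      rw [eq_div_iff (left_ne_zero_of_mul_eq_one c.m0)]
      linear_combination c.m0
    have hm0 := left_ne_zero_of_mul_eq_one c.m0
    rw [hw0] at hg
    field_simp at hg
    have hk : e.n p 2 * f2 f p *
        (conj (e.n p 0) * conj (f3 f p) + e.n p 2 * conj (pd 2 (f2 f) p)) = 0 := by
      linear_combination (1 / 2) * hg
    exact (mul_eq_zero.1 hk).resolve_left (mul_ne_zero h2 h3)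
  have key2 := congrArg conj key
  simp only [map_mul, map_add, Complex.conj_conj, c.n2, map_zero] at key2
  rw [zz]
  field_simp
  linear_combination key2

theorem hol_zz (he : e.IsInvariant f Ω) : Hol Ω (zz f) :=
  (((hol_f2 hΩ hf).pd hΩ 2).neg hΩ).div hΩ (hol_f3 hΩ hf) fun _ hp => he.f3_ne hΩ hf hp

theorem hol_il (he : e.IsInvariant f Ω) : Hol Ω (il f) :=
  (hol_f2 hΩ hf).div hΩ (hol_f3 hΩ hf) fun _ hp => he.f3_ne hΩ hf hp

theorem il_ne (he : e.IsInvariant f Ω) {p : Pt} (hp : p ∈ Ω) : il f p ≠ 0 :=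
  div_ne_zero (he.f2_ne hΩ hf hp) (he.f3_ne hΩ hf hp)

/-- The derivation `Δ`, divided by the boost factor, on scalars independent of `v`. -/
def dn (f : ℂ → ℝ → ℂ) (d : Fin 4 → ℂ) (p : Pt) : ℂ :=
  zz f p * d 0 + conj (zz f p) * d 1 + d 2

theorem Tetrad.IsInvariant.act_n (he : e.IsInvariant f Ω) {p : Pt} (hp : p ∈ Ω) {φ : Scalar}
    {d : Fin 4 → ℂ} (h : HasPD φ d p) (h3 : d 3 = 0) :
    act e.n φ p = e.n p 2 * dn f d p := by
  have c := he.comps hp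
  rw [act_of_vert (by rw [h.eq, h3]), c.n1, he.n0 hΩ hf hp, h.eq, h.eq, h.eq, dn, map_mul, c.n2]
  ring

theorem Tetrad.IsInvariant.al_eq (he : e.IsInvariant f Ω) {p : Pt} (hp : p ∈ Ω) :
    e.al f p = conj (e.m p 0) / (4 * conj (il f p)) := by
  rw [he.al_eq' hΩ hf hp, il, map_div₀, map_div₀]
  have := he.f2_ne hΩ hf hp
  have h' : conj (f2 f p) ≠ 0 := by simpa using this
  field_simp

/-- Coordinate derivatives of the boost factor; it is constant along `n`. -/
theorem Tetrad.IsInvariant.hasPD_boost (he : e.IsInvariant f Ω) {p : Pt} (hp : p ∈ Ω) :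
    HasPD (fun q => e.n q 2) ![-(e.n p 2 / (4 * il f p)), -(e.n p 2 / (4 * conj (il f p))),
      e.n p 2 / 4 * (zz f p / il f p + conj (zz f p) / conj (il f p)), 0] p := by
  refine (he.hasPD_a hΩ hf hp).change fun i => ?_
  have h2 := he.f2_ne hΩ hf hp
  have h3 := he.f3_ne hΩ hf hp
  have h2' : conj (f2 f p) ≠ 0 := by simpa using h2
  have h3' : conj (f3 f p) ≠ 0 := by simpa using h3
  fin_cases i <;> simp [il, zz] <;> field_simp
  ring

theorem Tetrad.IsInvariant.hasPD_phase (he : e.IsInvariant f Ω) {p : Pt} (hp : p ∈ Ω) :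
    HasPD (fun q => e.m q 0) ![-(e.m p 0 / (4 * il f p)), e.m p 0 / (4 * conj (il f p)),
      e.m p 0 / 4 * (zz f p / il f p - conj (zz f p) / conj (il f p)), 0] p := by
  refine (he.hasPD_w hΩ hf hp).change fun i => ?_
  have h2 := he.f2_ne hΩ hf hp
  have h3 := he.f3_ne hΩ hf hp
  have h2' : conj (f2 f p) ≠ 0 := by simpa using h2
  have h3' : conj (f3 f p) ≠ 0 := by simpa using h3
  fin_cases i <;> simp [il, zz] <;> field_simp
  ring

/-- In ∇_m n the derivative of a along m contributes through the ζ-component of n and through the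
v-component of m. These contributions cancel, and only the derivative of z remains. -/
theorem Tetrad.IsInvariant.mu_eq (he : e.IsInvariant f Ω) {p : Pt} (hp : p ∈ Ω) :
    e.mu f p = e.n p 2 * pd 0 (zz f) p := by
  have c := he.comps hp
  have hz := (hol_zz hΩ hf he).hasPD hΩ hp
  have ha := he.hasPD_boost hΩ hf hp
  have hn0 := (ha.mul hz).congr hΩ (ψ := fun q => e.n q 0) (fun q hq => he.n0 hΩ hf hq) hp
  rw [Tetrad.mu, ip_eq]
  simp only [cov_eq hΩ hf hp, Matrix.cons_val, Tetrad.mb, cjV, c.m1, c.m2, c.m3, map_zero, act,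
    Fin.sum_univ_four, hn0.eq, ha.eq, map_mul, map_div₀, c.n2, c.n1, Complex.conj_conj,
    he.n0 hΩ hf hp]
  have := c.n2_ne
  field_simp
  linear_combination (8 * e.n p 2 * pd 0 (zz f) p) * c.m0

theorem Tetrad.IsInvariant.nu_eq (he : e.IsInvariant f Ω) {p : Pt} (hp : p ∈ Ω) :
    e.nu f p = conj (e.m p 0) * e.n p 2 ^ 2 *
      (pd 2 (zz f) p + zz f p * pd 0 (zz f) p + conj (f1 f p) / 2) := by
  have c := he.comps hp
  have hz := (hol_zz hΩ hf he).hasPD hΩ hp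
  have ha := he.hasPD_boost hΩ hf hp
  have hn0 := (ha.mul hz).congr hΩ (ψ := fun q => e.n q 0) (fun q hq => he.n0 hΩ hf hq) hp
  rw [Tetrad.nu, ip_eq]
  simp only [cov_eq hΩ hf hp, Matrix.cons_val, Tetrad.mb, cjV, c.m1, c.m2, c.m3, map_zero, act,
    Fin.sum_univ_four, hn0.eq, ha.eq, map_mul, map_div₀, c.n2, c.n1, Complex.conj_conj,
    he.n0 hΩ hf hp]
  have := c.n2_ne
  have := il_ne hΩ hf he hp
  have h' : conj (il f p) ≠ 0 := by simpa using this
  field_simp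
  ring

theorem Tetrad.IsInvariant.hasPD_al (he : e.IsInvariant f Ω) {p : Pt} (hp : p ∈ Ω) :
    HasPD (e.al f) ![e.al f p / (4 * il f p),
      -(e.al f p * (1 + 4 * conj (pd 0 (il f) p)) / (4 * conj (il f p))),
      -(e.al f p * ((zz f p / il f p - conj (zz f p) / conj (il f p)) / 4
        + conj (pd 2 (il f) p) / conj (il f p))), 0] p := by
  have hi := il_ne hΩ hf he hp
  have h' : conj (il f p) ≠ 0 := by simpa using hi
  have H := ((he.hasPD_phase hΩ hf hp).cj.div
    (((hol_il hΩ hf he).hasPD hΩ hp).cj.const_mul 4) (by simpa using hi)).congr hΩ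
    (fun q hq => he.al_eq hΩ hf hq) hp
  refine H.change fun i => ?_
  rw [he.al_eq hΩ hf hp]
  have h4 : conj (4 : ℂ) = 4 := Complex.conj_ofNat 4
  fin_cases i <;> simp [cjD, h4] <;> field_simp <;> ring

theorem Tetrad.IsInvariant.A_eq (he : e.IsInvariant f Ω) {p : Pt} (hp : p ∈ Ω) :
    e.A f p = -1 - 4 * conj (pd 0 (il f) p) := by
  have c := he.comps hp
  have hi := il_ne hΩ hf he hp
  have h' : conj (il f p) ≠ 0 := by simpa using hi
  have h1 := he.al_eq hΩ hf hp
  have h2 := he.al_ne p hp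
  have hm0 : conj (e.m p 0) ≠ 0 := right_ne_zero_of_mul_eq_one c.m0
  rw [Tetrad.A]
  simp only [act, (he.hasPD_al hΩ hf hp).eq, Fin.sum_univ_four, Matrix.cons_val, Tetrad.mb, cjV,
    c.m1, c.m2, map_zero]
  rw [h1]
  field_simp
  ring

/-- The quotient `f''/f'''` is transported along `∂_u + zz ∂_ζ` by the derivative of `zz`. -/
theorem pd_two_il (he : e.IsInvariant f Ω) {p : Pt} (hp : p ∈ Ω) :
    pd 2 (il f) p = il f p * pd 0 (zz f) p - zz f p * pd 0 (il f) p := by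
  have h2 := (hol_f2 hΩ hf).hasPD hΩ hp
  have h3 := (hol_f3 hΩ hf).hasPD hΩ hp
  have hz := (hol_zz hΩ hf he).hasPD hΩ hp
  have n2 := he.f2_ne hΩ hf hp
  have n3 := he.f3_ne hΩ hf hp
  have hi : HasPD (il f) _ p := h2.div h3 n3
  -- The ζ-derivative of f''_u = -z f''', which expresses that f'' is constant along ∂_u + z∂_ζ.
  have e1 : pd 2 (f3 f) p = -(pd 0 (zz f) p * f3 f p + zz f p * pd 0 (f3 f) p) := by
    have := ((hz.mul h3).neg).congr hΩ (ψ := pd 2 (f2 f))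
      (fun q hq => by
        have := he.f3_ne hΩ hf hq
        rw [zz]; field_simp) hp
    have h4 := this.eq 0
    rw [pd_comm hΩ (hol_f2 hΩ hf).smooth 0 2 hp] at h4
    exact h4
  rw [hi.eq, hi.eq]
  simp only [Matrix.cons_val]
  rw [e1]
  have e2 : pd 2 (f2 f) p = -(zz f p * f3 f p) := by rw [zz]; field_simp
  have e3 : pd 0 (f2 f) p = f3 f p := rfl
  rw [e2, e3, il]
  field_simp
  ring

end InvariantTetrad


/-! ## Homothetic symmetries of the second derivative of the potential -/

/-- The `u`-component `e₀ u + d₀` of the symmetry. -/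
def pu (e₀ d₀ : ℝ) : Scalar := fun p => (e₀ : ℂ) * (p.2.1 : ℂ) + (d₀ : ℂ)

theorem HasPD.pu (e₀ d₀ : ℝ) (p : Pt) : HasPD (PPWave.pu e₀ d₀) ![0, 0, (e₀ : ℂ), 0] p :=
  (((HasPD.u p).const_mul _).add (HasPD.const _ p)).change fun i => by
    fin_cases i <;> simp

theorem conj_pu (e₀ d₀ : ℝ) (p : Pt) : conj (pu e₀ d₀ p) = pu e₀ d₀ p := by
  simp [pu]

/-- The vector field `(e₀ u + d₀) ∂_u + i ω₀ (ζ ∂_ζ - ζ̄ ∂_ζ̄)` evaluated on a covector. -/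
def lieV (e₀ d₀ ω₀ : ℝ) (p : Pt) (d : Fin 4 → ℂ) : ℂ :=
  pu e₀ d₀ p * d 2 + Complex.I * ω₀ * p.1 * d 0 - Complex.I * ω₀ * conj p.1 * d 1

/-- The potential is homogeneous under the vector field of `lieV`, up to a term affine in `ζ`. -/
structure AffineSym (f : ℂ → ℝ → ℂ) (Ω : Set Pt) (e₀ d₀ ω₀ : ℝ) (t r : ℝ → ℂ) : Prop where
  eq : ∀ p ∈ Ω, pu e₀ d₀ p * pd 2 (pot f) p + Complex.I * ω₀ * p.1 * f1 f p
    + 2 * e₀ * pot f p = t p.2.1 + r p.2.1 * p.1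
  diff_t : ∀ p ∈ Ω, DifferentiableAt ℝ t p.2.1
  diff_r : ∀ p ∈ Ω, DifferentiableAt ℝ r p.2.1

/-- `φ` is an eigenfunction with eigenvalue `k` of the vector field of `lieV`. -/
structure Weight (Ω : Set Pt) (e₀ d₀ ω₀ : ℝ) (φ : Scalar) (k : ℂ) : Prop where
  diff : ∀ p ∈ Ω, DifferentiableAt ℝ φ p
  eq : ∀ p ∈ Ω, lieV e₀ d₀ ω₀ p (fun i => pd i φ p) = k * φ p
  vert : ∀ p ∈ Ω, pd 3 φ p = 0

section Weights

variable {Ω : Set Pt} {e₀ d₀ ω₀ : ℝ} {φ ψ : Scalar} {k k' : ℂ}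

theorem Weight.of_hasPD {d : Pt → Fin 4 → ℂ} (hd : ∀ p ∈ Ω, HasPD φ (d p) p)
    (h : ∀ p ∈ Ω, lieV e₀ d₀ ω₀ p (d p) = k * φ p) (h3 : ∀ p ∈ Ω, d p 3 = 0) :
    Weight Ω e₀ d₀ ω₀ φ k :=
  ⟨fun p hp => (hd p hp).diff, fun p hp => by simp only [(hd p hp).eq, h p hp],
    fun p hp => by rw [(hd p hp).eq, h3 p hp]⟩

theorem Weight.hasPD (h : Weight Ω e₀ d₀ ω₀ φ k) {p : Pt} (hp : p ∈ Ω) :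
    HasPD φ (fun i => pd i φ p) p := HasPD.of_diff (h.diff p hp)

theorem Weight.mul (h : Weight Ω e₀ d₀ ω₀ φ k) (h' : Weight Ω e₀ d₀ ω₀ ψ k') :
    Weight Ω e₀ d₀ ω₀ (fun q => φ q * ψ q) (k + k') :=
  Weight.of_hasPD (fun p hp => (h.hasPD hp).mul (h'.hasPD hp))
    (fun p hp => by
      have e1 := h.eq p hp
      have e2 := h'.eq p hp
      simp only [lieV] at *
      linear_combination ψ p * e1 + φ p * e2)
    (fun p hp => by simp [h.vert p hp, h'.vert p hp])

theorem Weight.div (h : Weight Ω e₀ d₀ ω₀ φ k) (h' : Weight Ω e₀ d₀ ω₀ ψ k')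
    (h0 : ∀ p ∈ Ω, ψ p ≠ 0) : Weight Ω e₀ d₀ ω₀ (fun q => φ q / ψ q) (k - k') :=
  Weight.of_hasPD (fun p hp => (h.hasPD hp).div (h'.hasPD hp) (h0 p hp))
    (fun p hp => by
      have e1 := h.eq p hp
      have e2 := h'.eq p hp
      have := h0 p hp
      simp only [lieV] at *
      field_simp
      linear_combination ψ p * e1 - φ p * e2)
    (fun p hp => by simp [h.vert p hp, h'.vert p hp])

theorem Weight.const_mul (c : ℂ) (h : Weight Ω e₀ d₀ ω₀ φ k) :
    Weight Ω e₀ d₀ ω₀ (fun q => c * φ q) k :=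
  Weight.of_hasPD (fun p hp => (h.hasPD hp).const_mul c)
    (fun p hp => by
      have e1 := h.eq p hp
      simp only [lieV] at *
      linear_combination c * e1)
    (fun p hp => by simp [h.vert p hp])

theorem Weight.add (h : Weight Ω e₀ d₀ ω₀ φ k) (h' : Weight Ω e₀ d₀ ω₀ ψ k) :
    Weight Ω e₀ d₀ ω₀ (fun q => φ q + ψ q) k :=
  Weight.of_hasPD (fun p hp => (h.hasPD hp).add (h'.hasPD hp))
    (fun p hp => by
      have e1 := h.eq p hp
      have e2 := h'.eq p hp
      simp only [lieV] at *
      linear_combination e1 + e2)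
    (fun p hp => by simp [h.vert p hp, h'.vert p hp])

theorem Weight.cj (h : Weight Ω e₀ d₀ ω₀ φ k) :
    Weight Ω e₀ d₀ ω₀ (fun q => conj (φ q)) (conj k) :=
  Weight.of_hasPD (fun p hp => (h.hasPD hp).cj)
    (fun p hp => by
      have e1 := congrArg conj (h.eq p hp)
      simp only [lieV, cjD, Matrix.cons_val, map_add, map_sub, map_mul, Complex.conj_I,
        Complex.conj_ofReal, conj_pu, Complex.conj_conj] at *
      linear_combination e1)
    (fun p hp => by simp [cjD, h.vert p hp])

theorem Weight.congr {Ω : Set Pt} (hΩ : IsOpen Ω) (h : Weight Ω e₀ d₀ ω₀ φ k)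
    (he : ∀ q ∈ Ω, ψ q = φ q) : Weight Ω e₀ d₀ ω₀ ψ k :=
  Weight.of_hasPD (fun p hp => (h.hasPD hp).congr hΩ he hp)
    (fun p hp => by rw [h.eq p hp, he p hp]) (fun p hp => h.vert p hp)

theorem Weight.change (h : Weight Ω e₀ d₀ ω₀ φ k) (hk : k = k') : Weight Ω e₀ d₀ ω₀ φ k' :=
  hk ▸ h

/-- The commutator [V, ∂_ζ] = -iω₀ ∂_ζ shifts the eigenvalue. For `Weight.pd_two` the relevant
commutator is [V, ∂_u] = -e₀ ∂_u. -/
theorem Weight.pd_zero (hΩ : IsOpen Ω) (hφ : Hol Ω φ) (h : Weight Ω e₀ d₀ ω₀ φ k) :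
    Weight Ω e₀ d₀ ω₀ (pd 0 φ) (k - Complex.I * ω₀) := by
  refine Weight.of_hasPD (fun p hp => (hφ.pd hΩ 0).hasPD hΩ hp) (fun p hp => ?_)
    (fun p hp => by simp)
  have H := (((HasPD.pu e₀ d₀ p).mul ((hφ.pd hΩ 2).hasPD hΩ hp)).add
    (((HasPD.zeta p).const_mul (Complex.I * ω₀)).mul ((hφ.pd hΩ 0).hasPD hΩ hp))).congr hΩ
    (ψ := fun q => k * φ q) (fun q hq => by
      rw [← h.eq q hq, lieV, hφ.bar q hq]; ring) hp
  have H0 := H.eq 0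
  rw [((hφ.hasPD hΩ hp).const_mul k).eq, pd_comm hΩ hφ.smooth 0 2 hp] at H0
  simp only [Matrix.cons_val] at H0
  simp only [lieV, Matrix.cons_val]
  linear_combination -H0

theorem Weight.pd_two (hΩ : IsOpen Ω) (hφ : Hol Ω φ) (h : Weight Ω e₀ d₀ ω₀ φ k) :
    Weight Ω e₀ d₀ ω₀ (pd 2 φ) (k - e₀) := by
  refine Weight.of_hasPD (fun p hp => (hφ.pd hΩ 2).hasPD hΩ hp) (fun p hp => ?_)
    (fun p hp => by simp)
  have H := (((HasPD.pu e₀ d₀ p).mul ((hφ.pd hΩ 2).hasPD hΩ hp)).add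
    (((HasPD.zeta p).const_mul (Complex.I * ω₀)).mul ((hφ.pd hΩ 0).hasPD hΩ hp))).congr hΩ
    (ψ := fun q => k * φ q) (fun q hq => by
      rw [← h.eq q hq, lieV, hφ.bar q hq]; ring) hp
  have H0 := H.eq 2
  rw [((hφ.hasPD hΩ hp).const_mul k).eq, pd_comm hΩ hφ.smooth 2 0 hp] at H0
  simp only [Matrix.cons_val] at H0
  simp only [lieV, Matrix.cons_val]
  linear_combination -H0

end Weights

/-! ### Linear algebra of covectors annihilated by a common vector. -/

section Wedge

/-- Three covectors without `∂_v`-component, two of which are independent and annihilated by `V`. -/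
theorem det_three_eq_zero_iff {x y z : Fin 4 → ℂ} {V : Fin 3 → ℂ}
    (hx3 : x 3 = 0) (hy3 : y 3 = 0) (hz3 : z 3 = 0)
    (hx : V 0 * x 0 + V 1 * x 1 + V 2 * x 2 = 0) (hy : V 0 * y 0 + V 1 * y 1 + V 2 * y 2 = 0)
    (hV : V ≠ 0) (hxy : ∃ a b, x a * y b - x b * y a ≠ 0) :
    (∀ a b c : Fin 4, x a * y b * z c - x a * y c * z b - x b * y a * z c + x b * y c * z a
      + x c * y a * z b - x c * y b * z a = 0) ↔
      V 0 * z 0 + V 1 * z 1 + V 2 * z 2 = 0 := by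
  constructor
  · intro h
    obtain ⟨a, b, hab⟩ := hxy
    have h0 := h a b 0
    have h1 := h a b 1
    have h2 := h a b 2
    have : (x a * y b - x b * y a) * (V 0 * z 0 + V 1 * z 1 + V 2 * z 2) = 0 := by
      linear_combination V 0 * h0 + V 1 * h1 + V 2 * h2 + (x a * z b - x b * z a) * hy
        - (y a * z b - y b * z a) * hx
    exact (mul_eq_zero.1 this).resolve_left hab
  · intro hz
    -- Without ∂_v-components there is a single 3 × 3 minor up to sign. By Cramer's rule it times
    -- each entry of V is zero, so V ≠ 0 makes it vanish.
    have D : x 0 * y 1 * z 2 - x 0 * y 2 * z 1 - x 1 * y 0 * z 2 + x 1 * y 2 * z 0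
        + x 2 * y 0 * z 1 - x 2 * y 1 * z 0 = 0 := by
      by_contra hD
      refine hV (funext fun i => ?_)
      fin_cases i
      · refine (mul_eq_zero.1 (?_ : V 0 * _ = 0)).resolve_right hD
        linear_combination (y 1 * z 2 - y 2 * z 1) * hx - (x 1 * z 2 - x 2 * z 1) * hy
          + (x 1 * y 2 - x 2 * y 1) * hz
      · refine (mul_eq_zero.1 (?_ : V 1 * _ = 0)).resolve_right hD
        linear_combination -(y 0 * z 2 - y 2 * z 0) * hx + (x 0 * z 2 - x 2 * z 0) * hy
          - (x 0 * y 2 - x 2 * y 0) * hz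
      · refine (mul_eq_zero.1 (?_ : V 2 * _ = 0)).resolve_right hD
        linear_combination (y 0 * z 1 - y 1 * z 0) * hx - (x 0 * z 1 - x 1 * z 0) * hy
          + (x 0 * y 1 - x 1 * y 0) * hz
    intro a b c
    fin_cases a <;> fin_cases b <;> fin_cases c <;> simp [hx3, hy3, hz3] <;>
      first | ring1 | linear_combination D | linear_combination -D

/-- When V has a nonzero u-component, the u-components of x and y are determined by the other two,
so every 2 × 2 minor is a multiple of the (ζ, ζ̄) minor. -/
theorem det_two_eq_zero {x y : Fin 4 → ℂ} {V : Fin 3 → ℂ} (hx3 : x 3 = 0) (hy3 : y 3 = 0)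
    (hx : V 0 * x 0 + V 1 * x 1 + V 2 * x 2 = 0) (hy : V 0 * y 0 + V 1 * y 1 + V 2 * y 2 = 0)
    (hV : V 2 ≠ 0) (h01 : x 0 * y 1 - x 1 * y 0 = 0) (a b : Fin 4) :
    x a * y b - x b * y a = 0 := by
  have h02 : x 0 * y 2 - x 2 * y 0 = 0 := by
    refine (mul_eq_zero.1 (?_ : V 2 * _ = 0)).resolve_left hV
    linear_combination x 0 * hy - y 0 * hx - V 1 * h01
  have h12 : x 1 * y 2 - x 2 * y 1 = 0 := by
    refine (mul_eq_zero.1 (?_ : V 2 * _ = 0)).resolve_left hV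
    linear_combination x 1 * hy - y 1 * hx + V 0 * h01
  fin_cases a <;> fin_cases b <;> simp [hx3, hy3] <;>
    first
    | ring1
    | linear_combination h01
    | linear_combination -h01
    | linear_combination h02
    | linear_combination -h02
    | linear_combination h12
    | linear_combination -h12

theorem wedge_two_ne_iff {φ ψ : Scalar} {p : Pt} :
    wedgeD ![φ, ψ] p ≠ 0 ↔ ∃ a b, pd a φ p * pd b ψ p - pd b φ p * pd a ψ p ≠ 0 := by
  rw [ne_eq, funext_iff, not_forall]
  constructor
  · rintro ⟨J, hJ⟩
    refine ⟨J 0, J 1, ?_⟩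
    simpa [wedgeD, Matrix.det_fin_two] using hJ
  · rintro ⟨a, b, h⟩
    exact ⟨![a, b], by simpa [wedgeD, Matrix.det_fin_two] using h⟩

theorem wedge_three_eq_iff {φ ψ χ : Scalar} {p : Pt} :
    wedgeD ![φ, ψ, χ] p = 0 ↔ ∀ a b c, pd a φ p * pd b ψ p * pd c χ p
      - pd a φ p * pd c ψ p * pd b χ p - pd b φ p * pd a ψ p * pd c χ p
      + pd b φ p * pd c ψ p * pd a χ p + pd c φ p * pd a ψ p * pd b χ p
      - pd c φ p * pd b ψ p * pd a χ p = 0 := by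
  rw [funext_iff]
  constructor
  · intro h a b c
    have := h ![a, b, c]
    simp only [wedgeD, Matrix.det_fin_three, Matrix.of_apply, Matrix.cons_val, Pi.zero_apply] at this
    linear_combination this
  · intro h J
    simp only [wedgeD, Matrix.det_fin_three, Matrix.of_apply, Matrix.cons_val, Pi.zero_apply]
    linear_combination h (J 0) (J 1) (J 2)

end Wedge

/-! ### Weights of the tetrad and of its invariants under the homothetic field. -/

section Symmetry

variable {f : ℂ → ℝ → ℂ} {Ω : Set Pt} (hΩ : IsOpen Ω) (hf : Hol Ω (pot f)) {e : Tetrad}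
  {e₀ d₀ ω₀ : ℝ} {t r : ℝ → ℂ}

include hΩ hf

/-- The ζ-derivative of the homogeneity relation removes t and isolates r. Every later appearance of
r comes from this equation. -/
theorem AffineSym.f1_eq (hs : AffineSym f Ω e₀ d₀ ω₀ t r) {p : Pt} (hp : p ∈ Ω) :
    pu e₀ d₀ p * pd 2 (f1 f) p + Complex.I * ω₀ * p.1 * f2 f p
      + (Complex.I * ω₀ + 2 * e₀) * f1 f p = r p.2.1 := by
  have h0 := hf.hasPD hΩ hp
  have H := (((HasPD.pu e₀ d₀ p).mul ((hf.pd hΩ 2).hasPD hΩ hp)).add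
    (((HasPD.zeta p).const_mul (Complex.I * ω₀)).mul
      ((hol_f1 hΩ hf).hasPD hΩ hp))).add (h0.const_mul (2 * e₀))
  have H' := ((HasPD.ofU (hs.diff_t p hp).hasDerivAt).add
    ((HasPD.ofU (hs.diff_r p hp).hasDerivAt).mul (HasPD.zeta p))).congr hΩ
    (fun q hq => hs.eq q hq) hp
  have := (H.eq 0).symm.trans (H'.eq 0)
  rw [pd_comm hΩ hf.smooth 0 2 hp] at this
  simp only [Matrix.cons_val] at this
  simp only [f2, f1] at this ⊢
  linear_combination this

/-- The second ζ-derivative removes r as well, so f'' is exactly homogeneous. Its eigenvalue is -2e₀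
from the potential and -iω₀ for each derivative. -/
theorem AffineSym.weight_f2 (hs : AffineSym f Ω e₀ d₀ ω₀ t r) :
    Weight Ω e₀ d₀ ω₀ (f2 f) (-2 * (e₀ + Complex.I * ω₀)) := by
  refine Weight.of_hasPD (fun p hp => (hol_f2 hΩ hf).hasPD hΩ hp) (fun p hp => ?_)
    (fun p hp => by simp)
  have h1 := hol_f1 hΩ hf
  have h2 := hol_f2 hΩ hf
  have H := (((HasPD.pu e₀ d₀ p).mul ((h1.pd hΩ 2).hasPD hΩ hp)).add
    (((HasPD.zeta p).const_mul (Complex.I * ω₀)).mul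
      (h2.hasPD hΩ hp))).add ((h1.hasPD hΩ hp).const_mul (Complex.I * ω₀ + 2 * e₀))
  have H' := (HasPD.ofU (hs.diff_r p hp).hasDerivAt).congr hΩ
    (fun q hq => hs.f1_eq hΩ hf hq) hp
  have := (H.eq 0).symm.trans (H'.eq 0)
  rw [pd_comm hΩ h1.smooth 0 2 hp] at this
  simp only [Matrix.cons_val] at this
  simp only [lieV, Matrix.cons_val]
  simp only [f2] at this ⊢
  linear_combination this

theorem AffineSym.weight_f3 (hs : AffineSym f Ω e₀ d₀ ω₀ t r) :
    Weight Ω e₀ d₀ ω₀ (f3 f) (-2 * (e₀ + Complex.I * ω₀) - Complex.I * ω₀) :=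
  (hs.weight_f2 hΩ hf).pd_zero hΩ (hol_f2 hΩ hf)

theorem AffineSym.weight_il (hs : AffineSym f Ω e₀ d₀ ω₀ t r) (he : e.IsInvariant f Ω) :
    Weight Ω e₀ d₀ ω₀ (il f) (Complex.I * ω₀) :=
  ((hs.weight_f2 hΩ hf).div (hs.weight_f3 hΩ hf) fun _ hp => he.f3_ne hΩ hf hp).change (by ring)

theorem AffineSym.weight_zz (hs : AffineSym f Ω e₀ d₀ ω₀ t r) (he : e.IsInvariant f Ω) :
    Weight Ω e₀ d₀ ω₀ (zz f) (Complex.I * ω₀ - e₀) :=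
  ((((hs.weight_f2 hΩ hf).pd_two hΩ (hol_f2 hΩ hf)).const_mul (-1)).div (hs.weight_f3 hΩ hf)
    fun _ hp => he.f3_ne hΩ hf hp).congr hΩ (fun q _ => by simp [zz]) |>.change (by ring)

/-- The eigenvalue equation of f'' divided by f'''. It expresses z through L, and its derivatives
drive all the invariant relations below. -/
theorem AffineSym.pu_mul_zz (hs : AffineSym f Ω e₀ d₀ ω₀ t r) (he : e.IsInvariant f Ω) {p : Pt}
    (hp : p ∈ Ω) :
    pu e₀ d₀ p * zz f p = Complex.I * ω₀ * p.1 + 2 * (e₀ + Complex.I * ω₀) * il f p := by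
  have h := (hs.weight_f2 hΩ hf).eq p hp
  have h3 := he.f3_ne hΩ hf hp
  rw [lieV, (hol_f2 hΩ hf).bar p hp, show pd 0 (f2 f) p = f3 f p from rfl] at h
  rw [zz, il]
  field_simp
  linear_combination -h

theorem AffineSym.weight_boost (hs : AffineSym f Ω e₀ d₀ ω₀ t r) (he : e.IsInvariant f Ω) :
    Weight Ω e₀ d₀ ω₀ (fun q => e.n q 2) e₀ := by
  refine Weight.of_hasPD (fun p hp => he.hasPD_boost hΩ hf hp) (fun p hp => ?_) (fun p hp => rfl)
  have h := hs.pu_mul_zz hΩ hf he hp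
  have h' := congrArg conj h
  simp only [map_mul, map_add, Complex.conj_I, Complex.conj_ofReal, Complex.conj_ofNat,
    conj_pu] at h'
  have hi := il_ne hΩ hf he hp
  have hi' : conj (il f p) ≠ 0 := by simpa using hi
  simp only [lieV, Matrix.cons_val]
  field_simp
  linear_combination e.n p 2 * conj (il f p) * h + e.n p 2 * il f p * h'

theorem AffineSym.weight_phase (hs : AffineSym f Ω e₀ d₀ ω₀ t r) (he : e.IsInvariant f Ω) :
    Weight Ω e₀ d₀ ω₀ (fun q => e.m q 0) (Complex.I * ω₀) := by
  refine Weight.of_hasPD (fun p hp => he.hasPD_phase hΩ hf hp) (fun p hp => ?_) (fun p hp => rfl)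
  have h := hs.pu_mul_zz hΩ hf he hp
  have h' := congrArg conj h
  simp only [map_mul, map_add, Complex.conj_I, Complex.conj_ofReal, Complex.conj_ofNat,
    conj_pu] at h'
  have hi := il_ne hΩ hf he hp
  have hi' : conj (il f p) ≠ 0 := by simpa using hi
  simp only [lieV, Matrix.cons_val]
  field_simp
  linear_combination e.m p 0 * conj (il f p) * h - e.m p 0 * il f p * h'

/-- In α = w̄/(4 L̄) both w and L have weight iω₀, so the weights cancel and α is constant along V.
-/
theorem AffineSym.weight_al (hs : AffineSym f Ω e₀ d₀ ω₀ t r) (he : e.IsInvariant f Ω) :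
    Weight Ω e₀ d₀ ω₀ (e.al f) 0 := by
  refine (((hs.weight_phase hΩ hf he).cj.div ((hs.weight_il hΩ hf he).cj.const_mul 4)
    fun p hp => ?_).congr hΩ fun q hq => he.al_eq hΩ hf hq).change (by ring)
  simpa using il_ne hΩ hf he hp

/-- The derivative of `ν` along the symmetry. -/
theorem AffineSym.lieV_nu (hs : AffineSym f Ω e₀ d₀ ω₀ t r) (he : e.IsInvariant f Ω) {p : Pt}
    (hp : p ∈ Ω) : lieV e₀ d₀ ω₀ p (fun i => pd i (e.nu f) p)
      = conj (e.m p 0) * e.n p 2 ^ 2 * conj (r p.2.1) / 2 ∧ pd 3 (e.nu f) p = 0 := by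
  have hz := hol_zz hΩ hf he
  have wz := hs.weight_zz hΩ hf he
  have wa := hs.weight_boost hΩ hf he
  have ww := (hs.weight_phase hΩ hf he).cj
  have w1 := ((ww.mul wa).mul wa)
  -- Both z_u and z z_ζ have weight iω₀ - 2e₀, opposite to the weight of w̄ a². This part of ν is
  -- constant along V, and only the term with conj(f') can contribute.
  have w2 := w1.mul (((wz.pd_two hΩ hz).change (k' := Complex.I * ω₀ - 2 * e₀) (by ring)).add
    ((wz.mul (wz.pd_zero hΩ hz)).change (by ring)))
  have h1 := ((hol_f1 hΩ hf).hasPD hΩ hp).cj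
  have H := ((w2.hasPD hp).add (((w1.hasPD hp).mul h1).const_mul (1 / 2))).congr hΩ
    (ψ := e.nu f) (fun q hq => by rw [he.nu_eq hΩ hf hq]; ring) hp
  have hr := congrArg conj (hs.f1_eq hΩ hf hp)
  have E1 := w1.eq p hp
  have E2 := w2.eq p hp
  simp only [map_mul, map_add, Complex.conj_I, Complex.conj_ofReal, Complex.conj_ofNat,
    conj_pu] at hr E1 E2
  constructor
  · simp only [H.eq]
    simp only [lieV, cjD, Matrix.cons_val, map_zero, show pd 0 (f1 f) p = f2 f p from rfl]
      at E1 E2 ⊢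
    linear_combination E2 + (1 / 2 * conj (f1 f p)) * E1
      + (1 / 2 * conj (e.m p 0) * e.n p 2 * e.n p 2) * hr
  · rw [H.eq]
    simp [w2.vert p hp, w1.vert p hp, cjD]

/-- Since dα and dα* are independent and annihilate V ≠ 0, the triple wedge vanishes exactly where
Vν = 0, that is, where r = 0. The alternative in `hV` also admits the pure rotation, which has no
u-component. -/
theorem AffineSym.nuDependent_iff (hs : AffineSym f Ω e₀ d₀ ω₀ t r) (he : e.IsInvariant f Ω)
    (h02 : e.IsType02 f Ω) (hV : ∀ p ∈ Ω, pu e₀ d₀ p ≠ 0 ∨ (ω₀ : ℂ) * p.1 ≠ 0) :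
    e.NuDependent f Ω ↔ ∀ p ∈ Ω, r p.2.1 = 0 := by
  refine forall₂_congr fun p hp => ?_
  have wa := hs.weight_al hΩ hf he
  have ea := wa.eq p hp
  have ec : lieV e₀ d₀ ω₀ p (fun i => pd i (cj (e.al f)) p) = _ := wa.cj.eq p hp
  obtain ⟨en, e3⟩ := hs.lieV_nu hΩ hf he hp
  have c := he.comps hp
  rw [wedge_three_eq_iff, det_three_eq_zero_iff
    (V := ![Complex.I * ω₀ * p.1, -(Complex.I * ω₀ * conj p.1), pu e₀ d₀ p])
    (x := fun i => pd i (e.al f) p) (y := fun i => pd i (cj (e.al f)) p)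
    (z := fun i => pd i (e.nu f) p) (wa.vert p hp) (wa.cj.vert p hp) e3]
  · simp only [lieV] at en
    simp only [Matrix.cons_val]
    have h1 : conj (e.m p 0) * e.n p 2 ^ 2 ≠ 0 :=
      mul_ne_zero (right_ne_zero_of_mul_eq_one c.m0) (pow_ne_zero 2 c.n2_ne)
    constructor
    · intro h
      have : (conj (e.m p 0) * e.n p 2 ^ 2) * conj (r p.2.1) = 0 := by
        linear_combination 2 * h - 2 * en
      simpa using (mul_eq_zero.1 this).resolve_left h1
    · intro h
      rw [h] at en
      simp only [map_zero] at en
      linear_combination en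
  · simp only [lieV] at ea
    simp only [Matrix.cons_val]
    linear_combination ea
  · simp only [lieV] at ec
    simp only [Matrix.cons_val]
    simp only [map_zero, zero_mul] at ec
    linear_combination ec
  · intro h0
    rcases hV p hp with h | h
    · exact h (by simpa using congrFun h0 2)
    · exact h (by simpa using congrFun h0 0)
  · exact wedge_two_ne_iff.1 (h02 p hp)

/-- The (ζ, ζ̄) minor of dα ∧ dα* is |α|²(1 - AA*)/(16|L|²). If it were zero, `det_two_eq_zero`
would make the whole wedge vanish, because V annihilates both differentials. -/
theorem AffineSym.A_mul_conj_ne (hs : AffineSym f Ω e₀ d₀ ω₀ t r) (he : e.IsInvariant f Ω)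
    (h02 : e.IsType02 f Ω) {p : Pt} (hp : p ∈ Ω) (hV : pu e₀ d₀ p ≠ 0) :
    e.A f p * conj (e.A f p) ≠ 1 := by
  intro hA
  have wa := hs.weight_al hΩ hf he
  have ea := wa.eq p hp
  have ec : lieV e₀ d₀ ω₀ p (fun i => pd i (cj (e.al f)) p) = _ := wa.cj.eq p hp
  obtain ⟨a, b, hab⟩ := wedge_two_ne_iff.1 (h02 p hp)
  have hal := he.hasPD_al hΩ hf hp
  refine hab (det_two_eq_zero
    (V := ![Complex.I * ω₀ * p.1, -(Complex.I * ω₀ * conj p.1), pu e₀ d₀ p])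
    (x := fun i => pd i (e.al f) p) (y := fun i => pd i (cj (e.al f)) p)
    (wa.vert p hp) (wa.cj.vert p hp) ?_ ?_ hV ?_ a b)
  · simp only [lieV] at ea
    simp only [Matrix.cons_val]
    linear_combination ea
  · simp only [lieV] at ec
    simp only [Matrix.cons_val]
    simp only [map_zero, zero_mul] at ec
    linear_combination ec
  · have hcj : ∀ i, pd i (cj (e.al f)) p = _ := hal.cj.eq
    rw [he.A_eq hΩ hf hp] at hA
    simp only [map_sub, map_neg, map_one, map_mul, Complex.conj_conj, Complex.conj_ofNat] at hA
    have hi := il_ne hΩ hf he hp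
    have hi' : conj (il f p) ≠ 0 := by simpa using hi
    simp only [hcj, hal.eq, cjD, Matrix.cons_val, map_neg, map_div₀, map_mul, map_add, map_one,
      Complex.conj_conj, Complex.conj_ofNat]
    field_simp
    linear_combination -(e.al f p * conj (e.al f p)) * hA

end Symmetry


/-! ## Invariant relations -/

section Relations

variable {f : ℂ → ℝ → ℂ} {Ω : Set Pt} (hΩ : IsOpen Ω) (hf : Hol Ω (pot f)) {e : Tetrad}
  {e₀ d₀ ω₀ : ℝ} {t r : ℝ → ℂ}

include hΩ hf

theorem Tetrad.IsInvariant.pd_il (he : e.IsInvariant f Ω) {p : Pt} (hp : p ∈ Ω) :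
    pd 0 (il f) p = -(1 + conj (e.A f p)) / 4 := by
  rw [he.A_eq hΩ hf hp]
  simp only [map_sub, map_neg, map_one, map_mul, Complex.conj_conj, Complex.conj_ofNat]
  ring

theorem AffineSym.pu_mul_pd_zz (hs : AffineSym f Ω e₀ d₀ ω₀ t r) (he : e.IsInvariant f Ω) {p : Pt}
    (hp : p ∈ Ω) :
    pu e₀ d₀ p * pd 0 (zz f) p
        = Complex.I * ω₀ + 2 * (e₀ + Complex.I * ω₀) * pd 0 (il f) p ∧
      pu e₀ d₀ p * pd 2 (zz f) p
        = 2 * (e₀ + Complex.I * ω₀) * pd 2 (il f) p - e₀ * zz f p := by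
  have H := ((HasPD.pu e₀ d₀ p).mul ((hol_zz hΩ hf he).hasPD hΩ hp))
  have H' := (((HasPD.zeta p).const_mul (Complex.I * ω₀)).add
    (((hol_il hΩ hf he).hasPD hΩ hp).const_mul (2 * (e₀ + Complex.I * ω₀)))).congr hΩ
    (fun q hq => hs.pu_mul_zz hΩ hf he hq) hp
  have E0 := (H.eq 0).symm.trans (H'.eq 0)
  have E2 := (H.eq 2).symm.trans (H'.eq 2)
  simp only [Matrix.cons_val] at E0 E2
  exact ⟨by linear_combination E0, by linear_combination E2⟩

theorem AffineSym.mu_eq (hs : AffineSym f Ω e₀ d₀ ω₀ t r) (he : e.IsInvariant f Ω) {p : Pt}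
    (hp : p ∈ Ω) (hV : pu e₀ d₀ p ≠ 0) :
    e.mu f p = -(e.n p 2 / (2 * pu e₀ d₀ p)) *
      (conj (e₀ + Complex.I * ω₀ : ℂ) + (e₀ + Complex.I * ω₀) * conj (e.A f p)) := by
  have h := (hs.pu_mul_pd_zz hΩ hf he hp).1
  rw [he.pd_il hΩ hf hp] at h
  rw [he.mu_eq hΩ hf hp]
  simp only [map_add, map_mul, Complex.conj_I, Complex.conj_ofReal]
  field_simp
  linear_combination (2 * e.n p 2) * h

theorem AffineSym.B_eq (hs : AffineSym f Ω e₀ d₀ ω₀ t r) (he : e.IsInvariant f Ω) {p : Pt}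
    (hp : p ∈ Ω) (hV : pu e₀ d₀ p ≠ 0) :
    e.B f p = e.n p 2 / (2 * pu e₀ d₀ p) * (e₀ + Complex.I * ω₀) *
      (1 - e.A f p * conj (e.A f p)) := by
  have c := he.comps hp
  rw [Tetrad.B, hs.mu_eq hΩ hf he hp hV]
  simp only [map_add, map_mul, map_neg, map_div₀, Complex.conj_I, Complex.conj_ofReal, c.n2,
    Complex.conj_ofNat, conj_pu, Complex.conj_conj]
  ring

/-- The invariant `B` is a nonzero real multiple of `e₀ + i ω₀`. -/
theorem AffineSym.B_real_multiple (hs : AffineSym f Ω e₀ d₀ ω₀ t r) (he : e.IsInvariant f Ω)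
    (h02 : e.IsType02 f Ω) {p : Pt} (hp : p ∈ Ω) (hV : pu e₀ d₀ p ≠ 0) :
    ∃ s : ℝ, s ≠ 0 ∧ e.B f p = s * (e₀ + Complex.I * ω₀) := by
  have c := he.comps hp
  have hA := hs.A_mul_conj_ne hΩ hf he h02 hp hV
  have hr : conj (e.n p 2 / (2 * pu e₀ d₀ p) * (1 - e.A f p * conj (e.A f p)))
      = e.n p 2 / (2 * pu e₀ d₀ p) * (1 - e.A f p * conj (e.A f p)) := by
    simp only [map_sub, map_mul, map_one, map_div₀, c.n2, Complex.conj_ofNat, conj_pu,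
      Complex.conj_conj]
    ring
  obtain ⟨s, hs'⟩ := Complex.conj_eq_iff_real.1 hr
  refine ⟨s, fun h0 => ?_, ?_⟩
  · rw [h0, Complex.ofReal_zero] at hs'
    have h1 : e.n p 2 / (2 * pu e₀ d₀ p) ≠ 0 := div_ne_zero c.n2_ne (mul_ne_zero two_ne_zero hV)
    exact hA (sub_eq_zero.1 ((mul_eq_zero.1 hs').resolve_left h1)).symm
  · rw [hs.B_eq hΩ hf he hp hV, ← hs']
    ring

/-- Division by AA* - 1 cancels the factor 1 - AA* of B up to sign, so X is a real multiple of e₀ +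
iω₀. This is how X₁ and X₂ recover the type of the symmetry. -/
theorem AffineSym.X_eq (hs : AffineSym f Ω e₀ d₀ ω₀ t r) (he : e.IsInvariant f Ω)
    (h02 : e.IsType02 f Ω) {p : Pt} (hp : p ∈ Ω) (hV : pu e₀ d₀ p ≠ 0) :
    e.X f p = -(e.n p 2 / (2 * pu e₀ d₀ p)) * (e₀ + Complex.I * ω₀) := by
  have hA := sub_ne_zero.2 (hs.A_mul_conj_ne hΩ hf he h02 hp hV)
  rw [Tetrad.X, hs.B_eq hΩ hf he hp hV, div_eq_iff hA]
  ring

theorem AffineSym.X1_eq (hs : AffineSym f Ω e₀ d₀ ω₀ t r) (he : e.IsInvariant f Ω)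
    (h02 : e.IsType02 f Ω) {p : Pt} (hp : p ∈ Ω) (hV : pu e₀ d₀ p ≠ 0) :
    e.X1 f p = -(e₀ / 2) * (e.n p 2 / pu e₀ d₀ p) ∧
      e.X2 f p = -(ω₀ / 2) * (e.n p 2 / pu e₀ d₀ p) := by
  have c := he.comps hp
  have hx := hs.X_eq hΩ hf he h02 hp hV
  have hr : conj (e.n p 2 / pu e₀ d₀ p) = e.n p 2 / pu e₀ d₀ p := by
    rw [map_div₀, c.n2, conj_pu]
  obtain ⟨s, hs'⟩ := Complex.conj_eq_iff_real.1 hr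
  have hx' : e.X f p = ((-(s * e₀ / 2) : ℝ) : ℂ) + ((-(s * ω₀ / 2) : ℝ) : ℂ) * Complex.I := by
    push_cast
    rw [hx, ← hs']
    ring
  rw [Tetrad.X1, Tetrad.X2, hx', hs']
  simp only [Complex.add_re, Complex.add_im, Complex.ofReal_re, Complex.ofReal_im,
    Complex.re_ofReal_mul, Complex.im_ofReal_mul, Complex.I_re, Complex.I_im]
  push_cast
  constructor <;> ring

theorem Tetrad.IsInvariant.dn_boost (he : e.IsInvariant f Ω) {p : Pt} (hp : p ∈ Ω) :
    dn f (fun i => pd i (fun q => e.n q 2) p) p = 0 := by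
  simp only [dn, (he.hasPD_boost hΩ hf hp).eq, Matrix.cons_val]
  ring

theorem Tetrad.IsInvariant.dn_phase (he : e.IsInvariant f Ω) {p : Pt} (hp : p ∈ Ω) :
    dn f (fun i => pd i (fun q => conj (e.m q 0)) p) p = 0 := by
  simp only [dn, (he.hasPD_phase hΩ hf hp).cj.eq, cjD, Matrix.cons_val, map_mul, map_div₀, map_sub,
    map_neg, Complex.conj_conj, Complex.conj_ofNat]
  ring

/-- The factor a is constant along n, and Δ(e₀u + d₀) = a e₀, so Δ only differentiates the
denominator. -/
theorem Tetrad.IsInvariant.act_boost_div (he : e.IsInvariant f Ω)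
    (hV : ∀ p ∈ Ω, pu e₀ d₀ p ≠ 0) {p : Pt} (hp : p ∈ Ω) {φ : Scalar} (c : ℂ)
    (hφ : ∀ q ∈ Ω, φ q = c * (e.n q 2 / pu e₀ d₀ q)) :
    act e.n φ p = -c * e₀ * (e.n p 2 / pu e₀ d₀ p) ^ 2 := by
  have hb := he.hasPD_boost hΩ hf hp
  have hd := he.dn_boost hΩ hf hp
  have H := (((HasPD.of_diff hb.diff).div (HasPD.pu e₀ d₀ p) (hV p hp)).const_mul c).congr hΩ hφ hp
  rw [he.act_n hΩ hf hp H (by simp [hb.eq])]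
  have := hV p hp
  simp only [dn, Matrix.cons_val] at hd ⊢
  field_simp
  linear_combination (c * e.n p 2 * pu e₀ d₀ p) * hd

theorem AffineSym.act_X1 (hs : AffineSym f Ω e₀ d₀ ω₀ t r) (he : e.IsInvariant f Ω)
    (h02 : e.IsType02 f Ω) (hV : ∀ p ∈ Ω, pu e₀ d₀ p ≠ 0) {p : Pt} (hp : p ∈ Ω) :
    act e.n (e.X1 f) p = 2 * e.X1 f p ^ 2 := by
  rw [he.act_boost_div hΩ hf hV hp _ fun q hq => (hs.X1_eq hΩ hf he h02 hq (hV q hq)).1,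
    (hs.X1_eq hΩ hf he h02 hp (hV p hp)).1]
  ring

theorem AffineSym.act_X2 (hs : AffineSym f Ω e₀ d₀ ω₀ t r) (he : e.IsInvariant f Ω)
    (h02 : e.IsType02 f Ω) (hV : ∀ p ∈ Ω, pu e₀ d₀ p ≠ 0) {p : Pt} (hp : p ∈ Ω) (h0 : e₀ = 0) :
    act e.n (e.X2 f) p = 0 := by
  rw [he.act_boost_div hΩ hf hV hp _ fun q hq => (hs.X1_eq hΩ hf he h02 hq (hV q hq)).2, h0]
  simp

/-- The correction X(μ + 2X*)/α* in ν̂ cancels every term containing L, so that only conj(f') and an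
explicit multiple of ζ remain. -/
theorem AffineSym.nuHat_eq (hs : AffineSym f Ω e₀ d₀ ω₀ t r) (he : e.IsInvariant f Ω)
    (h02 : e.IsType02 f Ω) {p : Pt} (hp : p ∈ Ω) (hV : pu e₀ d₀ p ≠ 0) :
    e.nuHat f p = conj (e.m p 0) * e.n p 2 ^ 2 * (conj (f1 f p) / 2
      - Complex.I * ω₀ * (e₀ - Complex.I * ω₀) * p.1 / pu e₀ d₀ p ^ 2) := by
  have c := he.comps hp
  have hi := il_ne hΩ hf he hp
  obtain ⟨h0, h2⟩ := hs.pu_mul_pd_zz hΩ hf he hp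
  have hz := hs.pu_mul_zz hΩ hf he hp
  rw [pd_two_il hΩ hf he hp] at h2
  have hm0 := left_ne_zero_of_mul_eq_one c.m0
  rw [Tetrad.nuHat, he.nu_eq hΩ hf hp, he.mu_eq hΩ hf hp, hs.X_eq hΩ hf he h02 hp hV,
    he.al_eq hΩ hf hp]
  simp only [map_add, map_mul, map_neg, map_div₀, Complex.conj_I, Complex.conj_ofReal, c.n2,
    Complex.conj_ofNat, conj_pu, Complex.conj_conj]
  have hcm : conj (e.m p 0) = 1 / e.m p 0 := by
    rw [eq_div_iff hm0]; linear_combination c.m0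
  rw [hcm]
  -- Combines `pu_mul_zz`, its derivatives and the transport equation `pd_two_il`. The subtracted
  -- multiple of L is the one that the correction term of ν̂ removes.
  have key : pu e₀ d₀ p ^ 2 * (pd 2 (zz f) p + zz f p * pd 0 (zz f) p)
      - 2 * (e₀ + Complex.I * ω₀) * (pu e₀ d₀ p * pd 0 (zz f) p - (e₀ - Complex.I * ω₀)) * il f p
      = -(Complex.I * ω₀ * (e₀ - Complex.I * ω₀) * p.1) := by
    linear_combination pu e₀ d₀ p * h2 + (pu e₀ d₀ p * zz f p) * h0
      + (Complex.I * ω₀ - e₀) * hz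
  have e1 : pd 2 (zz f) p + zz f p * pd 0 (zz f) p
      = (2 * (e₀ + Complex.I * ω₀) * (pu e₀ d₀ p * pd 0 (zz f) p - (e₀ - Complex.I * ω₀)) * il f p
      -(Complex.I * ω₀ * (e₀ - Complex.I * ω₀) * p.1)) / pu e₀ d₀ p ^ 2 := by
    rw [eq_div_iff (pow_ne_zero 2 hV)]
    linear_combination key
  rw [e1]
  field_simp
  ring

/-- One has ν̂/X* = -w̄ a G with G = (e₀u + d₀) conj(f')/(e₀ - iω₀) - 2iω₀ζ/(e₀u + d₀). As a and w
are constant along n, Δ acts on G alone. The conjugate of `AffineSym.f1_eq` brings in r̄, and the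
remaining terms of Υ̂ cancel everything else. -/
theorem AffineSym.upsHat_eq (hs : AffineSym f Ω e₀ d₀ ω₀ t r) (he : e.IsInvariant f Ω)
    (h02 : e.IsType02 f Ω) (hV : ∀ p ∈ Ω, pu e₀ d₀ p ≠ 0) (hk : (e₀ - Complex.I * ω₀ : ℂ) ≠ 0)
    {p : Pt} (hp : p ∈ Ω) :
    e.upsHat f p = -(conj (e.m p 0) * e.n p 2 ^ 2 * conj (r p.2.1) / (e₀ - Complex.I * ω₀)) := by
  have c := he.comps hp
  have hi := il_ne hΩ hf he hp
  have hz := hs.pu_mul_zz hΩ hf he hp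
  have hz' := congrArg conj hz
  have hr := congrArg conj (hs.f1_eq hΩ hf hp)
  have hn := he.normalization hΩ hf hp
  have hb := he.hasPD_boost hΩ hf hp
  have hw := (he.hasPD_phase hΩ hf hp).cj
  have hdb := he.dn_boost hΩ hf hp
  have hdw := he.dn_phase hΩ hf hp
  have hf1 := ((hol_f1 hΩ hf).hasPD hΩ hp).cj
  have hp0 := hV p hp
  have hpu := HasPD.pu e₀ d₀ p
  simp only [map_add, map_mul, Complex.conj_I, Complex.conj_ofReal, Complex.conj_ofNat,
    conj_pu] at hz' hr
  have HG := ((hpu.mul hf1).const_mul (e₀ - Complex.I * ω₀ : ℂ)⁻¹).sub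
    (((HasPD.zeta p).const_mul (2 * Complex.I * ω₀)).div hpu hp0)
  have H := ((((HasPD.of_diff hw.diff).mul (HasPD.of_diff hb.diff)).mul HG).neg).congr hΩ
    (ψ := fun q => e.nuHat f q / conj (e.X f q)) (fun q hq => by
      have c := he.comps hq
      have := hV q hq
      have := c.n2_ne
      rw [hs.nuHat_eq hΩ hf he h02 hq (hV q hq), hs.X_eq hΩ hf he h02 hq (hV q hq)]
      simp only [map_add, map_mul, map_neg, map_div₀, Complex.conj_I, Complex.conj_ofReal, c.n2,
        Complex.conj_ofNat, conj_pu]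
      have hk' : (e₀ + -Complex.I * ω₀ : ℂ) ≠ 0 := by
        rwa [neg_mul, ← sub_eq_add_neg]
      have hk'' : (e₀ + -Complex.I * ω₀ : ℂ) = e₀ - Complex.I * ω₀ := by ring
      rw [hk'']
      field_simp) hp
  have hact : act e.n (fun q => e.nuHat f q / conj (e.X f q)) p
      = -(conj (e.m p 0) * e.n p 2 ^ 2) * (conj (r p.2.1) / (e₀ - Complex.I * ω₀) - conj (f1 f p)
        + 2 * conj (il f p) * conj (f2 f p)
        - 2 * Complex.I * ω₀ * (zz f p / pu e₀ d₀ p - e₀ * p.1 / pu e₀ d₀ p ^ 2)) := by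
    rw [he.act_n hΩ hf hp H (by simp [hb.eq, hw.eq, cjD])]
    simp only [dn] at hdb hdw
    simp only [dn, cjD, Matrix.cons_val, map_zero, show pd 0 (f1 f) p = f2 f p from rfl]
    have e1 : e₀ * conj (f1 f p) + pu e₀ d₀ p * (conj (zz f p) * conj (f2 f p)
        + conj (pd 2 (f1 f) p)) = conj (r p.2.1) - (e₀ - Complex.I * ω₀) * conj (f1 f p)
        + 2 * (e₀ - Complex.I * ω₀) * conj (il f p) * conj (f2 f p) := by
      linear_combination hr + conj (f2 f p) * hz'
    have e2 : conj (r p.2.1) / (e₀ - Complex.I * ω₀) - conj (f1 f p)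
        + 2 * conj (il f p) * conj (f2 f p) = (e₀ * conj (f1 f p) + pu e₀ d₀ p *
          (conj (zz f p) * conj (f2 f p) + conj (pd 2 (f1 f) p))) / (e₀ - Complex.I * ω₀) := by
      rw [e1]
      field_simp
    rw [e2]
    generalize hG : (e₀ - Complex.I * ω₀ : ℂ)⁻¹ * (pu e₀ d₀ p * conj (f1 f p))
      - 2 * Complex.I * ω₀ * p.1 / pu e₀ d₀ p = G
    rw [div_eq_mul_inv _ (e₀ - Complex.I * ω₀ : ℂ)]
    generalize (e₀ - Complex.I * ω₀ : ℂ)⁻¹ = κ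
    field_simp
    linear_combination (-(e.n p 2) ^ 2 * G * pu e₀ d₀ p ^ 2) * hdw
      - (e.n p 2 * G * pu e₀ d₀ p ^ 2 * conj (e.m p 0)) * hdb
  have hm0 := left_ne_zero_of_mul_eq_one c.m0
  have hcm : conj (e.m p 0) = 1 / e.m p 0 := by
    rw [eq_div_iff hm0]; linear_combination c.m0
  -- Here 1/α = 4 L̄/w̄, with the 4 rewritten by means of (a w̄)² conj(f'') = 2. In this form it
  -- cancels the f'' term of Δ(ν̂/X*).
  have hal : 1 / e.al f p = conj (e.m p 0) * e.n p 2 ^ 2 * (2 * conj (il f p) * conj (f2 f p)) := by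
    have hi' : conj (il f p) ≠ 0 := by simpa using hi
    rw [he.al_eq hΩ hf hp]
    rw [hcm] at hn ⊢
    field_simp at hn ⊢
    linear_combination -2 * hn
  rw [Tetrad.upsHat, hact, hs.nuHat_eq hΩ hf he h02 hp (hV p hp), hal,
    hs.X_eq hΩ hf he h02 hp (hV p hp), (hs.X1_eq hΩ hf he h02 hp (hV p hp)).2, he.al_eq hΩ hf hp]
  simp only [map_mul, map_div₀, Complex.conj_conj, Complex.conj_ofNat]
  rw [hcm]
  have hzz : zz f p = (Complex.I * ω₀ * p.1 + 2 * (e₀ + Complex.I * ω₀) * il f p) / pu e₀ d₀ p := by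
    rw [eq_div_iff hp0]; linear_combination hz
  rw [hzz]
  field_simp
  ring

theorem AffineSym.upsHat_iff (hs : AffineSym f Ω e₀ d₀ ω₀ t r) (he : e.IsInvariant f Ω)
    (h02 : e.IsType02 f Ω) (hV : ∀ p ∈ Ω, pu e₀ d₀ p ≠ 0) (hk : (e₀ - Complex.I * ω₀ : ℂ) ≠ 0) :
    (∀ p ∈ Ω, e.upsHat f p = 0) ↔ ∀ p ∈ Ω, r p.2.1 = 0 := by
  refine forall₂_congr fun p hp => ?_
  have c := he.comps hp
  have hm := right_ne_zero_of_mul_eq_one c.m0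
  rw [hs.upsHat_eq hΩ hf he h02 hV hk hp]
  simp only [neg_eq_zero, div_eq_zero_iff, hk, or_false, mul_eq_zero, hm, pow_eq_zero_iff,
    c.n2_ne, ne_eq, OfNat.ofNat_ne_zero, not_false_eq_true, false_or, map_eq_zero]

/-- For a translation in `u`, the invariant `Δν` measures the affine term. -/
theorem AffineSym.act_nu_iff (hs : AffineSym f Ω 0 1 0 t r) (he : e.IsInvariant f Ω) :
    (∀ p ∈ Ω, e.mu f p = 0) ∧
      ((∀ p ∈ Ω, act e.n (e.nu f) p = 0) ↔ ∀ p ∈ Ω, r p.2.1 = 0) := by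
  -- With e₀ = ω₀ = 0 the second derivative f'' does not depend on u, so z vanishes and n moves
  -- neither ζ nor f''.
  have hz : ∀ p ∈ Ω, zz f p = 0 := fun p hp => by
    have := hs.pu_mul_zz hΩ hf he hp
    simpa [pu] using this
  have hz' : ∀ p ∈ Ω, ∀ i, pd i (zz f) p = 0 := fun p hp i => pd_of_eq_zero hΩ hz hp i
  refine ⟨fun p hp => by rw [he.mu_eq hΩ hf hp, hz' p hp, mul_zero], ?_⟩
  refine forall₂_congr fun p hp => ?_
  have c := he.comps hp
  have hm := right_ne_zero_of_mul_eq_one c.m0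
  have hb := he.hasPD_boost hΩ hf hp
  have hw := (he.hasPD_phase hΩ hf hp).cj
  have hf1 := ((hol_f1 hΩ hf).hasPD hΩ hp).cj
  have hdb := he.dn_boost hΩ hf hp
  have hdw := he.dn_phase hΩ hf hp
  have hr := hs.f1_eq hΩ hf hp
  have hb' := HasPD.of_diff hb.diff
  have H := ((((HasPD.of_diff hw.diff).mul hb').mul hb').mul (hf1.const_mul (1 / 2))).congr hΩ
    (ψ := e.nu f) (fun q hq => by
      rw [he.nu_eq hΩ hf hq, hz q hq, hz' q hq]; ring) hp
  have : act e.n (e.nu f) p = conj (e.m p 0) * e.n p 2 ^ 3 / 2 * conj (r p.2.1) := by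
    rw [he.act_n hΩ hf hp H (by simp [hb.eq, hw.eq, cjD]), ← hr]
    simp only [dn, hz p hp, map_zero, zero_mul, zero_add] at hdb hdw
    simp [dn, hz p hp, cjD, pu, hdb, hdw]
    ring
  rw [this]
  simp only [div_eq_zero_iff, mul_eq_zero, hm, pow_eq_zero_iff,
    c.n2_ne, ne_eq, OfNat.ofNat_ne_zero, not_false_eq_true, false_or, map_eq_zero]

/-! ### The case of a pure rotation, used for the logarithmic class. -/

section Rotation

/-- For a rotation in `ζ`: the form of the potential. -/
theorem AffineSym.rotation_eq (hs : AffineSym f Ω 0 0 1 t r) (he : e.IsInvariant f Ω) {p : Pt}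
    (hp : p ∈ Ω) : il f p = -p.1 / 2 ∧ zz f p = p.1 * pd 0 (zz f) p ∧
      f1 f p = -Complex.I * r p.2.1 - p.1 * f2 f p := by
  have h1 := hs.pu_mul_zz hΩ hf he hp
  have h2 := (hs.weight_zz hΩ hf he).eq p hp
  have h3 := hs.f1_eq hΩ hf hp
  rw [lieV, (hol_zz hΩ hf he).bar p hp] at h2
  simp only [pu, Complex.ofReal_zero, Complex.ofReal_one, mul_one, zero_mul, zero_add, sub_zero,
    mul_zero, add_zero] at h1 h2 h3
  have hI := Complex.I_mul_I
  refine ⟨?_, ?_, ?_⟩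
  · linear_combination (Complex.I / 2) * h1 + (p.1 / 2 + il f p) * hI
  · linear_combination (Complex.I) * h2 + (zz f p - p.1 * pd 0 (zz f) p) * hI
  · linear_combination (-Complex.I) * h3 + (p.1 * f2 f p + f1 f p) * hI

theorem AffineSym.rotation_zeta_ne (hs : AffineSym f Ω 0 0 1 t r) (he : e.IsInvariant f Ω) {p : Pt}
    (hp : p ∈ Ω) : p.1 ≠ 0 := by
  intro h
  have := il_ne hΩ hf he hp
  rw [(hs.rotation_eq hΩ hf he hp).1, h] at this
  simp at this

theorem AffineSym.rotation_pd_il (hs : AffineSym f Ω 0 0 1 t r) (he : e.IsInvariant f Ω) {p : Pt}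
    (hp : p ∈ Ω) : pd 0 (il f) p = -1 / 2 ∧ pd 2 (il f) p = 0 := by
  have H := ((HasPD.zeta p).const_mul (-1 / 2)).congr hΩ (ψ := il f)
    (fun q hq => by rw [(hs.rotation_eq hΩ hf he hq).1]; ring) hp
  rw [H.eq, H.eq]
  simp

theorem AffineSym.rotation_A (hs : AffineSym f Ω 0 0 1 t r) (he : e.IsInvariant f Ω) {p : Pt}
    (hp : p ∈ Ω) : e.A f p = 1 := by
  rw [he.A_eq hΩ hf hp, (hs.rotation_pd_il hΩ hf he hp).1]
  simp only [map_div₀, map_neg, map_one, Complex.conj_ofNat]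
  norm_num

theorem AffineSym.rotation_pd_zz (hs : AffineSym f Ω 0 0 1 t r) (he : e.IsInvariant f Ω) {p : Pt}
    (hp : p ∈ Ω) :
    pd 0 (pd 0 (zz f)) p = 0 ∧ pd 2 (zz f) p = p.1 * pd 2 (pd 0 (zz f)) p := by
  have hz := hol_zz hΩ hf he
  have H := ((HasPD.zeta p).mul ((hz.pd hΩ 0).hasPD hΩ hp)).congr hΩ (ψ := zz f)
    (fun q hq => (hs.rotation_eq hΩ hf he hq).2.1) hp
  have h0 := H.eq 0
  have h2 := H.eq 2
  simp only [Matrix.cons_val] at h0 h2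
  constructor
  · refine (mul_eq_zero.1 (?_ : p.1 * _ = 0)).resolve_left (hs.rotation_zeta_ne hΩ hf he hp)
    linear_combination -h0
  · linear_combination h2

/-- If z_ζ were real, then dα/α would equal dα*/α*, so α would have constant phase and dα ∧ dα*
would vanish. -/
theorem AffineSym.rotation_pd_zz_ne_conj (hs : AffineSym f Ω 0 0 1 t r) (he : e.IsInvariant f Ω)
    (h02 : e.IsType02 f Ω) {p : Pt} (hp : p ∈ Ω) : conj (pd 0 (zz f) p) ≠ pd 0 (zz f) p := by
  intro hc
  obtain ⟨a, b, hab⟩ := wedge_two_ne_iff.1 (h02 p hp)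
  have hal := he.hasPD_al hΩ hf hp
  have hcj : ∀ i, pd i (cj (e.al f)) p = _ := hal.cj.eq
  have h0 := hs.rotation_zeta_ne hΩ hf he hp
  have h0' : conj p.1 ≠ 0 := by simpa using h0
  obtain ⟨h1, h2, -⟩ := hs.rotation_eq hΩ hf he hp
  obtain ⟨h3, h4⟩ := hs.rotation_pd_il hΩ hf he hp
  have key : ∀ i, conj (e.al f p) * pd i (e.al f) p = e.al f p * pd i (cj (e.al f)) p := by
    intro i
    rw [hal.eq, hcj, h1, h2, h3, h4]
    have c2 : conj (2 : ℂ) = 2 := Complex.conj_ofNat 2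
    have c4 : conj (4 : ℂ) = 4 := Complex.conj_ofNat 4
    fin_cases i <;> simp [cjD, hc, c2, c4] <;> field_simp <;> ring
  have hne := he.al_ne p hp
  have hne' : conj (e.al f p) ≠ 0 := by simpa using hne
  refine hab ((mul_eq_zero.1 (?_ : conj (e.al f p) * _ = 0)).resolve_left hne')
  linear_combination pd b (cj (e.al f)) p * key a - pd a (cj (e.al f)) p * key b

/-- Here A = 1, L = -ζ/2 and z = ζ z_ζ. The term (Δμ + μ²)/α* cancels the z-part of 2ν, and -1/α
cancels the f'' term in conj(f'). What is left is Y = i w̄ a² r̄. -/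
theorem AffineSym.Y_iff (hs : AffineSym f Ω 0 0 1 t r) (he : e.IsInvariant f Ω) :
    (∀ p ∈ Ω, e.Y f p = 0) ↔ ∀ p ∈ Ω, r p.2.1 = 0 := by
  refine forall₂_congr fun p hp => ?_
  have c := he.comps hp
  have hz := hol_zz hΩ hf he
  have hm0 := left_ne_zero_of_mul_eq_one c.m0
  have hcm : conj (e.m p 0) = 1 / e.m p 0 := by
    rw [eq_div_iff hm0]; linear_combination c.m0
  obtain ⟨h1, h2, h3⟩ := hs.rotation_eq hΩ hf he hp
  obtain ⟨h4, h5⟩ := hs.rotation_pd_zz hΩ hf he hp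
  have hb := he.hasPD_boost hΩ hf hp
  have hdb := he.dn_boost hΩ hf hp
  have hn := he.normalization hΩ hf hp
  have H := ((HasPD.of_diff hb.diff).mul ((hz.pd hΩ 0).hasPD hΩ hp)).congr hΩ
    (ψ := e.mu f) (fun q hq => he.mu_eq hΩ hf hq) hp
  have hmu : act e.n (e.mu f) p = e.n p 2 ^ 2 * pd 2 (pd 0 (zz f)) p := by
    rw [he.act_n hΩ hf hp H (by simp [hb.eq])]
    simp only [dn, Matrix.cons_val, h4] at hdb ⊢
    linear_combination (e.n p 2 * pd 0 (zz f) p) * hdb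
  have hY : e.Y f p = Complex.I * conj (e.m p 0) * e.n p 2 ^ 2 * conj (r p.2.1) := by
    have h0' : conj p.1 ≠ 0 := by simpa using hs.rotation_zeta_ne hΩ hf he hp
    rw [Tetrad.Y, hs.rotation_A hΩ hf he hp, he.nu_eq hΩ hf hp, hmu, he.mu_eq hΩ hf hp,
      he.al_eq hΩ hf hp, h5, h2, h1, h3]
    simp only [map_mul, map_neg, map_sub, map_div₀, Complex.conj_conj, Complex.conj_ofNat,
      Complex.conj_I]
    rw [hcm] at hn ⊢
    field_simp at hn ⊢
    linear_combination (-2 * conj p.1) * hn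
  have hm := right_ne_zero_of_mul_eq_one c.m0
  rw [hY]
  simp only [mul_eq_zero, hm, pow_eq_zero_iff, Complex.I_ne_zero,
    c.n2_ne, ne_eq, OfNat.ofNat_ne_zero, not_false_eq_true, false_or, map_eq_zero]

end Rotation

end Relations


/-! ## Killing vector fields -/

section Killing

variable {f : ℂ → ℝ → ℂ} {Ω : Set Pt} (hΩ : IsOpen Ω) (hf : Hol Ω (pot f))

include hΩ hf

/-- The Killing equations of the pp-wave in components. -/
theorem lie_eq {ξ : VField} {p : Pt} (hp : p ∈ Ω) (i j : Fin 4) :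
    ∑ k, (ξ p k * pd k (fun q => metric f q i j) p + metric f p k j * pd i (fun q => ξ q k) p
      + metric f p i k * pd j (fun q => ξ q k) p)
    = (if i = 2 ∧ j = 2 then -(ξ p 0 * f1 f p + ξ p 1 * conj (f1 f p)
        + ξ p 2 * (pd 2 (pot f) p + conj (pd 2 (pot f) p))) else 0)
      + (![pd i (fun q => ξ q 1) p, pd i (fun q => ξ q 0) p,
          -(pot f p + conj (pot f p)) * pd i (fun q => ξ q 2) p - pd i (fun q => ξ q 3) p,
          -pd i (fun q => ξ q 2) p] : Fin 4 → ℂ) j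
      + (![pd j (fun q => ξ q 1) p, pd j (fun q => ξ q 0) p,
          -(pot f p + conj (pot f p)) * pd j (fun q => ξ q 2) p - pd j (fun q => ξ q 3) p,
          -pd j (fun q => ξ q 2) p] : Fin 4 → ℂ) i := by
  simp only [pd_metric hΩ hf hp, Fin.sum_univ_four]
  fin_cases i <;> fin_cases j <;> simp [metric, pot] <;> ring

/-- The integrated form of the Killing equations. -/
structure KillingForm (f : ℂ → ℝ → ℂ) (Ω : Set Pt) (ξ : VField) (a d b : ℝ) : Prop where
  u_eq : ∀ p ∈ Ω, ξ p 2 = pu a d p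
  hol : Hol Ω (fun q => ξ q 0)
  rot : ∀ p ∈ Ω, pd 0 (fun q => ξ q 0) p = Complex.I * b
  s_zeta : ∀ p ∈ Ω, pd 0 (fun q => ξ q 3) p = conj (pd 2 (fun q => ξ q 0) p)
  s_bar : ∀ p ∈ Ω, pd 1 (fun q => ξ q 3) p = pd 2 (fun q => ξ q 0) p
  s_v : ∀ p ∈ Ω, pd 3 (fun q => ξ q 3) p = -a
  s_u : ∀ p ∈ Ω, ξ p 0 * f1 f p + conj (ξ p 0 * f1 f p)
    + pu a d p * (pd 2 (pot f) p + conj (pd 2 (pot f) p))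
    + 2 * a * (pot f p + conj (pot f p)) + 2 * pd 2 (fun q => ξ q 3) p = 0

theorem IsKilling.exists_form (hc : IsPreconnected Ω) (hne : Ω.Nonempty)
    (h2 : ∀ p ∈ Ω, f2 f p ≠ 0) {ξ : VField} (hξ : IsKilling f Ω ξ) :
    ∃ a d b : ℝ, KillingForm f Ω ξ a d b := by
  obtain ⟨p0, hp0⟩ := hne
  have sm : ∀ k, Smooth Ω (fun q => ξ q k) := fun k => contDiffOn_pi.1 hξ.smooth k
  set P : Scalar := fun q => ξ q 2 with hP
  set Q : Scalar := fun q => ξ q 0 with hQ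
  set Q' : Scalar := fun q => ξ q 1 with hQ'
  set S : Scalar := fun q => ξ q 3 with hS
  have sP : Smooth Ω P := sm 2
  have sQ : Smooth Ω Q := sm 0
  have sQ' : Smooth Ω Q' := sm 1
  have sS : Smooth Ω S := sm 3
  have r1 : ∀ p ∈ Ω, Q' p = conj (Q p) := fun p hp => (congrFun (hξ.real p hp) 1).symm
  have r2 : ∀ p ∈ Ω, P p = conj (P p) := fun p hp => (congrFun (hξ.real p hp) 2).symm
  have L : ∀ p ∈ Ω, ∀ i j, _ = (0 : ℂ) := fun p hp i j =>
    (lie_eq hΩ hf (ξ := ξ) hp i j).symm.trans (hξ.lie p hp i j)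
  simp only [← hP, ← hQ, ← hQ', ← hS] at L
  have e33 : ∀ p ∈ Ω, pd 3 P p = 0 := fun p hp => by
    simpa using L p hp 3 3
  have e00 : ∀ p ∈ Ω, pd 0 Q' p = 0 := fun p hp => by
    simpa using L p hp 0 0
  have e11 : ∀ p ∈ Ω, pd 1 Q p = 0 := fun p hp => by
    simpa using L p hp 1 1
  have e01 : ∀ p ∈ Ω, pd 0 Q p + pd 1 Q' p = 0 := fun p hp => by
    have := L p hp 0 1
    simp at this
    linear_combination this
  have e03 : ∀ p ∈ Ω, pd 0 P p = pd 3 Q' p := fun p hp => by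
    have := L p hp 0 3
    simp at this
    linear_combination -this
  have e13 : ∀ p ∈ Ω, pd 1 P p = pd 3 Q p := fun p hp => by
    have := L p hp 1 3
    simp at this
    linear_combination -this
  have e23 : ∀ p ∈ Ω, pd 3 S p = -pd 2 P p := fun p hp => by
    have := L p hp 2 3
    simp [e33 p hp] at this
    linear_combination -this
  have e02 : ∀ p ∈ Ω, pd 0 S p = pd 2 Q' p - (pot f p + conj (pot f p)) * pd 0 P p :=
    fun p hp => by
      have := L p hp 0 2
      simp at this
      linear_combination -this
  have e12 : ∀ p ∈ Ω, pd 1 S p = pd 2 Q p - (pot f p + conj (pot f p)) * pd 1 P p :=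
    fun p hp => by
      have := L p hp 1 2
      simp at this
      linear_combination -this
  have e22 : ∀ p ∈ Ω, Q p * f1 f p + Q' p * conj (f1 f p)
      + P p * (pd 2 (pot f) p + conj (pd 2 (pot f) p))
      + 2 * ((pot f p + conj (pot f p)) * pd 2 P p) + 2 * pd 2 S p = 0 := fun p hp => by
    have := L p hp 2 2
    simp only [and_self, if_true, Matrix.cons_val] at this
    linear_combination -this
  clear L
  have cm := fun (φ : Scalar) (h : Smooth Ω φ) i j p (hp : p ∈ Ω) => pd_comm hΩ h i j hp
  -- second derivatives of the `u`-component
  have p00 : ∀ p ∈ Ω, pd 0 (pd 0 P) p = 0 := fun p hp => by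
    rw [pd_congr hΩ e03 hp, cm _ sQ' 0 3 p hp, pd_of_eq_zero hΩ e00 hp]
  -- The derivative P_ζζ̄ equals both Q_ζv and Q'_ζ̄v, and their sum is the v-derivative of the (ζ,
  -- ζ̄) equation.
  have p01 : ∀ p ∈ Ω, pd 0 (pd 1 P) p = 0 := fun p hp => by
    have h1 : pd 0 (pd 1 P) p = pd 3 (pd 0 Q) p := by
      rw [pd_congr hΩ e13 hp, cm _ sQ 0 3 p hp]
    have h2 : pd 0 (pd 1 P) p = pd 3 (pd 1 Q') p := by
      rw [cm _ sP 0 1 p hp, pd_congr hΩ e03 hp, cm _ sQ' 1 3 p hp]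
    have h3 := pd_of_eq_zero hΩ e01 hp 3
    rw [(((sQ.pd hΩ 0).hasPD hΩ hp).add ((sQ'.pd hΩ 1).hasPD hΩ hp)).eq] at h3
    linear_combination (1 / 2) * h1 + (1 / 2) * h2 + (1 / 2) * h3
  -- The v-derivative of the (ζ, u) equation: S_ζv = -P_ζu and Q'_uv = P_ζu have opposite signs.
  have p20 : ∀ p ∈ Ω, pd 2 (pd 0 P) p = 0 := fun p hp => by
    have hH := (hf.hasPD hΩ hp).add (hf.hasPD hΩ hp).cj
    have h1 := (((sQ'.pd hΩ 2).hasPD hΩ hp).sub (hH.mul ((sP.pd hΩ 0).hasPD hΩ hp))).congr hΩ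
      (ψ := pd 0 S) e02 hp |>.eq 3
    have h2 : pd 3 (pd 0 S) p = -pd 2 (pd 0 P) p := by
      rw [cm _ sS 3 0 p hp, pd_congr hΩ e23 hp, ((sP.pd hΩ 2).hasPD hΩ hp).neg.eq,
        cm _ sP 0 2 p hp]
    have h3 : pd 3 (pd 2 Q') p = pd 2 (pd 0 P) p := by
      rw [cm _ sQ' 3 2 p hp, pd_congr hΩ (fun q hq => (e03 q hq).symm) hp]
    have h4 : pd 3 (pd 0 P) p = 0 := by rw [cm _ sP 3 0 p hp, pd_of_eq_zero hΩ e33 hp]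
    rw [h2] at h1
    simp only [cjD, Matrix.cons_val, map_zero, h3, h4] at h1
    linear_combination (-1 / 2) * h1
  -- The v-derivative of the (u, u) equation, with S_v = -P_u.
  have puu : ∀ p ∈ Ω, pd 1 P p * f1 f p + pd 0 P p * conj (f1 f p) + -2 * pd 2 (pd 2 P) p = 0 := by
    intro p hp
    have h1 := (hol_f1 hΩ hf).hasPD hΩ hp
    have h2 := (hf.pd hΩ 2).hasPD hΩ hp
    have hH := (hf.hasPD hΩ hp).add (hf.hasPD hΩ hp).cj
    have h := (((((sQ.hasPD hΩ hp).mul h1).add ((sQ'.hasPD hΩ hp).mul h1.cj)).add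
      ((sP.hasPD hΩ hp).mul (h2.add h2.cj))).add
      ((hH.mul ((sP.pd hΩ 2).hasPD hΩ hp)).const_mul 2)).add
      (((sS.pd hΩ 2).hasPD hΩ hp).const_mul 2) |>.congr hΩ (ψ := fun _ => 0)
        (fun q hq => (e22 q hq).symm) hp |>.eq 3
    rw [pd_zero_fun, cm _ sS 3 2 p hp, cm _ sP 3 2 p hp, pd_congr hΩ e23 hp,
      ((sP.pd hΩ 2).hasPD hΩ hp).neg.eq, pd_of_eq_zero hΩ e33 hp] at h
    simp only [cjD, Matrix.cons_val, map_zero, ← e03 p hp, ← e13 p hp, e33 p hp] at h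
    linear_combination -h
  -- One more ζ-derivative leaves P_ζ̄ f'' = 0. The condition f'' ≠ 0 excludes Killing fields whose
  -- u-component depends on ζ.
  have p1 : ∀ p ∈ Ω, pd 1 P p = 0 := fun p hp => by
    have h1 := (hol_f1 hΩ hf).hasPD hΩ hp
    have h := ((((sP.pd hΩ 1).hasPD hΩ hp).mul h1).add (((sP.pd hΩ 0).hasPD hΩ hp).mul h1.cj)).add
      ((((sP.pd hΩ 2).pd hΩ 2).hasPD hΩ hp).const_mul (-2)) |>.congr hΩ (ψ := fun _ => 0)
        (fun q hq => (puu q hq).symm) hp |>.eq 0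
    have h3 : pd 0 (pd 2 (pd 2 P)) p = 0 := by
      rw [cm _ (sP.pd hΩ 2) 0 2 p hp]
      refine pd_of_eq_zero hΩ (fun q hq => ?_) hp 2
      rw [cm _ sP 0 2 q hq, p20 q hq]
    rw [pd_zero_fun, p01 p hp, p00 p hp, h3] at h
    simp only [cjD, Matrix.cons_val, map_zero] at h
    refine (mul_eq_zero.1 (?_ : pd 1 P p * f2 f p = 0)).resolve_right (h2 p hp)
    simp only [f2]
    linear_combination -h
  have p0' : ∀ p ∈ Ω, pd 0 P p = 0 := fun p hp => by
    rw [pd_congr hΩ r2 hp, (sP.hasPD hΩ hp).cj.eq]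
    simp [cjD, p1 p hp]
  have p22 : ∀ p ∈ Ω, pd 2 (pd 2 P) p = 0 := fun p hp => by
    have := puu p hp
    rw [p1 p hp, p0' p hp] at this
    linear_combination (-1 / 2) * this
  have constP2 : ∀ p ∈ Ω, pd 2 P p = pd 2 P p0 := fun p hp => by
    refine const_of_pd_eq_zero hΩ hc (fun q hq => (sP.pd hΩ 2).diffAt hΩ hq) (fun q hq i => ?_)
      hp hp0
    fin_cases i
    · exact (cm _ sP 0 2 q hq).trans (p20 q hq)
    · exact (cm _ sP 1 2 q hq).trans (pd_of_eq_zero hΩ p1 hq 2)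
    · exact p22 q hq
    · exact (cm _ sP 3 2 q hq).trans (pd_of_eq_zero hΩ e33 hq 2)
  obtain ⟨a, ha⟩ : ∃ a : ℝ, pd 2 P p0 = a := by
    refine Complex.conj_eq_iff_real.1 ?_
    conv_rhs => rw [pd_congr hΩ r2 hp0, (sP.hasPD hΩ hp0).cj.eq]
    simp [cjD]
  have constP : ∀ p ∈ Ω, P p - a * p.2.1 = P p0 - a * p0.2.1 := fun p hp => by
    have hd := fun q (hq : q ∈ Ω) => (sP.hasPD hΩ hq).sub ((HasPD.u q).const_mul (a : ℂ))
    refine const_of_pd_eq_zero hΩ hc (φ := fun q => P q - a * q.2.1)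
      (fun q hq => (hd q hq).diff) (fun q hq i => ?_) hp hp0
    rw [(hd q hq).eq]
    fin_cases i
    · simp [p0' q hq]
    · simp [p1 q hq]
    · simp [constP2 q hq, ha]
    · simp [e33 q hq]
  obtain ⟨d, hd⟩ : ∃ d : ℝ, P p0 - a * p0.2.1 = d := by
    refine Complex.conj_eq_iff_real.1 ?_
    rw [map_sub, ← r2 p0 hp0]
    simp
  -- the `ζ`-component
  have hQhol : Hol Ω Q := ⟨sQ, e11, fun p hp => by rw [← e13 p hp, p1 p hp]⟩
  have q1 : ∀ p ∈ Ω, ∀ i, pd i Q' p = cjD (fun i => pd i Q p) i := fun p hp i => by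
    rw [pd_congr hΩ r1 hp, (sQ.hasPD hΩ hp).cj.eq]
  have qre : ∀ p ∈ Ω, pd 0 Q p + conj (pd 0 Q p) = 0 := fun p hp => by
    have := e01 p hp
    rw [q1 p hp] at this
    simpa [cjD] using this
  have hQ0 := hQhol.pd hΩ 0
  have qd : ∀ p ∈ Ω, ∀ i, pd i (pd 0 Q) p + cjD ![pd 0 (pd 0 Q) p, 0, pd 2 (pd 0 Q) p, 0] i = 0 :=
    fun p hp i => by
      have h := ((hQ0.smooth.hasPD hΩ hp).add (hQ0.hasPD hΩ hp).cj).congr hΩ (ψ := fun _ => 0)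
        (fun q hq => (qre q hq).symm) hp |>.eq i
      rw [pd_zero_fun] at h
      exact h.symm
  have s0 : ∀ p ∈ Ω, pd 0 S p = conj (pd 2 Q p) := fun p hp => by
    rw [e02 p hp, p0' p hp, q1 p hp]
    simp [cjD]
  have s1 : ∀ p ∈ Ω, pd 1 S p = pd 2 Q p := fun p hp => by
    rw [e12 p hp, p1 p hp]
    simp
  -- Symmetry of S_ζζ̄ makes Q_ζu real, while the (ζ, ζ̄) equation makes Q_ζ imaginary.
  have q20 : ∀ p ∈ Ω, pd 2 (pd 0 Q) p = 0 := fun p hp => by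
    have h1 : pd 0 (pd 1 S) p = pd 2 (pd 0 Q) p := by
      rw [pd_congr hΩ s1 hp, cm _ sQ 0 2 p hp]
    have h2 : pd 0 (pd 1 S) p = conj (pd 2 (pd 0 Q) p) := by
      rw [cm _ sS 0 1 p hp, pd_congr hΩ s0 hp, ((sQ.pd hΩ 2).hasPD hΩ hp).cj.eq]
      simp [cjD, cm _ sQ 0 2 p hp]
    have h3 := qd p hp 2
    simp only [cjD, Matrix.cons_val] at h3
    linear_combination (1 / 2) * h3 - (1 / 2) * h1 + (1 / 2) * h2
  have constQ : ∀ p ∈ Ω, pd 0 Q p = pd 0 Q p0 := fun p hp => by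
    refine const_of_pd_eq_zero hΩ hc (fun q hq => hQ0.smooth.diffAt hΩ hq) (fun q hq i => ?_)
      hp hp0
    fin_cases i
    · simpa [cjD] using qd q hq 0
    · exact hQ0.bar q hq
    · exact q20 q hq
    · exact hQ0.vert q hq
  obtain ⟨b, hb⟩ : ∃ b : ℝ, pd 0 Q p0 = Complex.I * b := by
    obtain ⟨b, hb⟩ : ∃ b : ℝ, -Complex.I * pd 0 Q p0 = b := by
      refine Complex.conj_eq_iff_real.1 ?_
      simp only [map_mul, map_neg, Complex.conj_I]
      linear_combination Complex.I * qre p0 hp0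
    refine ⟨b, ?_⟩
    rw [← hb]
    linear_combination (pd 0 Q p0) * Complex.I_mul_I
  have hPu : ∀ p ∈ Ω, P p = pu a d p := fun p hp => by
    have := constP p hp
    rw [hd] at this
    rw [pu]
    linear_combination this
  refine ⟨a, d, b, hPu, hQhol, fun p hp => (constQ p hp).trans hb, s0, s1, fun p hp => ?_,
    fun p hp => ?_⟩
  · rw [e23 p hp, constP2 p hp, ha]
  · have := e22 p hp
    rw [r1 p hp, hPu p hp, constP2 p hp, ha] at this
    rw [map_mul]
    linear_combination this

/-- The ζ-derivative of `s_u`. The unknown v-component now enters only through conj(Q_uu), where Q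
is the ζ-component. This term is antiholomorphic, so it drops out of `KillingForm.f2_eq`. -/
theorem KillingForm.f1_eq {ξ : VField} {a d b : ℝ} (hξ : IsKilling f Ω ξ)
    (h : KillingForm f Ω ξ a d b) {p : Pt} (hp : p ∈ Ω) :
    ξ p 0 * f2 f p + pu a d p * pd 2 (f1 f) p + (Complex.I * b + 2 * a) * f1 f p
      + 2 * conj (pd 2 (pd 2 (fun q => ξ q 0)) p) = 0 := by
  have sS : Smooth Ω (fun q => ξ q 3) := contDiffOn_pi.1 hξ.smooth 3
  have h0 := hf.hasPD hΩ hp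
  have h1 := (hol_f1 hΩ hf).hasPD hΩ hp
  have h2 := (hf.pd hΩ 2).hasPD hΩ hp
  have hQ := h.hol.hasPD hΩ hp
  have hm := hQ.mul h1
  have E := ((((hm.add hm.cj).add ((HasPD.pu a d p).mul (h2.add h2.cj))).add
    ((h0.add h0.cj).const_mul (2 * a))).add
    (((sS.pd hΩ 2).hasPD hΩ hp).const_mul 2)).congr hΩ (ψ := fun _ => 0)
      (fun q hq => (h.s_u q hq).symm) hp |>.eq 0
  have e3 : pd 0 (pd 2 (fun q => ξ q 3)) p = conj (pd 2 (pd 2 (fun q => ξ q 0)) p) := by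
    rw [pd_comm hΩ sS 0 2 hp, pd_congr hΩ h.s_zeta hp, ((h.hol.pd hΩ 2).hasPD hΩ hp).cj.eq]
    simp [cjD]
  rw [pd_zero_fun, e3] at E
  simp only [cjD, Matrix.cons_val, map_zero, h.rot p hp, mul_zero, zero_mul, add_zero,
    pd_comm hΩ hf.smooth 0 2 hp] at E
  simp only [f2, f1] at E ⊢
  linear_combination -E

theorem KillingForm.f2_eq {ξ : VField} {a d b : ℝ} (hξ : IsKilling f Ω ξ)
    (h : KillingForm f Ω ξ a d b) {p : Pt} (hp : p ∈ Ω) :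
    ξ p 0 * f3 f p + pu a d p * pd 2 (f2 f) p + 2 * (a + Complex.I * b) * f2 f p = 0 := by
  have h1 := (hol_f1 hΩ hf).hasPD hΩ hp
  have h2 := (hol_f2 hΩ hf).hasPD hΩ hp
  have h3 := ((hol_f1 hΩ hf).pd hΩ 2).hasPD hΩ hp
  have hQ := h.hol.hasPD hΩ hp
  have hQ2 := ((h.hol.pd hΩ 2).pd hΩ 2).hasPD hΩ hp
  have E := ((((hQ.mul h2).add ((HasPD.pu a d p).mul h3)).add
    (h1.const_mul (Complex.I * b + 2 * a))).add (hQ2.cj.const_mul 2)).congr hΩ (ψ := fun _ => 0)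
      (fun q hq => (h.f1_eq hΩ hf hξ hq).symm) hp |>.eq 0
  rw [pd_zero_fun] at E
  simp only [cjD, Matrix.cons_val, map_zero, h.rot p hp,
    pd_comm hΩ (hol_f1 hΩ hf).smooth 0 2 hp] at E
  simp only [f3, f2] at E ⊢
  linear_combination -E

end Killing


/-! ## Dimension of the Killing algebra -/

theorem isPreconnected_dom {U : Set (ℂ × ℝ)} (hU : IsConnected U) : IsPreconnected (dom U) := by
  have h := (hU.isPreconnected.prod (isPreconnected_univ (α := ℝ))).image
    (fun x : (ℂ × ℝ) × ℝ => ((x.1.1, x.1.2, x.2) : Pt)) (by fun_prop)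
  refine (congrArg IsPreconnected ?_).mp h
  ext ⟨z, u, v⟩
  simp [dom]

theorem dom_nonempty {U : Set (ℂ × ℝ)} (hU : IsConnected U) : (dom U).Nonempty := by
  obtain ⟨⟨z, u⟩, h⟩ := hU.nonempty
  exact ⟨(z, u, 0), h⟩

open Classical in
/-- The field `(e₀ u + d₀) ∂_u + i ω₀ (ζ ∂_ζ - ζ̄ ∂_ζ̄) + (s - e₀ v) ∂_v`, extended by zero. -/
def symField (Ω : Set Pt) (e₀ d₀ ω₀ : ℝ) (s : ℝ → ℝ) : VField := fun p =>
  if p ∈ Ω then ![Complex.I * ω₀ * p.1, -(Complex.I * ω₀ * conj p.1), pu e₀ d₀ p,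
    (s p.2.1 : ℂ) - e₀ * p.2.2] else 0

theorem symField_apply {Ω : Set Pt} {e₀ d₀ ω₀ : ℝ} {s : ℝ → ℝ} {p : Pt} (hp : p ∈ Ω) :
    symField Ω e₀ d₀ ω₀ s p = ![Complex.I * ω₀ * p.1, -(Complex.I * ω₀ * conj p.1), pu e₀ d₀ p,
      (s p.2.1 : ℂ) - e₀ * p.2.2] := by simp [symField, hp]

theorem symField_off {Ω : Set Pt} {e₀ d₀ ω₀ : ℝ} {s : ℝ → ℝ} {p : Pt} (hp : p ∉ Ω) :
    symField Ω e₀ d₀ ω₀ s p = 0 := by simp [symField, hp]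

section

variable {f : ℂ → ℝ → ℂ} {U : Set (ℂ × ℝ)} (hU : IsOpen U)
  (hf : Hol (dom U) (pot f)) {e₀ d₀ ω₀ : ℝ} {t r : ℝ → ℂ}

include hU hf

/-- A homogeneous potential admits the corresponding Killing vector field. -/
theorem AffineSym.symField_mem (hs : AffineSym f (dom U) e₀ d₀ ω₀ t r)
    (hr : ∀ p ∈ dom U, r p.2.1 = 0) {s : ℝ → ℝ} (hs1 : ContDiffOn ℝ ∞ s (uRange U))
    (hs2 : ∀ p ∈ dom U, HasDerivAt s (-(t p.2.1).re) p.2.1) :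
    symField (dom U) e₀ d₀ ω₀ s ∈ killingAlgebra f (dom U) (isOpen_dom hU) := by
  have hΩ := isOpen_dom hU
  refine ⟨⟨?_, ?_, ?_⟩, fun p hp => symField_off hp⟩
  · have : ContDiffOn ℝ ∞ (fun p : Pt => (![Complex.I * ω₀ * p.1, -(Complex.I * ω₀ * conj p.1),
        pu e₀ d₀ p, (s p.2.1 : ℂ) - e₀ * p.2.2] : Fin 4 → ℂ)) (dom U) := by
      have hz : ContDiff ℝ ∞ (fun p : Pt => p.1) := contDiff_fst
      have hzb : ContDiff ℝ ∞ (fun p : Pt => conj p.1) := Complex.conjCLE.contDiff.comp hz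
      have hu : ContDiff ℝ ∞ (fun p : Pt => p.2.1) := contDiff_fst.comp contDiff_snd
      have hv : ContDiff ℝ ∞ (fun p : Pt => p.2.2) := contDiff_snd.comp contDiff_snd
      have ho : ContDiff ℝ ∞ (fun x : ℝ => (x : ℂ)) := Complex.ofRealCLM.contDiff
      have hsu : ContDiffOn ℝ ∞ (fun p : Pt => s p.2.1) (dom U) :=
        hs1.comp hu.contDiffOn fun p hp => ⟨(p.1, p.2.1), hp, rfl⟩
      refine contDiffOn_pi.2 fun i => ?_
      fin_cases i
      · exact (contDiff_const.mul hz).contDiffOn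
      · exact (contDiff_const.mul hzb).neg.contDiffOn
      · exact ((contDiff_const.mul (ho.comp hu)).add contDiff_const).contDiffOn
      · exact (ho.comp_contDiffOn hsu).sub (contDiff_const.mul (ho.comp hv)).contDiffOn
    exact this.congr fun p hp => symField_apply hp
  · intro p hp
    funext i
    simp only [cjV, symField_apply hp]
    fin_cases i <;> simp [conj_pu]
  · intro p hp i j
    have h0 := (((HasPD.zeta p).const_mul (Complex.I * ω₀))).congr hΩ
      (ψ := fun q => symField (dom U) e₀ d₀ ω₀ s q 0) (fun q hq => by
        simp [symField_apply hq]) hp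
    have h1 := (((HasPD.zeta p).cj.const_mul (Complex.I * ω₀)).neg).congr hΩ
      (ψ := fun q => symField (dom U) e₀ d₀ ω₀ s q 1) (fun q hq => by
        simp [symField_apply hq]) hp
    have h2 := (HasPD.pu e₀ d₀ p).congr hΩ
      (ψ := fun q => symField (dom U) e₀ d₀ ω₀ s q 2) (fun q hq => by
        simp [symField_apply hq]) hp
    have h3 := ((HasPD.ofU (hs2 p hp).ofReal_comp).sub ((HasPD.v p).const_mul (e₀ : ℂ))).congr hΩ
      (ψ := fun q => symField (dom U) e₀ d₀ ω₀ s q 3) (fun q hq => by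
        simp [symField_apply hq]) hp
    rw [lie_eq hΩ hf hp]
    simp only [h0.eq, h1.eq, h2.eq, h3.eq, symField_apply hp]
    have ht := hs.eq p hp
    have ht' := congrArg conj ht
    rw [hr p hp] at ht ht'
    simp only [map_add, map_mul, Complex.conj_I, Complex.conj_ofReal, Complex.conj_ofNat,
      conj_pu, map_zero] at ht'
    have hre : ((t p.2.1).re : ℂ) = (t p.2.1 + conj (t p.2.1)) / 2 := by
      rw [Complex.add_conj]; push_cast; ring
    fin_cases i <;> fin_cases j <;> simp [cjD]
    rw [hre]
    linear_combination -ht - ht'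

/-- The Killing algebra is two-dimensional exactly if the potential is homogeneous, provided
every Killing vector field is a multiple of the homothetic field up to `∂_v`. -/
theorem AffineSym.isG2_iff (hs : AffineSym f (dom U) e₀ d₀ ω₀ t r) (hc : IsConnected U)
    (h2 : ∀ p ∈ dom U, f2 f p ≠ 0)
    (hrig : ∀ ξ, IsKilling f (dom U) ξ → ∃ c : ℝ, ∀ p ∈ dom U,
      ξ p 2 = c * pu e₀ d₀ p ∧ ξ p 0 = c * (Complex.I * ω₀ * p.1))
    (hV : ∀ p ∈ dom U, pu e₀ d₀ p ≠ 0 ∨ (ω₀ : ℂ) * p.1 ≠ 0)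
    (hprim : (∀ p ∈ dom U, r p.2.1 = 0) → ∃ s : ℝ → ℝ, ContDiffOn ℝ ∞ s (uRange U) ∧
      ∀ p ∈ dom U, HasDerivAt s (-(t p.2.1).re) p.2.1) :
    IsG2 f U hU ↔ ∀ p ∈ dom U, r p.2.1 = 0 := by
  have hΩ := isOpen_dom hU
  have hpc := isPreconnected_dom hc
  obtain ⟨p0, hp0⟩ := dom_nonempty hc
  set K := killingAlgebra f (dom U) hΩ with hK
  set W : VField := symField (dom U) 0 0 0 (fun _ => 1) with hW
  have hWp : ∀ p ∈ dom U, W p = ![0, 0, 0, 1] := fun p hp => by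
    rw [hW, symField_apply hp]
    simp [pu]
  have hWK : W ∈ K := by
    have hs0 : AffineSym f (dom U) 0 0 0 (fun _ => 0) (fun _ => 0) :=
      ⟨fun p hp => by simp [pu], fun p hp => differentiableAt_const _,
        fun p hp => differentiableAt_const _⟩
    exact hs0.symField_mem hU hf (fun _ _ => rfl) contDiffOn_const
      (fun p _ => by simpa using hasDerivAt_const p.2.1 (1 : ℝ))
  -- fields with vanishing `ζ`- and `u`-components are multiples of `∂_v`
  have key0 : ∀ ξ ∈ K, (∀ p ∈ dom U, ξ p 2 = 0 ∧ ξ p 0 = 0) → ∃ c : ℝ, ξ = c • W := by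
    rintro ξ ⟨hξ, hoff⟩ h0
    obtain ⟨a, d, b, hF⟩ := hξ.exists_form hΩ hf hpc ⟨p0, hp0⟩ h2
    have hu : ∀ p ∈ dom U, pu a d p = 0 := fun p hp => (hF.u_eq p hp).symm.trans (h0 p hp).1
    have ha : (a : ℂ) = 0 := by
      have := pd_of_eq_zero hΩ hu hp0 2
      rwa [(HasPD.pu a d p0).eq] at this
    have hQ : ∀ p ∈ dom U, ∀ i, pd i (fun q => ξ q 0) p = 0 := fun p hp i =>
      pd_of_eq_zero hΩ (fun q hq => (h0 q hq).2) hp i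
    have sS : Smooth (dom U) (fun q => ξ q 3) := contDiffOn_pi.1 hξ.smooth 3
    have hS : ∀ p ∈ dom U, ξ p 3 = ξ p0 3 := fun p hp => by
      refine const_of_pd_eq_zero hΩ hpc (φ := fun q => ξ q 3) (fun q hq => sS.diffAt hΩ hq)
        (fun q hq i => ?_) hp hp0
      fin_cases i
      · exact (hF.s_zeta q hq).trans (by rw [hQ q hq, map_zero])
      · exact (hF.s_bar q hq).trans (hQ q hq 2)
      · have := hF.s_u q hq
        rw [(h0 q hq).2, hu q hq, ha] at this
        simpa using this
      · exact (hF.s_v q hq).trans (by rw [ha, neg_zero])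
    obtain ⟨c, hcS⟩ : ∃ c : ℝ, ξ p0 3 = c :=
      Complex.conj_eq_iff_real.1 (congrFun (hξ.real p0 hp0) 3)
    refine ⟨c, funext fun p => ?_⟩
    by_cases hp : p ∈ dom U
    · have r1 : conj (ξ p 0) = ξ p 1 := congrFun (hξ.real p hp) 1
      rw [(h0 p hp).2, map_zero] at r1
      funext i
      rw [Pi.smul_apply, Pi.smul_apply, hWp p hp]
      fin_cases i
      · simp [(h0 p hp).2]
      · simp [← r1]
      · simp [(h0 p hp).1]
      · simp [hS p hp, hcS]
    · rw [hoff p hp, Pi.smul_apply, hW, symField_off hp, smul_zero]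
  -- a multiple of the homothetic field forces homogeneity
  have keyr : ∀ ξ, IsKilling f (dom U) ξ → ∀ c : ℝ, (∀ p ∈ dom U,
      ξ p 2 = c * pu e₀ d₀ p ∧ ξ p 0 = c * (Complex.I * ω₀ * p.1)) →
      ∀ p ∈ dom U, (c : ℂ) * r p.2.1 = 0 := by
    intro ξ hξ c hcξ p hp
    obtain ⟨a, d, b, hF⟩ := hξ.exists_form hΩ hf hpc ⟨p0, hp0⟩ h2
    have hu : ∀ q ∈ dom U, pu a d q = c * pu e₀ d₀ q := fun q hq =>
      (hF.u_eq q hq).symm.trans (hcξ q hq).1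
    have ha : (a : ℂ) = c * e₀ := by
      have := ((HasPD.pu e₀ d₀ p).const_mul (c : ℂ)).congr hΩ hu hp |>.eq 2
      rwa [(HasPD.pu a d p).eq] at this
    have HQ := fun q (hq : q ∈ dom U) =>
      (((HasPD.zeta q).const_mul (Complex.I * ω₀)).const_mul (c : ℂ)).congr hΩ
        (fun q hq => (hcξ q hq).2) hq
    have hb : Complex.I * b = c * (Complex.I * ω₀) := by
      rw [← hF.rot p hp, (HQ p hp).eq]
      simp
    have hQ2 : pd 2 (pd 2 (fun q => ξ q 0)) p = 0 :=
      pd_of_eq_zero hΩ (fun q hq => by rw [(HQ q hq).eq]; simp) hp 2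
    have h1 := hF.f1_eq hΩ hf hξ hp
    rw [(hcξ p hp).2, hu p hp, hQ2, hb, ha, map_zero] at h1
    rw [← hs.f1_eq hΩ hf hp]
    linear_combination h1
  have hWne : W ≠ 0 := fun h => by
    have := congrFun (congrFun h p0) 3
    rw [hWp p0 hp0] at this
    simp at this
  constructor
  · intro hG
    by_contra hr
    push Not at hr
    obtain ⟨p, hp, hrp⟩ := hr
    have hspan : K = Submodule.span ℝ {W} := by
      refine le_antisymm (fun ξ hξ => ?_) ((Submodule.span_singleton_le_iff_mem _ _).2 hWK)
      obtain ⟨c, hcξ⟩ := hrig ξ hξ.1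
      have hc0 := (mul_eq_zero.1 (keyr ξ hξ.1 c hcξ p hp)).resolve_right hrp
      obtain ⟨c', hc'⟩ := key0 ξ hξ fun q hq => by
        obtain ⟨h1, h2⟩ := hcξ q hq
        rw [h1, h2, hc0]
        simp
      exact Submodule.mem_span_singleton.2 ⟨c', hc'.symm⟩
    have h1 : Module.finrank ℝ K = 1 := by rw [hspan, finrank_span_singleton hWne]
    rw [IsG2, ← hK, h1] at hG
    exact absurd hG (by norm_num)
  · intro hr
    obtain ⟨s, hs1, hs2⟩ := hprim hr
    have hVK := hs.symField_mem hU hf hr hs1 hs2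
    set V : VField := symField (dom U) e₀ d₀ ω₀ s with hVdef
    have hspan : K = Submodule.span ℝ (Set.range ![V, W]) := by
      refine le_antisymm (fun ξ hξ => ?_) (Submodule.span_le.2 ?_)
      · obtain ⟨c, hcξ⟩ := hrig ξ hξ.1
        obtain ⟨c', hc'⟩ := key0 (ξ - c • V) (K.sub_mem hξ (K.smul_mem c hVK)) fun q hq => by
          obtain ⟨h1, h2⟩ := hcξ q hq
          simp [h1, h2, hVdef, symField_apply hq]
        have : ξ = c • V + c' • W := by rw [← hc']; abel
        rw [this]
        exact Submodule.add_mem _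
          (Submodule.smul_mem _ _ (Submodule.subset_span ⟨0, rfl⟩))
          (Submodule.smul_mem _ _ (Submodule.subset_span ⟨1, rfl⟩))
      · rintro _ ⟨i, rfl⟩
        fin_cases i
        · exact hVK
        · exact hWK
    have hli : LinearIndependent ℝ ![V, W] := by
      refine LinearIndependent.pair_iff.2 fun x y hxy => ?_
      have hx0 := congrFun (congrFun hxy p0) 0
      have hx2 := congrFun (congrFun hxy p0) 2
      have hx3 := congrFun (congrFun hxy p0) 3
      simp only [Pi.add_apply, Pi.smul_apply, hWp p0 hp0, hVdef, symField_apply hp0,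
        Matrix.cons_val, smul_zero, add_zero, Pi.zero_apply] at hx0 hx2 hx3
      have hx : x = 0 := by
        rcases hV p0 hp0 with h | h
        · exact (smul_eq_zero.1 hx2).resolve_right h
        · exact (smul_eq_zero.1 hx0).resolve_right
            (by rw [mul_assoc]; exact mul_ne_zero Complex.I_ne_zero h)
      rw [hx] at hx3
      simp at hx3
      exact ⟨hx, hx3⟩
    rw [IsG2, ← hK, hspan, finrank_span_eq_card hli]
    simp

end

/-! ### Killing fields are determined up to ∂_v by the homothetic field. -/

section Rigidity

variable {f : ℂ → ℝ → ℂ} {Ω : Set Pt} (hΩ : IsOpen Ω) (hf : Hol Ω (pot f)) {e : Tetrad}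
  {e₀ d₀ ω₀ : ℝ} {t r : ℝ → ℂ}

include hΩ hf

theorem KillingForm.zeta_eq {ξ : VField} {a d b : ℝ} (hξ : IsKilling f Ω ξ)
    (h : KillingForm f Ω ξ a d b) (he : e.IsInvariant f Ω) {p : Pt} (hp : p ∈ Ω) :
    ξ p 0 = pu a d p * zz f p - 2 * (a + Complex.I * b) * il f p := by
  have h2 := h.f2_eq hΩ hf hξ hp
  have h3 := he.f3_ne hΩ hf hp
  rw [zz, il]
  field_simp
  linear_combination h2

theorem KillingForm.rot_eq {ξ : VField} {a d b : ℝ} (hξ : IsKilling f Ω ξ)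
    (h : KillingForm f Ω ξ a d b) (he : e.IsInvariant f Ω) {p : Pt} (hp : p ∈ Ω) :
    Complex.I * b = pu a d p * pd 0 (zz f) p - 2 * (a + Complex.I * b) * pd 0 (il f) p := by
  have H := (((HasPD.pu a d p).mul ((hol_zz hΩ hf he).hasPD hΩ hp)).sub
    (((hol_il hΩ hf he).hasPD hΩ hp).const_mul (2 * (a + Complex.I * b)))).congr hΩ
    (fun q hq => h.zeta_eq hΩ hf hξ he hq) hp |>.eq 0
  rw [h.rot p hp] at H
  simp only [Matrix.cons_val] at H
  linear_combination H

/-- Choose c so that ξ and cV have the same u-component at one point. The defect κ = (a - c e₀) +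
i(b - c ω₀) then satisfies κ A* = -κ* there, hence κ(AA* - 1) = 0. As AA* ≠ 1, κ vanishes, and its
real and imaginary parts identify the parameters of ξ with those of cV. -/
theorem AffineSym.rigid (hs : AffineSym f Ω e₀ d₀ ω₀ t r) (he : e.IsInvariant f Ω)
    (h02 : e.IsType02 f Ω) (hV : ∀ p ∈ Ω, pu e₀ d₀ p ≠ 0) (hc : IsPreconnected Ω)
    (hne : Ω.Nonempty) {ξ : VField} (hξ : IsKilling f Ω ξ) :
    ∃ c : ℝ, ∀ p ∈ Ω, ξ p 2 = c * pu e₀ d₀ p ∧ ξ p 0 = c * (Complex.I * ω₀ * p.1) := by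
  obtain ⟨a, d, b, hF⟩ := hξ.exists_form hΩ hf hc hne fun p hp => he.f2_ne hΩ hf hp
  obtain ⟨p0, hp0⟩ := hne
  have h1 := hF.rot_eq hΩ hf hξ he hp0
  have h3 := (hs.pu_mul_pd_zz hΩ hf he hp0).1
  have hA := hs.A_mul_conj_ne hΩ hf he h02 hp0 (hV p0 hp0)
  rw [he.pd_il hΩ hf hp0] at h1 h3
  obtain ⟨c, hcdef⟩ : ∃ c : ℝ, pu a d p0 = c * pu e₀ d₀ p0 := by
    obtain ⟨c, hc⟩ := Complex.conj_eq_iff_real.1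
      (show conj (pu a d p0 / pu e₀ d₀ p0) = pu a d p0 / pu e₀ d₀ p0 by
        rw [map_div₀, conj_pu, conj_pu])
    exact ⟨c, by rw [← hc, div_mul_cancel₀ _ (hV p0 hp0)]⟩
  have hk : ((a - c * e₀ : ℝ) + Complex.I * (b - c * ω₀ : ℝ) : ℂ) = 0 := by
    set κ : ℂ := (a - c * e₀ : ℝ) + Complex.I * (b - c * ω₀ : ℝ) with hκ
    have hκ' : conj κ = (a - c * e₀ : ℝ) - Complex.I * (b - c * ω₀ : ℝ) := by
      rw [hκ]
      simp only [map_add, map_mul, Complex.conj_I, Complex.conj_ofReal]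
      ring
    have e1 : κ * conj (e.A f p0) = -conj κ := by
      rw [hκ', hκ]
      push_cast
      rw [hcdef] at h1
      linear_combination -2 * h1 - 2 * c * h3
    have e2 := congrArg conj e1
    simp only [map_mul, map_neg, Complex.conj_conj] at e2
    have e3 : κ * (e.A f p0 * conj (e.A f p0) - 1) = 0 := by
      linear_combination e.A f p0 * e1 - e2
    exact (mul_eq_zero.1 e3).resolve_right (sub_ne_zero.2 hA)
  have hre := congrArg Complex.re hk
  have him := congrArg Complex.im hk
  simp only [Complex.add_re, Complex.add_im, Complex.ofReal_re, Complex.ofReal_im, Complex.mul_re,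
    Complex.mul_im, Complex.I_re, Complex.I_im, Complex.zero_re, Complex.zero_im, zero_mul,
    one_mul, zero_sub, neg_zero, add_zero, zero_add] at hre him
  have ha : (a : ℂ) = c * e₀ := by
    rw [sub_eq_zero.1 hre]; push_cast; rfl
  have hb : (b : ℂ) = c * ω₀ := by
    rw [sub_eq_zero.1 him]; push_cast; rfl
  refine ⟨c, fun p hp => ?_⟩
  have hu : pu a d p = c * pu e₀ d₀ p := by
    simp only [pu, ha] at hcdef ⊢
    linear_combination hcdef
  refine ⟨by rw [hF.u_eq p hp, hu], ?_⟩
  rw [hF.zeta_eq hΩ hf hξ he hp, hu, ha, hb]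
  linear_combination c * hs.pu_mul_zz hΩ hf he hp

/-- Since L_ζ = -1/2, the rotation parameter drops out of `rot_eq`, leaving (a u + d) z_ζ = -a with
real a and d. As z_ζ is never real, a u + d and a vanish. -/
theorem AffineSym.rotation_rigid (hs : AffineSym f Ω 0 0 1 t r) (he : e.IsInvariant f Ω)
    (h02 : e.IsType02 f Ω) (hc : IsPreconnected Ω)
    (hne : Ω.Nonempty) {ξ : VField} (hξ : IsKilling f Ω ξ) :
    ∃ c : ℝ, ∀ p ∈ Ω, ξ p 2 = c * pu 0 0 p ∧
      ξ p 0 = c * (Complex.I * (1 : ℝ) * p.1) := by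
  obtain ⟨a, d, b, hF⟩ := hξ.exists_form hΩ hf hc hne fun p hp => he.f2_ne hΩ hf hp
  have hP : ∀ p ∈ Ω, pu a d p = 0 ∧ (a : ℂ) = 0 := fun p hp => by
    have h1 := hF.rot_eq hΩ hf hξ he hp
    rw [(hs.rotation_pd_il hΩ hf he hp).1] at h1
    have h2 : pu a d p * pd 0 (zz f) p = -a := by linear_combination -h1
    have h3 := congrArg conj h2
    rw [map_mul, conj_pu, map_neg, Complex.conj_ofReal] at h3
    have h4 : pu a d p = 0 := by
      refine (mul_eq_zero.1 (?_ : pu a d p * (conj (pd 0 (zz f) p) - pd 0 (zz f) p) = 0)).resolve_right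
        (sub_ne_zero.2 (hs.rotation_pd_zz_ne_conj hΩ hf he h02 hp))
      linear_combination h3 - h2
    refine ⟨h4, ?_⟩
    rw [h4] at h2
    linear_combination h2
  refine ⟨b, fun p hp => ?_⟩
  obtain ⟨h1, h2⟩ := hP p hp
  rw [hF.u_eq p hp, hF.zeta_eq hΩ hf hξ he hp, h1, h2, (hs.rotation_eq hΩ hf he hp).1]
  simp [pu]
  ring

end Rigidity


/-! ## The precursor classes -/

theorem mem_uRange {U : Set (ℂ × ℝ)} {p : Pt} (hp : p ∈ dom U) : p.2.1 ∈ uRange U :=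
  ⟨(p.1, p.2.1), hp, rfl⟩

theorem forall_uRange_iff {U : Set (ℂ × ℝ)} {q : ℝ → Prop} :
    (∀ u ∈ uRange U, q u) ↔ ∀ p ∈ dom U, q p.2.1 := by
  constructor
  · exact fun h p hp => h _ (mem_uRange hp)
  · rintro h _ ⟨⟨z, u⟩, hx, rfl⟩
    exact h (z, u, 0) hx

theorem isOpen_uRange {U : Set (ℂ × ℝ)} (hU : IsOpen U) : IsOpen (uRange U) := isOpenMap_snd U hU

theorem isPreconnected_uRange {U : Set (ℂ × ℝ)} (hU : IsConnected U) :
    IsPreconnected (uRange U) :=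
  hU.isPreconnected.image _ continuous_snd.continuousOn

theorem hasDerivAt_of_smooth {U : Set (ℂ × ℝ)} (hU : IsOpen U) {g : ℝ → ℂ}
    (hg : ContDiffOn ℝ ∞ g (uRange U)) {u : ℝ} (hu : u ∈ uRange U) :
    HasDerivAt g (deriv g u) u :=
  ((hg.contDiffAt ((isOpen_uRange hU).mem_nhds hu)).differentiableAt (by simp)).hasDerivAt

theorem smooth_of_u {U : Set (ℂ × ℝ)} {g : ℝ → ℂ} (hg : ContDiffOn ℝ ∞ g (uRange U)) :
    Smooth (dom U) (fun p => g p.2.1) :=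
  hg.comp (contDiff_fst.comp contDiff_snd).contDiffOn fun _ hp => mem_uRange hp

theorem contDiffOn_real_of_holomorphic {W : Set ℂ} (hW : IsOpen W) {F : ℂ → ℂ}
    (hF : DifferentiableOn ℂ F W) : ContDiffOn ℝ ∞ F W :=
  (hF.contDiffOn hW).restrict_scalars ℝ

/-- By `AffineSym.f1_eq`, r is an expression in f and V alone. Two representations of one potential
can thus be compared without relating their holomorphic parts. -/
theorem AffineSym.unique {f : ℂ → ℝ → ℂ} {Ω : Set Pt} (hΩ : IsOpen Ω) (hf : Hol Ω (pot f))
    {e₀ d₀ ω₀ : ℝ} {t r t' r' : ℝ → ℂ} (hs : AffineSym f Ω e₀ d₀ ω₀ t r)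
    (hs' : AffineSym f Ω e₀ d₀ ω₀ t' r') {p : Pt} (hp : p ∈ Ω) : r p.2.1 = r' p.2.1 :=
  (hs.f1_eq hΩ hf hp).symm.trans (hs'.f1_eq hΩ hf hp)

/-- The potential `D(u) (F(E(u) ζ) + g(u) E(u) ζ)` with factors `D`, `E` that are homogeneous under
`(e₀ u + d₀) ∂_u`. -/
structure Precursor (f : ℂ → ℝ → ℂ) (U : Set (ℂ × ℝ)) (W : Set ℂ) (e₀ d₀ ω₀ : ℝ) (D E : ℝ → ℂ)
    (F : ℂ → ℂ) (g : ℝ → ℂ) : Prop where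
  maps : ∀ x ∈ U, E x.2 * x.1 ∈ W
  hol : DifferentiableOn ℂ F W
  smooth_g : ContDiffOn ℝ ∞ g (uRange U)
  smooth_D : ContDiffOn ℝ ∞ D (uRange U)
  smooth_E : ContDiffOn ℝ ∞ E (uRange U)
  D_ne : ∀ u ∈ uRange U, D u ≠ 0
  E_ne : ∀ u ∈ uRange U, E u ≠ 0
  pu_ne : ∀ p ∈ dom U, pu e₀ d₀ p ≠ 0
  D_eq : ∀ p ∈ dom U, pu e₀ d₀ p * deriv D p.2.1 = -2 * e₀ * D p.2.1
  E_eq : ∀ p ∈ dom U, pu e₀ d₀ p * deriv E p.2.1 = -(Complex.I * ω₀) * E p.2.1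
  eq : ∀ x ∈ U, f x.1 x.2 = D x.2 * (F (E x.2 * x.1) + g x.2 * (E x.2 * x.1))

/-! ### Classes A, B and C treated uniformly. -/

section Precursor

variable {f : ℂ → ℝ → ℂ} {U : Set (ℂ × ℝ)} (hU : IsOpen U) {W : Set ℂ} (hW : IsOpen W)
  {e₀ d₀ ω₀ : ℝ} {D E : ℝ → ℂ} {F : ℂ → ℂ} {g : ℝ → ℂ}

include hU hW

theorem Precursor.hasPD (h : Precursor f U W e₀ d₀ ω₀ D E F g) {p : Pt} (hp : p ∈ dom U) :
    HasPD (pot f) ![D p.2.1 * (deriv F (E p.2.1 * p.1) + g p.2.1) * E p.2.1, 0,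
      deriv D p.2.1 * (F (E p.2.1 * p.1) + g p.2.1 * (E p.2.1 * p.1))
        + D p.2.1 * (deriv F (E p.2.1 * p.1) * deriv E p.2.1 * p.1
          + deriv g p.2.1 * (E p.2.1 * p.1) + g p.2.1 * (deriv E p.2.1 * p.1)), 0] p := by
  have hu := mem_uRange hp
  have hs := (HasPD.ofU (hasDerivAt_of_smooth hU h.smooth_E hu)).mul (HasPD.zeta p)
  have hF := hs.comp ((h.hol.differentiableAt (hW.mem_nhds (h.maps (p.1, p.2.1) hp))).hasDerivAt)
  have H := (HasPD.ofU (hasDerivAt_of_smooth hU h.smooth_D hu)).mul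
    (hF.add ((HasPD.ofU (hasDerivAt_of_smooth hU h.smooth_g hu)).mul hs))
  refine (H.congr (isOpen_dom hU) (ψ := pot f) (fun q hq => h.eq (q.1, q.2.1) hq) hp).change
    fun i => ?_
  fin_cases i <;> simp [-mul_eq_mul_left_iff] <;> ring

theorem Precursor.isHol (h : Precursor f U W e₀ d₀ ω₀ D E F g) : Hol (dom U) (pot f) := by
  have hs : Smooth (dom U) (fun p => E p.2.1 * p.1) :=
    (smooth_of_u h.smooth_E).mul contDiff_fst.contDiffOn
  have hF : Smooth (dom U) (fun p => F (E p.2.1 * p.1)) :=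
    (contDiffOn_real_of_holomorphic hW h.hol).comp hs fun p hp => h.maps (p.1, p.2.1) hp
  have hφ : Smooth (dom U) (pot f) :=
    ((smooth_of_u h.smooth_D).mul (hF.add ((smooth_of_u h.smooth_g).mul hs))).congr
      fun p hp => h.eq (p.1, p.2.1) hp
  exact Hol.of_hasPD hφ (fun p hp => h.hasPD hU hW hp) (fun _ _ => rfl) (fun _ _ => rfl)

/-- The product E(u)ζ is constant along V and D has weight -2e₀, so the term with F drops out. Only
the derivative of g survives, and it multiplies ζ. -/
theorem Precursor.affineSym (h : Precursor f U W e₀ d₀ ω₀ D E F g) :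
    AffineSym f (dom U) e₀ d₀ ω₀ (fun _ => 0)
      (fun u => D u * (e₀ * u + d₀) * deriv g u * E u) := by
  refine ⟨fun p hp => ?_, fun _ _ => differentiableAt_const _, fun p hp => ?_⟩
  · have H := h.hasPD hU hW hp
    rw [H.eq, f1, H.eq, pot, h.eq (p.1, p.2.1) hp]
    have hD := h.D_eq p hp
    have hE := h.E_eq p hp
    simp only [pu, Matrix.cons_val] at hD hE ⊢
    linear_combination (F (E p.2.1 * p.1) + g p.2.1 * (E p.2.1 * p.1)) * hD
      + (D p.2.1 * p.1 * (deriv F (E p.2.1 * p.1) + g p.2.1)) * hE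
  · have hu := mem_uRange hp
    have hg' : DifferentiableAt ℝ (deriv g) p.2.1 :=
      ((h.smooth_g.deriv_of_isOpen (m := ∞) (isOpen_uRange hU) (by simp)).contDiffAt
        ((isOpen_uRange hU).mem_nhds hu)).differentiableAt (by simp)
    have ho : DifferentiableAt ℝ (fun u : ℝ => (u : ℂ)) p.2.1 :=
      Complex.ofRealCLM.differentiableAt
    have hD := (hasDerivAt_of_smooth hU h.smooth_D hu).differentiableAt
    have hE := (hasDerivAt_of_smooth hU h.smooth_E hu).differentiableAt
    exact ((hD.mul ((ho.const_mul _).add_const _)).mul hg').mul hE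

omit hU hW in
theorem Precursor.deriv_iff (h : Precursor f U W e₀ d₀ ω₀ D E F g) :
    (∀ p ∈ dom U, D p.2.1 * (e₀ * p.2.1 + d₀) * deriv g p.2.1 * E p.2.1 = 0) ↔
      ∀ u ∈ uRange U, deriv g u = 0 := by
  rw [forall_uRange_iff]
  refine forall₂_congr fun p hp => ?_
  have h1 := h.D_ne _ (mem_uRange hp)
  have h2 := h.E_ne _ (mem_uRange hp)
  have h3 : (e₀ * p.2.1 + d₀ : ℂ) ≠ 0 := h.pu_ne p hp
  simp only [mul_eq_zero, h1, h2, h3, false_or, or_false]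

/-- A constant g is absorbed into F, using that the range of u is an interval. Conversely, a form
with G is itself a precursor with g = 0, and `AffineSym.unique` transfers r = 0 to the original one.
-/
theorem Precursor.homogeneous_iff (h : Precursor f U W e₀ d₀ ω₀ D E F g) (hc : IsConnected U) :
    (∀ u ∈ uRange U, deriv g u = 0) ↔ ∃ G : ℂ → ℂ, DifferentiableOn ℂ G W ∧
      ∀ x ∈ U, f x.1 x.2 = D x.2 * G (E x.2 * x.1) := by
  constructor
  · intro hg
    obtain ⟨x0, hx0⟩ := hc.nonempty
    have hu0 : x0.2 ∈ uRange U := ⟨x0, hx0, rfl⟩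
    have hgc : ∀ u ∈ uRange U, g u = g x0.2 := fun u hu =>
      (isOpen_uRange hU).is_const_of_deriv_eq_zero (isPreconnected_uRange hc)
        (fun v hv => (hasDerivAt_of_smooth hU h.smooth_g hv).differentiableAt.differentiableWithinAt)
        (fun v hv => hg v hv) hu hu0
    refine ⟨fun s => F s + g x0.2 * s, h.hol.add (by fun_prop), fun x hx => ?_⟩
    rw [h.eq x hx, hgc x.2 ⟨x, hx, rfl⟩]
  · rintro ⟨G, hG, hfG⟩
    have h' : Precursor f U W e₀ d₀ ω₀ D E G (fun _ => 0) :=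
      { h with
        hol := hG
        smooth_g := contDiffOn_const
        eq := fun x hx => by rw [hfG x hx, zero_mul, add_zero] }
    refine (h.deriv_iff).1 fun p hp => ?_
    rw [(h.affineSym hU hW).unique (isOpen_dom hU) (h.isHol hU hW) (h'.affineSym hU hW) hp]
    simp

theorem Precursor.isG2_iff (h : Precursor f U W e₀ d₀ ω₀ D E F g) (hc : IsConnected U)
    {e : Tetrad} (he : e.IsInvariant f (dom U)) (h02 : e.IsType02 f (dom U)) :
    IsG2 f U hU ↔ ∀ u ∈ uRange U, deriv g u = 0 := by
  have hs := h.affineSym hU hW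
  have hf := h.isHol hU hW
  have hΩ := isOpen_dom hU
  rw [hs.isG2_iff hU hf hc (fun p hp => he.f2_ne hΩ hf hp)
    (fun ξ hξ => hs.rigid hΩ hf he h02 h.pu_ne (isPreconnected_dom hc) (dom_nonempty hc) hξ)
    (fun p hp => Or.inl (h.pu_ne p hp))
    (fun _ => ⟨fun _ => 0, contDiffOn_const, fun p _ => by
      simpa using hasDerivAt_const p.2.1 (0 : ℝ)⟩)]
  exact h.deriv_iff

theorem Precursor.nuDependent_iff (h : Precursor f U W e₀ d₀ ω₀ D E F g)
    {e : Tetrad} (he : e.IsInvariant f (dom U)) (h02 : e.IsType02 f (dom U)) :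
    e.NuDependent f (dom U) ↔ ∀ u ∈ uRange U, deriv g u = 0 := by
  rw [(h.affineSym hU hW).nuDependent_iff (isOpen_dom hU) (h.isHol hU hW) he h02
    (fun p hp => Or.inl (h.pu_ne p hp))]
  exact h.deriv_iff

theorem Precursor.upsHat_iff (h : Precursor f U W e₀ d₀ ω₀ D E F g)
    {e : Tetrad} (he : e.IsInvariant f (dom U)) (h02 : e.IsType02 f (dom U))
    (hk : (e₀ - Complex.I * ω₀ : ℂ) ≠ 0) :
    (∀ p ∈ dom U, e.upsHat f p = 0) ↔ ∀ u ∈ uRange U, deriv g u = 0 := by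
  rw [(h.affineSym hU hW).upsHat_iff (isOpen_dom hU) (h.isHol hU hW) he h02 h.pu_ne hk]
  exact h.deriv_iff

end Precursor

theorem tfae_of_iff {a b c d e : Prop} (h1 : a ↔ d) (h2 : b ↔ d) (h3 : c ↔ d) (h4 : d ↔ e) :
    List.TFAE [a, b, c, d, e] := by
  tfae_have 1 ↔ 4 := h1
  tfae_have 2 ↔ 4 := h2
  tfae_have 3 ↔ 4 := h3
  tfae_have 4 ↔ 5 := h4
  tfae_finish

/-! ### The individual potentials as instances of the two schemes. -/

section Classes

variable {U : Set (ℂ × ℝ)} (hU : IsOpen U) (hUc : IsConnected U) {W : Set ℂ} (hW : IsOpen W)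

theorem contDiffOn_ofReal_cpow (c : ℂ) : ContDiffOn ℝ ∞ (fun u : ℝ => (u : ℂ) ^ c) (Set.Ioi 0) := by
  have h : DifferentiableOn ℂ (fun z : ℂ => z ^ c) Complex.slitPlane := fun z hz =>
    (differentiableAt_id.cpow_const hz).differentiableWithinAt
  exact (contDiffOn_real_of_holomorphic Complex.isOpen_slitPlane h).comp
    Complex.ofRealCLM.contDiff.contDiffOn fun u hu => Complex.ofReal_mem_slitPlane.2 hu

theorem mul_deriv_ofReal_cpow (c : ℂ) {u : ℝ} (hu : 0 < u) :
    (u : ℂ) * deriv (fun u : ℝ => (u : ℂ) ^ c) u = c * (u : ℂ) ^ c := by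
  have h := ((hasDerivAt_id (u : ℂ)).cpow_const (c := c)
    (Complex.ofReal_mem_slitPlane.2 hu)).comp_ofReal
  have hu' : (u : ℂ) ≠ 0 := Complex.ofReal_ne_zero.2 hu.ne'
  have h2 : deriv (fun u : ℝ => (u : ℂ) ^ c) u = c * (u : ℂ) ^ (c - 1) * 1 := h.deriv
  rw [h2, Complex.cpow_sub _ _ hu', Complex.cpow_one]
  field_simp

theorem precursor_potB {k : ℝ} {F : ℂ → ℂ} {g : ℝ → ℂ}
    (hmap : ∀ x ∈ U, 0 < x.2 ∧ (x.2 : ℂ) ^ (-(Complex.I * k)) * x.1 ∈ W)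
    (hF : DifferentiableOn ℂ F W) (hg : ContDiffOn ℝ ∞ g (uRange U)) :
    Precursor (potB k F g) U W 1 0 k (fun u => (u : ℂ) ^ (-2 : ℂ))
      (fun u => (u : ℂ) ^ (-(Complex.I * k))) F g := by
  have hpos : ∀ u ∈ uRange U, 0 < u := by
    rintro _ ⟨x, hx, rfl⟩
    exact (hmap x hx).1
  have hne : ∀ u ∈ uRange U, (u : ℂ) ≠ 0 := fun u hu => Complex.ofReal_ne_zero.2 (hpos u hu).ne'
  refine ⟨fun x hx => (hmap x hx).2, hF, hg, (contDiffOn_ofReal_cpow _).mono hpos,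
    (contDiffOn_ofReal_cpow _).mono hpos, fun u hu => ?_, fun u hu => ?_, fun p hp => ?_,
    fun p hp => ?_, fun p hp => ?_, fun x hx => ?_⟩
  · simp [Complex.cpow_eq_zero_iff, hne u hu]
  · simp [Complex.cpow_eq_zero_iff, hne u hu]
  · simpa [pu] using hne _ (mem_uRange hp)
  · have := mul_deriv_ofReal_cpow (-2) (hpos _ (mem_uRange hp))
    simp only [pu, Complex.ofReal_one, Complex.ofReal_zero, one_mul, add_zero, mul_one]
    exact this
  · have := mul_deriv_ofReal_cpow (-(Complex.I * k)) (hpos _ (mem_uRange hp))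
    simp only [pu, Complex.ofReal_one, Complex.ofReal_zero, one_mul, add_zero]
    exact this
  · have h0 := hne x.2 ⟨x, hx, rfl⟩
    rw [potB, show (-2 - Complex.I * k : ℂ) = -2 + -(Complex.I * k) by ring,
      Complex.cpow_add _ _ h0]
    ring

/-- The value ω₀ = -1 is the one for which ∂_u + iω₀ζ∂_ζ annihilates e^{iu}ζ. -/
theorem precursor_potC {F : ℂ → ℂ} {g : ℝ → ℂ}
    (hmap : ∀ x ∈ U, Complex.exp (Complex.I * x.2) * x.1 ∈ W)
    (hF : DifferentiableOn ℂ F W) (hg : ContDiffOn ℝ ∞ g (uRange U)) :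
    Precursor (potC F g) U W 0 1 (-1) (fun _ => 1)
      (fun u => Complex.exp (Complex.I * u)) F g := by
  have hE : ContDiff ℝ ∞ (fun u : ℝ => Complex.exp (Complex.I * u)) :=
    Complex.contDiff_exp.comp (contDiff_const.mul Complex.ofRealCLM.contDiff)
  refine ⟨hmap, hF, hg, contDiffOn_const, hE.contDiffOn, fun u _ => one_ne_zero,
    fun u _ => Complex.exp_ne_zero _, fun p _ => ?_, fun p _ => ?_, fun p _ => ?_,
    fun x _ => ?_⟩
  · simp [pu]
  · simp
  · have h : HasDerivAt (fun u : ℝ => Complex.exp (Complex.I * u)) _ p.2.1 :=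
      (((hasDerivAt_id (p.2.1 : ℂ)).const_mul Complex.I).cexp).comp_ofReal
    rw [h.deriv]
    simp [pu]
    ring
  · rw [potC]
    ring

theorem precursor_potA {F : ℂ → ℂ} {g : ℝ → ℂ} (hmap : ∀ x ∈ U, x.1 ∈ W)
    (hF : DifferentiableOn ℂ F W) (hg : ContDiffOn ℝ ∞ g (uRange U)) :
    Precursor (potA F g) U W 0 1 0 (fun _ => 1) (fun _ => 1) F g := by
  refine ⟨fun x hx => by simpa using hmap x hx, hF, hg, contDiffOn_const, contDiffOn_const,
    fun u _ => one_ne_zero, fun u _ => one_ne_zero, fun p _ => ?_, fun p _ => ?_, fun p _ => ?_,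
    fun x _ => ?_⟩
  · simp [pu]
  · simp
  · simp
  · simp [potA]

theorem hasDerivAt_log_branch (hW : IsOpen W) {lg : ℂ → ℂ} (hlg : ContinuousOn lg W)
    (hexp : ∀ ζ ∈ W, Complex.exp (lg ζ) = ζ) {ζ : ℂ} (hζ : ζ ∈ W) : HasDerivAt lg ζ⁻¹ ζ := by
  have h := Complex.hasDerivAt_exp (lg ζ)
  rw [hexp ζ hζ] at h
  have h0 : ζ ≠ 0 := by
    rw [← hexp ζ hζ]
    exact Complex.exp_ne_zero _
  refine h.of_local_left_inverse (hlg.continuousAt (hW.mem_nhds hζ)) h0 ?_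
  filter_upwards [hW.mem_nhds hζ] with z hz using hexp z hz

/-- The potential of a logarithmic pp-wave with affine term. -/
structure LogPotential (f : ℂ → ℝ → ℂ) (U : Set (ℂ × ℝ)) (W : Set ℂ) (lg : ℂ → ℂ)
    (g₁ g₂ : ℝ → ℂ) : Prop where
  maps : ∀ x ∈ U, x.1 ∈ W
  cont : ContinuousOn lg W
  exp_lg : ∀ ζ ∈ W, Complex.exp (lg ζ) = ζ
  smooth₁ : ContDiffOn ℝ ∞ g₁ (uRange U)
  smooth₂ : ContDiffOn ℝ ∞ g₂ (uRange U)
  eq : ∀ x ∈ U, f x.1 x.2 = g₁ x.2 * lg x.1 + g₂ x.2 * x.1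

section Log

variable {f : ℂ → ℝ → ℂ} {lg : ℂ → ℂ} {g₁ g₂ : ℝ → ℂ}

include hU hW

theorem LogPotential.hasPD (h : LogPotential f U W lg g₁ g₂) {p : Pt} (hp : p ∈ dom U) :
    HasPD (pot f) ![g₁ p.2.1 * p.1⁻¹ + g₂ p.2.1, 0,
      deriv g₁ p.2.1 * lg p.1 + deriv g₂ p.2.1 * p.1, 0] p := by
  have hu := mem_uRange hp
  have hl := (HasPD.zeta p).comp
    (hasDerivAt_log_branch hW h.cont h.exp_lg (h.maps (p.1, p.2.1) hp))
  have H := ((HasPD.ofU (hasDerivAt_of_smooth hU h.smooth₁ hu)).mul hl).add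
    ((HasPD.ofU (hasDerivAt_of_smooth hU h.smooth₂ hu)).mul (HasPD.zeta p))
  refine (H.congr (isOpen_dom hU) (ψ := pot f) (fun q hq => h.eq (q.1, q.2.1) hq) hp).change
    fun i => ?_
  fin_cases i <;> simp

theorem LogPotential.isHol (h : LogPotential f U W lg g₁ g₂) : Hol (dom U) (pot f) := by
  have hlg : DifferentiableOn ℂ lg W := fun z hz =>
    (hasDerivAt_log_branch hW h.cont h.exp_lg hz).differentiableAt.differentiableWithinAt
  have hl : Smooth (dom U) (fun p => lg p.1) :=
    (contDiffOn_real_of_holomorphic hW hlg).comp contDiff_fst.contDiffOn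
      fun p hp => h.maps (p.1, p.2.1) hp
  have hφ : Smooth (dom U) (pot f) :=
    (((smooth_of_u h.smooth₁).mul hl).add
      ((smooth_of_u h.smooth₂).mul contDiff_fst.contDiffOn)).congr
      fun p hp => h.eq (p.1, p.2.1) hp
  exact Hol.of_hasPD hφ (fun p hp => h.hasPD hU hW hp) (fun _ _ => rfl) (fun _ _ => rfl)

/-- Rotation acts on log ζ by adding a constant, iζ∂_ζ log ζ = i, so the logarithmic term
contributes only to t. The coordinate u is merely a parameter. -/
theorem LogPotential.affineSym (h : LogPotential f U W lg g₁ g₂) :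
    AffineSym f (dom U) 0 0 1 (fun u => Complex.I * g₁ u) (fun u => Complex.I * g₂ u) := by
  refine ⟨fun p hp => ?_, fun p hp => ?_, fun p hp => ?_⟩
  · have H := h.hasPD hU hW hp
    have h0 : p.1 ≠ 0 := by
      rw [← h.exp_lg _ (h.maps (p.1, p.2.1) hp)]
      exact Complex.exp_ne_zero _
    rw [f1, H.eq, H.eq]
    simp [pu]
    field_simp
  · exact (hasDerivAt_of_smooth hU h.smooth₁ (mem_uRange hp)).differentiableAt.const_mul _
  · exact (hasDerivAt_of_smooth hU h.smooth₂ (mem_uRange hp)).differentiableAt.const_mul _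

omit hW in
-- Needed because t = i g₁ need not vanish in class L: the rotation becomes Killing only after
-- adding s(u)∂_v with s' = -Re t = Im g₁.
theorem exists_primitive (hUc : IsConnected U) {g : ℝ → ℝ} (hg : ContDiffOn ℝ ∞ g (uRange U)) :
    ∃ s : ℝ → ℝ, ContDiffOn ℝ ∞ s (uRange U) ∧ ∀ u ∈ uRange U, HasDerivAt s (g u) u := by
  obtain ⟨x0, hx0⟩ := hUc.nonempty
  have hu0 : x0.2 ∈ uRange U := ⟨x0, hx0, rfl⟩
  have hJ := isOpen_uRange hU
  have hd : ∀ u ∈ uRange U, HasDerivAt (fun u => ∫ x in x0.2..u, g x) (g u) u := fun u hu => by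
    have hsub : Set.uIcc x0.2 u ⊆ uRange U :=
      (isPreconnected_uRange hUc).ordConnected.uIcc_subset hu0 hu
    refine intervalIntegral.integral_hasDerivAt_right
      (hg.continuousOn.mono hsub).intervalIntegrable
      (hg.continuousOn.stronglyMeasurableAtFilter hJ u hu)
      (hg.continuousOn.continuousAt (hJ.mem_nhds hu))
  refine ⟨_, ?_, hd⟩
  refine (contDiffOn_infty_iff_deriv_of_isOpen hJ).2
    ⟨fun u hu => (hd u hu).differentiableAt.differentiableWithinAt, ?_⟩
  exact hg.congr fun u hu => (hd u hu).deriv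

omit hW hU in
theorem I_mul_eq_zero_iff : (∀ p ∈ dom U, Complex.I * g₂ p.2.1 = 0) ↔ ∀ u ∈ uRange U, g₂ u = 0 := by
  rw [forall_uRange_iff]
  simp

theorem LogPotential.isG2_iff (h : LogPotential f U W lg g₁ g₂) (hUc : IsConnected U) {e : Tetrad}
    (he : e.IsInvariant f (dom U)) (h02 : e.IsType02 f (dom U)) :
    IsG2 f U hU ↔ ∀ u ∈ uRange U, g₂ u = 0 := by
  have hs := h.affineSym hU hW
  have hf := h.isHol hU hW
  have hΩ := isOpen_dom hU
  rw [hs.isG2_iff hU hf hUc (fun p hp => he.f2_ne hΩ hf hp)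
    (fun ξ hξ => hs.rotation_rigid hΩ hf he h02 (isPreconnected_dom hUc) (dom_nonempty hUc) hξ)
    (fun p hp => Or.inr (by simpa using hs.rotation_zeta_ne hΩ hf he hp)) (fun _ => ?_)]
  · exact I_mul_eq_zero_iff
  · obtain ⟨s, h1, h2⟩ := exists_primitive hU hUc
      (g := fun u => (g₁ u).im) (Complex.imCLM.contDiff.comp_contDiffOn h.smooth₁)
    exact ⟨s, h1, fun p hp => by simpa using h2 _ (mem_uRange hp)⟩

theorem LogPotential.homogeneous_iff (h : LogPotential f U W lg g₁ g₂) :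
    (∀ u ∈ uRange U, g₂ u = 0) ↔ ∃ g : ℝ → ℂ, ContDiffOn ℝ ∞ g (uRange U) ∧
      ∀ x ∈ U, f x.1 x.2 = g x.2 * lg x.1 := by
  constructor
  · intro h0
    exact ⟨g₁, h.smooth₁, fun x hx => by
      rw [h.eq x hx, h0 x.2 ⟨x, hx, rfl⟩, zero_mul, add_zero]⟩
  · rintro ⟨g, hg, hfg⟩
    have h' : LogPotential f U W lg g (fun _ => 0) :=
      { h with
        smooth₁ := hg
        smooth₂ := contDiffOn_const
        eq := fun x hx => by rw [hfg x hx, zero_mul, add_zero] }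
    refine I_mul_eq_zero_iff.1 fun p hp => ?_
    rw [(h.affineSym hU hW).unique (isOpen_dom hU) (h.isHol hU hW) (h'.affineSym hU hW) hp]
    simp

end Log

end Classes

end PPWave

end

open PPWave in
theorem proposition6p4
    (U : Set (ℂ × ℝ)) (hU : IsOpen U) (hUc : IsConnected U) (W : Set ℂ) (hW : IsOpen W) :
    -- class B
    (∀ (k : ℝ) (F : ℂ → ℂ) (g : ℝ → ℂ) (e : Tetrad),
      (∀ x ∈ U, 0 < x.2 ∧ (x.2 : ℂ) ^ (-(Complex.I * k)) * x.1 ∈ W) →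
      DifferentiableOn ℂ F W → ContDiffOn ℝ ∞ g (uRange U) →
      e.IsInvariant (potB k F g) (dom U) → e.IsType02 (potB k F g) (dom U) →
      (∀ p ∈ dom U,
        (e.B (potB k F g) p).re ≠ 0 ∧
        (e.B (potB k F g) p).im / (e.B (potB k F g) p).re = k ∧
        act e.n (e.X1 (potB k F g)) p = 2 * e.X1 (potB k F g) p ^ 2 ∧
        e.A (potB k F g) p * conj (e.A (potB k F g) p) ≠ 1) ∧
      List.TFAE [
        IsG2 (potB k F g) U hU,
        e.NuDependent (potB k F g) (dom U),
        ∀ p ∈ dom U, e.upsHat (potB k F g) p = 0,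
        ∀ u ∈ uRange U, deriv g u = 0,
        ∃ G : ℂ → ℂ, DifferentiableOn ℂ G W ∧
          ∀ x ∈ U, potB k F g x.1 x.2
            = G ((x.2 : ℂ) ^ (-(Complex.I * k)) * x.1) * (x.2 : ℂ) ^ (-2 : ℂ)]) ∧
    -- class C
    (∀ (F : ℂ → ℂ) (g : ℝ → ℂ) (e : Tetrad),
      (∀ x ∈ U, Complex.exp (Complex.I * x.2) * x.1 ∈ W) →
      DifferentiableOn ℂ F W → ContDiffOn ℝ ∞ g (uRange U) →
      e.IsInvariant (potC F g) (dom U) → e.IsType02 (potC F g) (dom U) →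
      (∀ p ∈ dom U,
        (e.B (potC F g) p).re = 0 ∧
        act e.n (e.X2 (potC F g)) p = 0 ∧
        e.mu (potC F g) p ≠ 0 ∧
        e.A (potC F g) p * conj (e.A (potC F g) p) ≠ 1) ∧
      List.TFAE [
        IsG2 (potC F g) U hU,
        e.NuDependent (potC F g) (dom U),
        ∀ p ∈ dom U, e.upsHat (potC F g) p = 0,
        ∀ u ∈ uRange U, deriv g u = 0,
        ∃ G : ℂ → ℂ, DifferentiableOn ℂ G W ∧
          ∀ x ∈ U, potC F g x.1 x.2 = G (Complex.exp (Complex.I * x.2) * x.1)]) ∧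
    -- class L
    (∀ (lg : ℂ → ℂ) (g₁ g₂ : ℝ → ℂ) (e : Tetrad),
      (∀ x ∈ U, x.1 ∈ W) →
      ContinuousOn lg W → (∀ ζ ∈ W, Complex.exp (lg ζ) = ζ) →
      ContDiffOn ℝ ∞ g₁ (uRange U) → ContDiffOn ℝ ∞ g₂ (uRange U) →
      e.IsInvariant (potL lg g₁ g₂) (dom U) → e.IsType02 (potL lg g₁ g₂) (dom U) →
      (∀ p ∈ dom U, e.A (potL lg g₁ g₂) p = 1) ∧
      List.TFAE [
        IsG2 (potL lg g₁ g₂) U hU,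
        e.NuDependent (potL lg g₁ g₂) (dom U),
        ∀ p ∈ dom U, e.Y (potL lg g₁ g₂) p = 0,
        ∀ u ∈ uRange U, g₂ u = 0,
        ∃ g : ℝ → ℂ, ContDiffOn ℝ ∞ g (uRange U) ∧
          ∀ x ∈ U, potL lg g₁ g₂ x.1 x.2 = g x.2 * lg x.1]) ∧
    -- class A
    (∀ (F : ℂ → ℂ) (g : ℝ → ℂ) (e : Tetrad),
      (∀ x ∈ U, x.1 ∈ W) →
      DifferentiableOn ℂ F W → ContDiffOn ℝ ∞ g (uRange U) →
      e.IsInvariant (potA F g) (dom U) → e.IsType02 (potA F g) (dom U) →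
      (∀ p ∈ dom U, e.mu (potA F g) p = 0) ∧
      List.TFAE [
        IsG2 (potA F g) U hU,
        e.NuDependent (potA F g) (dom U),
        ∀ p ∈ dom U, act e.n (e.nu (potA F g)) p = 0,
        ∀ u ∈ uRange U, deriv g u = 0,
        ∃ G : ℂ → ℂ, DifferentiableOn ℂ G W ∧
          ∀ x ∈ U, potA F g x.1 x.2 = G x.1]) := by
  have hΩ := isOpen_dom hU
  refine ⟨fun k F g e hmap hF hg he h02 => ?_, fun F g e hmap hF hg he h02 => ?_,
    fun lg g₁ g₂ e hmap hlg hexp hg₁ hg₂ he h02 => ?_, fun F g e hmap hF hg he h02 => ?_⟩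
  · have h := precursor_potB hmap hF hg
    have hf := h.isHol hU hW
    have hs := h.affineSym hU hW
    refine ⟨fun p hp => ?_, tfae_of_iff (h.isG2_iff hU hW hUc he h02)
      (h.nuDependent_iff hU hW he h02) (h.upsHat_iff hU hW he h02 fun h0 => ?_) ?_⟩
    · obtain ⟨s, hs0, hB⟩ := hs.B_real_multiple hΩ hf he h02 hp (h.pu_ne p hp)
      have hre : (e.B (potB k F g) p).re = s := by rw [hB]; simp
      have him : (e.B (potB k F g) p).im = s * k := by rw [hB]; simp
      refine ⟨hre ▸ hs0, ?_, hs.act_X1 hΩ hf he h02 h.pu_ne hp,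
        hs.A_mul_conj_ne hΩ hf he h02 hp (h.pu_ne p hp)⟩
      rw [hre, him]
      field_simp
    · simpa using congrArg Complex.re h0
    · simpa only [mul_comm] using h.homogeneous_iff hU hW hUc
  · have h := precursor_potC hmap hF hg
    have hf := h.isHol hU hW
    have hs := h.affineSym hU hW
    refine ⟨fun p hp => ?_, tfae_of_iff (h.isG2_iff hU hW hUc he h02)
      (h.nuDependent_iff hU hW he h02) (h.upsHat_iff hU hW he h02 (by simp)) ?_⟩
    · obtain ⟨s, hs0, hB⟩ := hs.B_real_multiple hΩ hf he h02 hp (h.pu_ne p hp)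
      refine ⟨by rw [hB]; simp, hs.act_X2 hΩ hf he h02 h.pu_ne hp rfl, fun hmu => ?_,
        hs.A_mul_conj_ne hΩ hf he h02 hp (h.pu_ne p hp)⟩
      -- If μ vanished, B = μA - μ* would vanish too, but B is a nonzero real multiple of -i.
      rw [Tetrad.B, hmu] at hB
      simp [hs0] at hB
    · simpa only [one_mul] using h.homogeneous_iff hU hW hUc
  · have h : LogPotential (potL lg g₁ g₂) U W lg g₁ g₂ :=
      ⟨hmap, hlg, hexp, hg₁, hg₂, fun _ _ => rfl⟩
    have hf := h.isHol hU hW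
    have hs := h.affineSym hU hW
    exact ⟨fun p hp => hs.rotation_A hΩ hf he hp, tfae_of_iff (h.isG2_iff hU hW hUc he h02)
      ((hs.nuDependent_iff hΩ hf he h02 fun p hp =>
        Or.inr (by simpa using hs.rotation_zeta_ne hΩ hf he hp)).trans I_mul_eq_zero_iff)
      ((hs.Y_iff hΩ hf he).trans I_mul_eq_zero_iff) (h.homogeneous_iff hU hW)⟩
  · have h := precursor_potA hmap hF hg
    have hf := h.isHol hU hW
    have hs := h.affineSym hU hW
    obtain ⟨hmu, hnu⟩ := hs.act_nu_iff hΩ hf he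
    refine ⟨hmu, tfae_of_iff (h.isG2_iff hU hW hUc he h02)
      (h.nuDependent_iff hU hW he h02) (hnu.trans (h.deriv_iff)) ?_⟩
    simpa only [one_mul] using h.homogeneous_iff hU hW hUc
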